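/- Let $\mathbb T=\mathbb R/\mathbb Z$ with Lebesgue probability measure and its usual distance, and let $\mathbb T^2$ carry the product measure. A dyadic interval is $I=[2^{-k}j,2^{-k}(j+1)]\subset\mathbb T$ with $k\ge 1$ and $0\le j<2^k$, and $|I|=2^{-k}$. A family $\{\varphi_I\}$ of smooth functions $\mathbb T\to\mathbb C$ indexed by the dyadic intervals is called adapted with constants $C_m>0$ if for all $I$, all $x\in\mathbb T$ and all $m\in\mathbb N$ $$|\varphi_I(x)|\le C_m\Big(1+\tfrac{\operatorname{dist}(x,I)}{|I|}\Big)^{-m},\qquad |\varphi_I'(x)|\le \tfrac{C_m}{|I|}\Big(1+\tfrac{\operatorname{dist}(x,I)}{|I|}\Big)^{-m};$$ it has mean zero if $\int_{\mathbb T}\varphi_I=0$ for all $I$. Given two adapted families $\{\varphi^1_I\}$, $\{\varphi^2_J\}$, put, for $R=I\times J$, $|R|=|I||J|$, $\phi_R(x,y)=|R|^{-1/2}\varphi^1_I(x)\varphi^2_J(y)$ and $\langle \phi_R,f\rangle=\int_{\mathbb T^2}\phi_R\overline f$. For $f:\mathbb T^2\to\mathbb C$ define $$MMf(x,y)=\sup_R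 \frac{|\langle\phi_R,f\rangle|}{|R|^{1/2}}\chi_R(x,y);$$ if $\{\varphi_J^2\}$ has mean zero, $$MSf(x,y)=\sup_I\frac1{|I|^{1/2}}\Big(\sum_J\frac{|\langle\phi_R,f\rangle|^2}{|J|}\chi_J(y)\Big)^{1/2}\chi_I(x);$$ if $\{\varphi_I^1\}$ has mean zero, $$SMf(x,y)=\Big(\sum_I\frac{\big(\sup_J|J|^{-1/2}|\langle\phi_R,f\rangle|\chi_J(y)\big)^2}{|I|}\chi_I(x)\Big)^{1/2};$$ and, if both families have mean zero, $$SSf(x,y)=\Big(\sum_R\frac{|\langle\phi_R,f\rangle|^2}{|R|}\chi_R(x,y)\Big)^{1/2}.$$ Let $f^*(t)=\inf\{\lambda\ge0:|\{|f|>\lambda\}|\le t\}$, $f^{**}(t)=\frac1t\int_0^tf^*(s)\,ds$, $\|f\|_{L\log L}=\int_0^1f^{**}(t)\,dt$, let $L\log L(\mathbb T^2)$ be the space of measurable $f$ with $\|f\|_{L\log L}<\infty$, and let $\|g\|_{1,\infty}=\sup_{\lambda>0}\lambda\,|\{|g|>\lambda\}|$. Then each operator $T\in\{MM,MS,SM,SS\}$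 (under the corresponding mean-zero condition) maps $L^p(\mathbb T^2)$ boundedly to $L^p(\mathbb T^2)$ for every $1<p<\infty$, and $L\log L(\mathbb T^2)$ boundedly to $L^{1,\infty}(\mathbb T^2)$: there are constants $K_p$, depending only on $p$ and the adaptation constants of the two families, and $K$, depending only on these adaptation constants, such that $$\|Tf\|_p\le K_p\|f\|_p\quad (f\in L^p(\mathbb T^2)),\qquad \|Tf\|_{1,\infty}\le K\|f\|_{L\log L}\quad (f\in L\log L(\mathbb T^2)).$$ -/

import Mathlib

open MeasureTheory
open scoped ENNReal NNReal ComplexConjugate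

noncomputable section

namespace HybridMaxSquare

/-- The two-dimensional torus `𝕋² = ℝ²/ℤ²`; its `volume` is the product of the two
normalized Lebesgue (Haar) measures. -/
abbrev Torus2 : Type := UnitAddCircle × UnitAddCircle

/-- Dyadic intervals of the circle, indexed by their scale `k ≥ 1` and position `0 ≤ j < 2 ^ k`:
the pair `(k, j)` stands for `[2⁻ᵏ j, 2⁻ᵏ (j + 1)]`.  Different pairs give different subsets of
the circle, and the circle itself is not a dyadic interval. -/
abbrev DyadicInterval : Type := Σ k : ℕ+, Fin (2 ^ (k : ℕ))

/-- The length `|I| = 2⁻ᵏ`. -/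
def len (I : DyadicInterval) : ℝ := ((2 : ℝ) ^ (I.1 : ℕ))⁻¹

/-- The closed subset of the circle underlying a dyadic interval. -/
def arc (I : DyadicInterval) : Set UnitAddCircle :=
  (fun x : ℝ => (x : UnitAddCircle)) ''
    Set.Icc (len I * ((I.2 : ℕ) : ℝ)) (len I * (((I.2 : ℕ) : ℝ) + 1))

/-- `φ : 𝕋 → ℂ` is smooth and adapted to `I` with constants `C m > 0`.  Smoothness and the
derivative are those of the 1-periodic function on `ℝ` given by `φ`. -/
structure IsAdapted (C : ℕ → ℝ) (I : DyadicInterval) (φ : UnitAddCircle → ℂ) : Prop where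
  const_pos : ∀ m, 0 < C m
  smooth : ContDiff ℝ ((⊤ : ℕ∞) : WithTop ℕ∞) (fun x : ℝ => φ (x : UnitAddCircle))
  bound : ∀ (m : ℕ) (x : UnitAddCircle),
    ‖φ x‖ ≤ C m / (1 + Metric.infDist x (arc I) / len I) ^ m
  deriv_bound : ∀ (m : ℕ) (x : ℝ),
    ‖deriv (fun t : ℝ => φ (t : UnitAddCircle)) x‖ ≤
      C m * (1 / len I) / (1 + Metric.infDist (x : UnitAddCircle) (arc I) / len I) ^ m

/-- An adapted family: each `φ I` is adapted to `I`, with the same constants for all `I`. -/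
def IsAdaptedFamily (C : ℕ → ℝ) (φ : DyadicInterval → UnitAddCircle → ℂ) : Prop :=
  ∀ I, IsAdapted C I (φ I)

/-- Every member of the family has integral zero. -/
def ZeroMean (φ : DyadicInterval → UnitAddCircle → ℂ) : Prop :=
  ∀ I, ∫ x, φ I x = 0

/-- The `L²`-normalized tensor product `|R|^(-1/2) φ¹_I(x) φ²_J(y)`, where `R = I × J`. -/
def tensor (φ₁ φ₂ : DyadicInterval → UnitAddCircle → ℂ) (I J : DyadicInterval) (z : Torus2) : ℂ :=
  ((1 / √(len I * len J) : ℝ) : ℂ) * (φ₁ I z.1 * φ₂ J z.2)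

/-- The inner product `⟨φ_R, f⟩ = ∫ φ_R · conj f` with the `L²`-normalized tensor product. -/
def coeff (φ₁ φ₂ : DyadicInterval → UnitAddCircle → ℂ) (f : Torus2 → ℂ) (I J : DyadicInterval) : ℂ :=
  ∫ z, tensor φ₁ φ₂ I J z * conj (f z)

/-- The characteristic function of a dyadic interval. -/
def chi (I : DyadicInterval) (x : UnitAddCircle) : ℝ≥0∞ := (arc I).indicator 1 x

/-- `MM f (x, y) = sup_R |R|^(-1/2) |⟨φ_R, f⟩| χ_R(x, y)`. -/
def MM (φ₁ φ₂ : DyadicInterval → UnitAddCircle → ℂ) (f : Torus2 → ℂ) (z : Torus2) : ℝ≥0∞ :=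
  ⨆ R : DyadicInterval × DyadicInterval,
    ENNReal.ofReal (‖coeff φ₁ φ₂ f R.1 R.2‖ / √(len R.1 * len R.2)) *
      (chi R.1 z.1 * chi R.2 z.2)

/-- `MS f (x, y) = sup_I |I|^(-1/2) (∑_J |⟨φ_R, f⟩|² / |J| χ_J(y))^(1/2) χ_I(x)`. -/
def MS (φ₁ φ₂ : DyadicInterval → UnitAddCircle → ℂ) (f : Torus2 → ℂ) (z : Torus2) : ℝ≥0∞ :=
  ⨆ I : DyadicInterval,
    ENNReal.ofReal (1 / √(len I)) *
      (∑' J : DyadicInterval, ENNReal.ofReal (‖coeff φ₁ φ₂ f I J‖ ^ 2 / len J) * chi J z.2) ^ (1 / 2 : ℝ) *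
      chi I z.1

/-- `SM f (x, y) = (∑_I (sup_J |J|^(-1/2) |⟨φ_R, f⟩| χ_J(y))² / |I| χ_I(x))^(1/2)`. -/
def SM (φ₁ φ₂ : DyadicInterval → UnitAddCircle → ℂ) (f : Torus2 → ℂ) (z : Torus2) : ℝ≥0∞ :=
  (∑' I : DyadicInterval,
    ENNReal.ofReal (1 / len I) *
      (⨆ J : DyadicInterval, ENNReal.ofReal (‖coeff φ₁ φ₂ f I J‖ / √(len J)) * chi J z.2) ^ 2 *
      chi I z.1) ^ (1 / 2 : ℝ)

/-- `SS f (x, y) = (∑_R |⟨φ_R, f⟩|² / |R| χ_R(x, y))^(1/2)`. -/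
def SS (φ₁ φ₂ : DyadicInterval → UnitAddCircle → ℂ) (f : Torus2 → ℂ) (z : Torus2) : ℝ≥0∞ :=
  (∑' R : DyadicInterval × DyadicInterval,
    ENNReal.ofReal (‖coeff φ₁ φ₂ f R.1 R.2‖ ^ 2 / (len R.1 * len R.2)) *
      (chi R.1 z.1 * chi R.2 z.2)) ^ (1 / 2 : ℝ)

/-- The decreasing rearrangement `f*(t) = inf {λ ≥ 0 : μ {|f| > λ} ≤ t}` (with `inf ∅ = ∞`). -/
def rearr {X : Type*} [MeasurableSpace X] (μ : Measure X) (f : X → ℂ) (t : ℝ) : ℝ≥0∞ :=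
  ⨅ (l : ℝ≥0) (_ : μ {x | (l : ℝ) < ‖f x‖} ≤ ENNReal.ofReal t), (l : ℝ≥0∞)

/-- `f**(t) = (1 / t) ∫₀ᵗ f*(s) ds`, for `t > 0`. -/
def rearr2 {X : Type*} [MeasurableSpace X] (μ : Measure X) (f : X → ℂ) (t : ℝ) : ℝ≥0∞ :=
  ENNReal.ofReal (1 / t) * ∫⁻ s in Set.Ioc 0 t, rearr μ f s

/-- The Zygmund norm `‖f‖_{L log L} = ∫₀¹ f**(t) dt`, for a probability measure. -/
def LlogLNorm {X : Type*} [MeasurableSpace X] (μ : Measure X) (f : X → ℂ) : ℝ≥0∞ :=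
  ∫⁻ t in Set.Ioc (0 : ℝ) 1, rearr2 μ f t

/-- Membership in the Zygmund space `L log L`. -/
def MemLlogL {X : Type*} [MeasurableSpace X] (μ : Measure X) (f : X → ℂ) : Prop :=
  AEStronglyMeasurable f μ ∧ LlogLNorm μ f < ⊤

/-- The quasi-norm `‖g‖_{1,∞} = sup_{λ > 0} λ μ {g > λ}` of a nonnegative function. -/
def weakL1Norm {X : Type*} [MeasurableSpace X] (μ : Measure X) (g : X → ℝ≥0∞) : ℝ≥0∞ :=
  ⨆ (l : ℝ≥0) (_ : 0 < l), (l : ℝ≥0∞) * μ {x | (l : ℝ≥0∞) < g x}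

/-- `T` maps `L^p(𝕋²)` to `L^p(𝕋²)` boundedly, with constant `K`. -/
def BoundedLp (p : ℝ≥0∞) (K : ℝ≥0) (T : (Torus2 → ℂ) → Torus2 → ℝ≥0∞) : Prop :=
  ∀ f : Torus2 → ℂ, MemLp f p volume →
    MemLp (T f) p volume ∧ eLpNorm (T f) p volume ≤ K * eLpNorm f p volume

/-- `T` maps `L log L(𝕋²)` to `L^{1,∞}(𝕋²)` boundedly, with constant `K`. -/
def BoundedLlogLWeakL1 (K : ℝ≥0) (T : (Torus2 → ℂ) → Torus2 → ℝ≥0∞) : Prop :=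
  ∀ f : Torus2 → ℂ, MemLlogL volume f →
    AEMeasurable (T f) volume ∧ weakL1Norm volume (T f) ≤ K * LlogLNorm volume f

end HybridMaxSquare

end

noncomputable section

namespace HybridMaxSquare


/-! ### Geometry of the dyadic intervals -/

/-! Everything reduces to two operators on the circle, applied in one variable after the other: the
maximal function `Mx`, which takes means against the quadratically decaying weights `om`, and the
square function `Sq` of a mean-zero adapted family, acting on functions with values in a Hilbert
space. Integrating out one variable first gives `MM f ≤ C Mx_x Mx_y f`, and Minkowski's inequality
gives `MS f ≤ C Mx_x Sq_y f`. In `SM` the supremum over `J` sits inside the sum over `I`, so the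
vector-valued maximal inequality `controlled_l2_Mx` is applied in `y` to the terms of `Sq_x f`. In
`SS`, for fixed `y` and a finite set of `J`, the sum over `I` is `Sq` in `x` of a vector of slice
coefficients (`partialSS_eq_Sq`), and a supremum over finite sets recovers the operator.

The property that travels through this iteration is `Controlled`: all `L^p` bounds together with the
distributional inequality `WeakDist`, which is what weak (1,1) and strong (2,2) bounds yield once
the input is split at height `t`. `WeakDist` implies the `L^p` bounds for `1 < p < 2`, the weak
(1,1) bound (`WeakDist.weak`), and a bound from `L log L` to `L¹` (`WeakDist.lintegral_le`). It is
an inequality between integrals, so it passes from slices to the product (`Controlled.prod`). At the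
endpoint the first operator maps `L log L` to `L¹` and the second maps `L¹` to `L^{1,∞}`;
`Admissible` packages this composition. For the `L log L` step, Chebyshev gives `μ{|f| > t} ≤ M/t`,
so the large part of `f` has integral at most that of `f*` over `(0, M/t)`, and the substitution `s
= M/t` turns the `dt/t` integral into the integral of `f**`.

On the circle the main tool is stopping at the maximal dyadic intervals `Q` where the mean of the
input exceeds `t`. Seen from outside the enlargement `star Q`, the input may be replaced on `Q` by
its mean: for `Mx` because the weights are nearly constant on `Q` (`Mx_le_condAvg`), for `Sq`
because the mean-zero remainder has a summable effect (`setLIntegral_Sq_le_of_cancel`). The averaged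
function is bounded by `2t` and is handled in `L²`. For `Sq` the `L²` bound is Bessel's inequality,
from almost orthogonality and a Schur test.

For `p > 2` one proves weighted `L²` inequalities and dualizes (`lintegral_rpow_le_of_weighted`).
For maximal functions the weighted bound is that of Fefferman and Stein; for `Sq` it is a Carleson
embedding (`tsum_inside_le`, `tsum_mul_avg_le`). -/

lemma len_pos (I : DyadicInterval) : 0 < len I := by unfold len; positivity

lemma len_le_half (I : DyadicInterval) : len I ≤ 1 / 2 := by
  unfold len
  rw [one_div]
  apply inv_anti₀ (by norm_num)
  calc (2 : ℝ) = 2 ^ 1 := by norm_num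
    _ ≤ 2 ^ (I.1 : ℕ) := pow_le_pow_right₀ (by norm_num) I.1.pos

/-- The length as an extended nonnegative real. -/
def elen (I : DyadicInterval) : ℝ≥0∞ := ENNReal.ofReal (len I)

lemma elen_ne_zero (I : DyadicInterval) : elen I ≠ 0 := by
  simp [elen, len_pos]

lemma elen_ne_top (I : DyadicInterval) : elen I ≠ ⊤ := by simp [elen]

lemma elen_mul_inv (I : DyadicInterval) : elen I * (elen I)⁻¹ = 1 :=
  ENNReal.mul_inv_cancel (elen_ne_zero I) (elen_ne_top I)

lemma elen_inv_mul (I : DyadicInterval) : (elen I)⁻¹ * elen I = 1 :=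
  ENNReal.inv_mul_cancel (elen_ne_zero I) (elen_ne_top I)

lemma elen_inv (I : DyadicInterval) : (elen I)⁻¹ = ENNReal.ofReal (1 / len I) := by
  rw [elen, one_div, ENNReal.ofReal_inv_of_pos (len_pos I)]

/-- The representative in `[0, 1)` of a point of the circle. -/
def pos (x : UnitAddCircle) : ℝ := AddCircle.equivIco 1 0 x

lemma pos_nonneg (x : UnitAddCircle) : 0 ≤ pos x := (AddCircle.equivIco 1 0 x).2.1

lemma pos_lt_one (x : UnitAddCircle) : pos x < 1 := by
  have h := (AddCircle.equivIco (1 : ℝ) 0 x).2.2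
  exact h.trans_eq (zero_add 1)

lemma coe_pos (x : UnitAddCircle) : ((pos x : ℝ) : UnitAddCircle) = x :=
  AddCircle.coe_equivIco

lemma pos_coe {t : ℝ} (h0 : 0 ≤ t) (h1 : t < 1) : pos (t : UnitAddCircle) = t :=
  AddCircle.equivIco_coe_of_mem (by simpa using ⟨h0, h1⟩)

lemma measurable_pos : Measurable pos :=
  (AddCircle.measurableEquivIco (1 : ℝ) 0).measurable.subtype_val

/-- The half-open dyadic interval. -/
def cell (I : DyadicInterval) : Set UnitAddCircle :=
  {x | len I * ((I.2 : ℕ) : ℝ) ≤ pos x ∧ pos x < len I * (((I.2 : ℕ) : ℝ) + 1)}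

lemma measurableSet_cell (I : DyadicInterval) : MeasurableSet (cell I) :=
  (measurableSet_le measurable_const measurable_pos).inter
    (measurableSet_lt measurable_pos measurable_const)

/-- The half-open dyadic interval of level `k` containing `x`. -/
def cellOf (k : ℕ+) (x : UnitAddCircle) : DyadicInterval :=
  ⟨k, ⟨⌊(2 : ℝ) ^ (k : ℕ) * pos x⌋₊, by
    rw [Nat.floor_lt (by have := pos_nonneg x; positivity)]
    push_cast
    have := pos_lt_one x
    have h2 : (0 : ℝ) < 2 ^ (k : ℕ) := by positivity
    nlinarith⟩⟩

lemma mem_cell_iff {I : DyadicInterval} {x : UnitAddCircle} :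
    x ∈ cell I ↔ cellOf I.1 x = I := by
  obtain ⟨k, j⟩ := I
  have h2 : (0 : ℝ) < 2 ^ (k : ℕ) := by positivity
  have : x ∈ cell ⟨k, j⟩ ↔ ⌊(2 : ℝ) ^ (k : ℕ) * pos x⌋₊ = (j : ℕ) := by
    rw [Nat.floor_eq_iff (by have := pos_nonneg x; positivity)]
    simp only [cell, len, Set.mem_ofPred_eq]
    rw [inv_mul_le_iff₀ h2, lt_inv_mul_iff₀ h2]
  rw [this]
  simp [cellOf, Fin.ext_iff]

lemma mem_cell_cellOf (k : ℕ+) (x : UnitAddCircle) : x ∈ cell (cellOf k x) :=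
  mem_cell_iff.2 rfl

/-- Nestedness of the grid: the index at a coarse level is the index at a finer level divided by a
power of two and rounded down. -/
lemma cellOf_eq_of_le {k K : ℕ+} (h : k ≤ K) {x y : UnitAddCircle}
    (hxy : cellOf K x = cellOf K y) : cellOf k x = cellOf k y := by
  have key : ∀ z : UnitAddCircle, ⌊(2 : ℝ) ^ (k : ℕ) * pos z⌋₊ =
      ⌊(2 : ℝ) ^ (K : ℕ) * pos z⌋₊ / 2 ^ ((K : ℕ) - k) := by
    intro z
    rw [← Nat.floor_div_natCast]
    congr 1
    push_cast
    rw [eq_div_iff (by positivity)]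
    have h' : (k : ℕ) ≤ K := by exact_mod_cast h
    calc (2 : ℝ) ^ (k : ℕ) * pos z * 2 ^ ((K : ℕ) - k)
        = (2 ^ (k : ℕ) * 2 ^ ((K : ℕ) - k)) * pos z := by ring
      _ = _ := by rw [← pow_add, Nat.add_sub_cancel' h']
  simp only [cellOf, Sigma.mk.injEq, heq_eq_eq, true_and, Fin.mk.injEq] at hxy ⊢
  rw [key x, key y, hxy]

lemma cell_subset_of_mem {I J : DyadicInterval} (h : I.1 ≤ J.1) {x : UnitAddCircle}
    (hI : x ∈ cell I) (hJ : x ∈ cell J) : cell J ⊆ cell I := by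
  intro y hy
  rw [mem_cell_iff] at *
  rw [← hI]
  exact cellOf_eq_of_le h (hy.trans hJ.symm)

lemma eq_of_mem_cell {I J : DyadicInterval} (h : I.1 = J.1) {x : UnitAddCircle}
    (hI : x ∈ cell I) (hJ : x ∈ cell J) : I = J := by
  rw [mem_cell_iff] at *
  rw [← hI, ← hJ, h]

lemma cell_nonempty (I : DyadicInterval) : (cell I).Nonempty := by
  have hj : ((I.2 : ℕ) : ℝ) + 1 ≤ 2 ^ (I.1 : ℕ) := by exact_mod_cast I.2.2
  have hl := len_pos I
  have hl1 : len I * 2 ^ (I.1 : ℕ) = 1 := by unfold len; field_simp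
  refine ⟨((len I * ((I.2 : ℕ) : ℝ) : ℝ) : UnitAddCircle), ?_⟩
  have h1 : len I * ((I.2 : ℕ) : ℝ) < 1 := by nlinarith
  have h := pos_coe (t := len I * ((I.2 : ℕ) : ℝ)) (by positivity) h1
  constructor
  · rw [h]
  · rw [h]; nlinarith

lemma cell_subset_arc (I : DyadicInterval) : cell I ⊆ arc I := fun x hx =>
  ⟨pos x, ⟨hx.1, hx.2.le⟩, coe_pos x⟩

/-- The midpoint of a dyadic interval. -/
def mid (I : DyadicInterval) : UnitAddCircle := ((len I * (((I.2 : ℕ) : ℝ) + 1 / 2) : ℝ))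

lemma dist_coe_le (a b : ℝ) : dist (a : UnitAddCircle) (b : UnitAddCircle) ≤ |a - b| := by
  rw [dist_eq_norm, ← AddCircle.coe_sub, UnitAddCircle.norm_eq]
  simpa using round_le (a - b) 0

lemma arc_subset_closedBall (I : DyadicInterval) :
    arc I ⊆ Metric.closedBall (mid I) (len I / 2) := by
  rintro _ ⟨t, ht, rfl⟩
  rw [Metric.mem_closedBall]
  refine (dist_coe_le _ _).trans ?_
  rw [abs_le]
  constructor <;> nlinarith [ht.1, ht.2]

lemma dist_le_of_mem_arc {I : DyadicInterval} {x y : UnitAddCircle} (hx : x ∈ arc I)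
    (hy : y ∈ arc I) : dist x y ≤ len I := by
  have h1 := arc_subset_closedBall I hx
  have h2 := arc_subset_closedBall I hy
  rw [Metric.mem_closedBall] at h1 h2
  linarith [dist_triangle_right x y (mid I)]

lemma arc_nonempty (I : DyadicInterval) : (arc I).Nonempty :=
  (cell_nonempty I).mono (cell_subset_arc I)

lemma isCompact_arc (I : DyadicInterval) : IsCompact (arc I) :=
  isCompact_Icc.image (AddCircle.continuous_mk' 1)

lemma measurableSet_arc (I : DyadicInterval) : MeasurableSet (arc I) :=
  (isCompact_arc I).isClosed.measurableSet

lemma volume_midBall (I : DyadicInterval) :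
    volume (Metric.closedBall (mid I) (len I / 2)) = elen I := by
  rw [AddCircle.volume_closedBall, elen, min_eq_right]
  · congr 1; ring
  · linarith [len_le_half I]

lemma elen_le_volume_cell (I : DyadicInterval) : elen I ≤ volume (cell I) := by
  have hj : ((I.2 : ℕ) : ℝ) + 1 ≤ 2 ^ (I.1 : ℕ) := by exact_mod_cast I.2.2
  have hl := len_pos I
  have hl1 : len I * 2 ^ (I.1 : ℕ) = 1 := by unfold len; field_simp
  have hm := (UnitAddCircle.measurePreserving_mk 0).measure_preimage
    (measurableSet_cell I).nullMeasurableSet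
  rw [← hm, Measure.restrict_apply (by
    exact AddCircle.measurable_mk' (measurableSet_cell I))]
  -- The open interval is safe under both conventions: `pos` takes values in `[0, 1)`, while the
  -- measure is pulled back to `(0, 1]`.
  have : Set.Ioo (len I * ((I.2 : ℕ) : ℝ)) (len I * (((I.2 : ℕ) : ℝ) + 1)) ⊆
      ((↑) : ℝ → UnitAddCircle) ⁻¹' cell I ∩ Set.Ioc 0 (0 + 1) := by
    intro t ht
    have h0 : 0 < t := lt_of_le_of_lt (by positivity) ht.1
    have h1 : t < 1 := lt_of_lt_of_le ht.2 (by nlinarith)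
    refine ⟨?_, h0, by linarith⟩
    simp only [Set.mem_preimage, cell, Set.mem_ofPred_eq, pos_coe h0.le h1]
    exact ⟨ht.1.le, ht.2⟩
  refine le_trans ?_ (measure_mono this)
  rw [Real.volume_Ioo, elen]
  apply ENNReal.ofReal_le_ofReal
  linarith

/-- The cell lies in the arc and the arc in the closed ball about the midpoint. The ball already has
measure `len I`, so the three sets agree up to null sets. -/
lemma volume_cell (I : DyadicInterval) : volume (cell I) = elen I :=
  le_antisymm ((measure_mono ((cell_subset_arc I).trans (arc_subset_closedBall I))).trans_eq
    (volume_midBall I)) (elen_le_volume_cell I)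

lemma volume_arc (I : DyadicInterval) : volume (arc I) = elen I :=
  le_antisymm ((measure_mono (arc_subset_closedBall I)).trans_eq
    (volume_midBall I)) ((elen_le_volume_cell I).trans (measure_mono (cell_subset_arc I)))

/-- Lets dyadic averages be read as averages over balls, for which the differentiation theorem is
available. -/
lemma cell_ae_eq_midBall (I : DyadicInterval) :
    cell I =ᵐ[volume] Metric.closedBall (mid I) (len I / 2) :=
  ae_eq_of_subset_of_measure_ge ((cell_subset_arc I).trans (arc_subset_closedBall I))
    (by rw [volume_midBall, volume_cell]) (measurableSet_cell I).nullMeasurableSet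
    (measure_ne_top _ _)

lemma cell_ae_eq_arc (I : DyadicInterval) : cell I =ᵐ[volume] arc I :=
  ae_eq_of_subset_of_measure_ge (cell_subset_arc I)
    (by rw [volume_arc, volume_cell]) (measurableSet_cell I).nullMeasurableSet
    (measure_ne_top _ _)

lemma chi_eq_one {I : DyadicInterval} {x : UnitAddCircle} (h : x ∈ arc I) : chi I x = 1 := by
  simp [chi, h]

lemma chi_eq_zero {I : DyadicInterval} {x : UnitAddCircle} (h : x ∉ arc I) : chi I x = 0 := by
  simp [chi, h]

lemma chi_le_one (I : DyadicInterval) (x : UnitAddCircle) : chi I x ≤ 1 := by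
  by_cases h : x ∈ arc I
  · rw [chi_eq_one h]
  · rw [chi_eq_zero h]; exact zero_le

lemma measurable_chi (I : DyadicInterval) : Measurable (chi I) :=
  measurable_one.indicator (measurableSet_arc I)

lemma lintegral_mul_chi (I : DyadicInterval) (f : UnitAddCircle → ℝ≥0∞) :
    ∫⁻ x, f x * chi I x = ∫⁻ x in cell I, f x := by
  have : ∀ x, f x * chi I x = (arc I).indicator f x := by
    intro x
    by_cases h : x ∈ arc I <;> simp [chi, h]
  simp_rw [this]
  rw [lintegral_indicator (measurableSet_arc I), setLIntegral_congr (cell_ae_eq_arc I)]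

/-- The distance from the dyadic interval at its own scale, plus one. -/
def dec (I : DyadicInterval) (x : UnitAddCircle) : ℝ := 1 + Metric.infDist x (arc I) / len I

lemma one_le_dec (I : DyadicInterval) (x : UnitAddCircle) : 1 ≤ dec I x := by
  have := len_pos I
  have : 0 ≤ Metric.infDist x (arc I) / len I := div_nonneg Metric.infDist_nonneg this.le
  unfold dec; linarith

lemma dec_pos (I : DyadicInterval) (x : UnitAddCircle) : 0 < dec I x :=
  one_pos.trans_le (one_le_dec I x)

lemma dec_of_mem {I : DyadicInterval} {x : UnitAddCircle} (h : x ∈ arc I) : dec I x = 1 := by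
  simp [dec, Metric.infDist_zero_of_mem h]

lemma continuous_dec (I : DyadicInterval) : Continuous (dec I) := by
  unfold dec
  exact continuous_const.add ((Metric.continuous_infDist_pt _).div_const _)

lemma dec_le_add (I : DyadicInterval) (x y : UnitAddCircle) :
    dec I x ≤ dec I y + dist x y / len I := by
  have h := Metric.infDist_le_infDist_add_dist (s := arc I) (x := x) (y := y)
  have hl := len_pos I
  unfold dec
  have := (div_le_div_iff_of_pos_right hl).2 h
  rw [add_div] at this
  linarith

lemma dist_le_infDist_add {I : DyadicInterval} {c : UnitAddCircle} (hc : c ∈ arc I)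
    (x : UnitAddCircle) : dist x c ≤ Metric.infDist x (arc I) + len I := by
  have : dist x c - len I ≤ Metric.infDist x (arc I) := by
    rw [Metric.le_infDist (arc_nonempty I)]
    intro y hy
    have := dist_triangle x y c
    have := dist_le_of_mem_arc hy hc
    linarith
  linarith

lemma one_add_dist_le {I : DyadicInterval} {c : UnitAddCircle} (hc : c ∈ arc I)
    (x : UnitAddCircle) : 1 + dist x c / len I ≤ 2 * dec I x := by
  have h := (div_le_div_iff_of_pos_right (len_pos I)).2 (dist_le_infDist_add hc x)
  rw [add_div, div_self (len_pos I).ne'] at h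
  have := one_le_dec I x
  unfold dec at *
  linarith

/-- Intervals that are long compared with `J` and away from a point of `J` are far from `J`. -/
lemma len_div_le_dec {J : DyadicInterval} {y v : UnitAddCircle} {r : ℝ} (hy : y ∈ arc J)
    (hr : r ≤ dist v y) : r / len J ≤ dec J v := by
  have h := (div_le_div_iff_of_pos_right (len_pos J)).2 (dist_le_infDist_add hy v)
  rw [add_div, div_self (len_pos J).ne'] at h
  have h2 := (div_le_div_iff_of_pos_right (len_pos J)).2 hr
  unfold dec
  linarith

/-- The integrable weight attached to a dyadic interval. -/
def om (I : DyadicInterval) (x : UnitAddCircle) : ℝ≥0∞ := ENNReal.ofReal (1 / dec I x ^ 2)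

lemma measurable_om (I : DyadicInterval) : Measurable (om I) := by
  unfold om
  have := (continuous_dec I).measurable
  fun_prop

lemma om_le_one (I : DyadicInterval) (x : UnitAddCircle) : om I x ≤ 1 := by
  rw [om, ENNReal.ofReal_le_one]
  have := one_le_dec I x
  rw [div_le_one (by positivity)]
  nlinarith

lemma om_of_mem {I : DyadicInterval} {x : UnitAddCircle} (h : x ∈ arc I) : om I x = 1 := by
  simp [om, dec_of_mem h]

lemma one_le_four_om {I : DyadicInterval} {x : UnitAddCircle} (h : dec I x ≤ 2) :
    1 ≤ 4 * om I x := by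
  rw [om, show (4 : ℝ≥0∞) = ENNReal.ofReal 4 by norm_num, ← ENNReal.ofReal_mul (by norm_num),
    ENNReal.one_le_ofReal]
  have := dec_pos I x
  rw [mul_one_div, le_div_iff₀ (by positivity)]
  nlinarith

lemma om_le_four_om {I : DyadicInterval} {u v : UnitAddCircle} (h : dec I v ≤ 2 * dec I u) :
    om I u ≤ 4 * om I v := by
  rw [om, om, show (4 : ℝ≥0∞) = ENNReal.ofReal 4 by norm_num, ← ENNReal.ofReal_mul (by norm_num)]
  apply ENNReal.ofReal_le_ofReal
  have h1 := dec_pos I u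
  have h2 := dec_pos I v
  rw [mul_one_div, div_le_div_iff₀ (by positivity) (by positivity)]
  nlinarith

/-- The rotation-invariant kernel at scale `l`. -/
lemma lintegral_kernel_le {l : ℝ} (hl : 0 < l) (x : UnitAddCircle) :
    ∫⁻ y, ENNReal.ofReal (1 / (1 + dist x y / l) ^ 2) ≤ ENNReal.ofReal (Real.pi * l) := by
  have h1 : ∫⁻ y, ENNReal.ofReal (1 / (1 + dist x y / l) ^ 2) =
      ∫⁻ y : UnitAddCircle, ENNReal.ofReal (1 / (1 + ‖y‖ / l) ^ 2) := by
    simp_rw [dist_eq_norm]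
    exact lintegral_sub_left_eq_self
      (fun y : UnitAddCircle => ENNReal.ofReal (1 / (1 + ‖y‖ / l) ^ 2)) x
  rw [h1, ← UnitAddCircle.lintegral_preimage (-(1 / 2))]
  have h2 : ∫⁻ a in Set.Ioc (-(1 / 2 : ℝ)) (-(1 / 2) + 1),
      ENNReal.ofReal (1 / (1 + ‖(a : UnitAddCircle)‖ / l) ^ 2) ≤
      ∫⁻ a in Set.Ioc (-(1 / 2 : ℝ)) (-(1 / 2) + 1), ENNReal.ofReal ((1 + (a / l) ^ 2)⁻¹) := by
    apply setLIntegral_mono' measurableSet_Ioc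
    intro a ha
    have : ‖(a : UnitAddCircle)‖ = |a| := by
      rw [AddCircle.norm_coe_eq_abs_iff _ one_ne_zero, abs_le]
      constructor <;> norm_num <;> linarith [ha.1, ha.2]
    rw [this]
    apply ENNReal.ofReal_le_ofReal
    rw [one_div]
    apply inv_anti₀ (by positivity)
    have hq : 0 ≤ |a| / l := by positivity
    rw [show (a / l) ^ 2 = (|a| / l) ^ 2 by rw [div_pow, div_pow, sq_abs]]
    nlinarith
  -- Enlarging the period to the whole line leaves an arctangent integral, of value `π l`.
  refine h2.trans ((setLIntegral_le_lintegral _ _).trans ?_)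
  rw [← ofReal_integral_eq_lintegral_ofReal]
  · apply ENNReal.ofReal_le_ofReal
    rw [Measure.integral_comp_div (fun s : ℝ => (1 + s ^ 2)⁻¹) l, integral_univ_inv_one_add_sq,
      abs_of_pos hl, smul_eq_mul, mul_comm]
  · exact (integrable_inv_one_add_sq).comp_div hl.ne'
  · exact Filter.Eventually.of_forall fun a => by positivity

/-- The weight is dominated by a translation-invariant kernel centred at any point of the arc, so it
can be integrated in `x` for fixed `I` and also summed over all `I` of one level for fixed `x`. -/
lemma om_le_kernel {I : DyadicInterval} {c : UnitAddCircle} (hc : c ∈ arc I) (x : UnitAddCircle) :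
    om I x ≤ 4 * ENNReal.ofReal (1 / (1 + dist x c / len I) ^ 2) := by
  rw [om, show (4 : ℝ≥0∞) = ENNReal.ofReal 4 by norm_num, ← ENNReal.ofReal_mul (by norm_num)]
  apply ENNReal.ofReal_le_ofReal
  have h1 := dec_pos I x
  have h2 := one_add_dist_le hc x
  have h3 : 0 < 1 + dist x c / len I := by have := len_pos I; positivity
  rw [mul_one_div, div_le_div_iff₀ (by positivity) (by positivity)]
  nlinarith

/-- A constant controlling all sums and integrals of the weights. -/
def omC : ℝ≥0∞ := 4 * ENNReal.ofReal Real.pi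

lemma omC_ne_top : omC ≠ ⊤ := by unfold omC; finiteness

lemma lintegral_om_le (I : DyadicInterval) : ∫⁻ x, om I x ≤ omC * elen I := by
  obtain ⟨c, hc⟩ := arc_nonempty I
  calc ∫⁻ x, om I x ≤ ∫⁻ x, 4 * ENNReal.ofReal (1 / (1 + dist c x / len I) ^ 2) :=
        lintegral_mono fun x => by rw [dist_comm]; exact om_le_kernel hc x
    _ = 4 * ∫⁻ x, ENNReal.ofReal (1 / (1 + dist c x / len I) ^ 2) :=
        lintegral_const_mul' _ _ (by norm_num)
    _ ≤ 4 * ENNReal.ofReal (Real.pi * len I) := by gcongr; exact lintegral_kernel_le (len_pos I) c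
    _ = _ := by rw [ENNReal.ofReal_mul Real.pi_pos.le, omC, elen, mul_assoc]

/-- After multiplication by the common length, each term is at most the integral of the kernel
centred at `x` over one cell. The cells of one level are disjoint, so the sum costs a single kernel
integral. -/
lemma tsum_om_level_le (k : ℕ+) (x : UnitAddCircle) :
    ∑' j : Fin (2 ^ (k : ℕ)), om ⟨k, j⟩ x ≤ omC := by
  have hlen : ∀ j : Fin (2 ^ (k : ℕ)), len ⟨k, j⟩ = len ⟨k, 0⟩ := fun j => rfl
  have h1 : ∀ j : Fin (2 ^ (k : ℕ)), elen ⟨k, 0⟩ * om ⟨k, j⟩ x ≤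
      ∫⁻ y in cell ⟨k, j⟩, 4 * ENNReal.ofReal (1 / (1 + dist x y / len ⟨k, 0⟩) ^ 2) := by
    intro j
    have : elen ⟨k, 0⟩ * om ⟨k, j⟩ x = ∫⁻ y in cell ⟨k, j⟩, om ⟨k, j⟩ x := by
      rw [setLIntegral_const, volume_cell, mul_comm]; rfl
    rw [this]
    apply setLIntegral_mono' (measurableSet_cell _)
    intro y hy
    exact om_le_kernel (cell_subset_arc _ hy) x
  have h2 : elen ⟨k, 0⟩ * ∑' j : Fin (2 ^ (k : ℕ)), om ⟨k, j⟩ x ≤ elen ⟨k, 0⟩ * omC := by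
    rw [← ENNReal.tsum_mul_left]
    refine (ENNReal.tsum_le_tsum h1).trans ?_
    rw [← lintegral_iUnion (fun j => measurableSet_cell _)]
    · refine (setLIntegral_le_lintegral _ _).trans ?_
      rw [lintegral_const_mul' _ _ (by norm_num)]
      refine (mul_le_mul_right (lintegral_kernel_le (len_pos ⟨k, 0⟩) x) 4).trans_eq ?_
      rw [ENNReal.ofReal_mul Real.pi_pos.le, omC, elen]; ring
    · intro i j hij
      rw [Function.onFun, Set.disjoint_left]
      intro y hi hj
      have h : (⟨k, i⟩ : DyadicInterval) = ⟨k, j⟩ := eq_of_mem_cell rfl hi hj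
      simp only [Sigma.mk.injEq, heq_eq_eq, true_and] at h
      exact hij h
  exact (ENNReal.mul_le_mul_iff_right (elen_ne_zero _) (elen_ne_top _)).1 h2

/-- The ratio of the lengths of two dyadic intervals, at most one. -/
def rho (I J : DyadicInterval) : ℝ≥0∞ := ENNReal.ofReal (min (len I / len J) (len J / len I))

lemma rho_comm (I J : DyadicInterval) : rho I J = rho J I := by simp [rho, min_comm]

/-- Two geometric series: the levels below `n` contribute at most 1, the others at most 2. -/
lemma tsum_ratio_le (n : ℕ) :
    ∑' k : ℕ, ENNReal.ofReal (min ((2 : ℝ) ^ k / 2 ^ n) (2 ^ n / 2 ^ k)) ≤ 3 := by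
  rw [← ENNReal.summable.sum_add_tsum_nat_add' (k := n) (f := fun k : ℕ =>
    ENNReal.ofReal (min ((2 : ℝ) ^ k / 2 ^ n) (2 ^ n / 2 ^ k)))]
  have h1 : ∑ k ∈ Finset.range n, ENNReal.ofReal (min ((2 : ℝ) ^ k / 2 ^ n) (2 ^ n / 2 ^ k)) ≤ 1 := by
    calc _ ≤ ∑ k ∈ Finset.range n, ENNReal.ofReal ((2 : ℝ) ^ k / 2 ^ n) :=
          Finset.sum_le_sum fun k _ => ENNReal.ofReal_le_ofReal (min_le_left _ _)
      _ = ENNReal.ofReal (∑ k ∈ Finset.range n, (2 : ℝ) ^ k / 2 ^ n) :=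
          (ENNReal.ofReal_sum_of_nonneg fun k _ => by positivity).symm
      _ ≤ 1 := by
          rw [ENNReal.ofReal_le_one, ← Finset.sum_div, div_le_one (by positivity), geom_sum_eq (by norm_num)]
          norm_num
  have h2 : ∑' k : ℕ, ENNReal.ofReal (min ((2 : ℝ) ^ (k + n) / 2 ^ n) (2 ^ n / 2 ^ (k + n))) ≤ 2 := by
    rw [← ENNReal.tsum_geometric_two]
    apply ENNReal.tsum_le_tsum
    intro k
    refine (ENNReal.ofReal_le_ofReal (min_le_right _ _)).trans_eq ?_
    rw [pow_add, div_mul_cancel_right₀ (by positivity), ENNReal.ofReal_inv_of_pos (by positivity),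
      ← ENNReal.inv_pow, ENNReal.ofReal_pow (by norm_num)]
    simp
  calc _ ≤ (1 : ℝ≥0∞) + 2 := add_le_add h1 h2
    _ = 3 := by norm_num

/-- The summation behind almost orthogonality, the estimate of the bad part and the Carleson tail:
each level costs `omC`, and the ratio of lengths sums the levels. -/
lemma tsum_rho_mul_om_le (I : DyadicInterval) (x : UnitAddCircle) :
    ∑' J : DyadicInterval, rho I J * om J x ≤ 3 * omC := by
  refine (ENNReal.tsum_sigma fun (k : ℕ+) (j : Fin (2 ^ (k : ℕ))) =>
    rho I ⟨k, j⟩ * om ⟨k, j⟩ x).trans_le ?_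
  have h1 : ∀ k : ℕ+, ∑' j : Fin (2 ^ (k : ℕ)), rho I ⟨k, j⟩ * om ⟨k, j⟩ x ≤
      ENNReal.ofReal (min ((2 : ℝ) ^ (k : ℕ) / 2 ^ (I.1 : ℕ)) (2 ^ (I.1 : ℕ) / 2 ^ (k : ℕ))) * omC := by
    intro k
    have : ∀ j : Fin (2 ^ (k : ℕ)), rho I ⟨k, j⟩ =
        ENNReal.ofReal (min ((2 : ℝ) ^ (k : ℕ) / 2 ^ (I.1 : ℕ)) (2 ^ (I.1 : ℕ) / 2 ^ (k : ℕ))) := by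
      intro j
      simp only [rho, len]
      congr 2 <;> field_simp
    simp_rw [this, ENNReal.tsum_mul_left]
    gcongr
    exact tsum_om_level_le k x
  refine (ENNReal.tsum_le_tsum h1).trans ?_
  rw [ENNReal.tsum_mul_right]
  gcongr
  refine le_trans ?_ (tsum_ratio_le (I.1 : ℕ))
  exact ENNReal.tsum_comp_le_tsum_of_injective PNat.coe_injective
    (fun k : ℕ => ENNReal.ofReal (min ((2 : ℝ) ^ k / 2 ^ (I.1 : ℕ)) (2 ^ (I.1 : ℕ) / 2 ^ k)))


/-! ### Stopping intervals -/

/-- The maximal dyadic intervals on which `A` exceeds the height `t`. -/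
def stopping (A : DyadicInterval → ℝ≥0∞) (t : ℝ≥0∞) : Set DyadicInterval :=
  {Q | t < A Q ∧ ∀ P, cell Q ⊆ cell P → P.1 < Q.1 → A P ≤ t}

lemma stopping_eq_of_mem {A : DyadicInterval → ℝ≥0∞} {t : ℝ≥0∞} {P Q : DyadicInterval}
    (hP : P ∈ stopping A t) (hQ : Q ∈ stopping A t) {x : UnitAddCircle} (hx : x ∈ cell P)
    (hx' : x ∈ cell Q) : P = Q := by
  rcases lt_trichotomy P.1 Q.1 with h | h | h
  · exact absurd hP.1 (not_lt.2 (hQ.2 P (cell_subset_of_mem h.le hx hx') h))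
  · exact eq_of_mem_cell h hx hx'
  · exact absurd hQ.1 (not_lt.2 (hP.2 Q (cell_subset_of_mem h.le hx' hx) h))

/-- The cells of the intervals in the family are pairwise disjoint. -/
def DisjointCells (S : Set DyadicInterval) : Prop :=
  ∀ P ∈ S, ∀ Q ∈ S, ∀ x, x ∈ cell P → x ∈ cell Q → P = Q

lemma disjointCells_stopping (A : DyadicInterval → ℝ≥0∞) (t : ℝ≥0∞) :
    DisjointCells (stopping A t) := fun _ hP _ hQ _ hx hx' => stopping_eq_of_mem hP hQ hx hx'

/-- Among the intervals containing `J` on which `A` exceeds `t`, one of least level works; it exists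
because levels are positive integers. -/
lemma exists_stopping {A : DyadicInterval → ℝ≥0∞} {t : ℝ≥0∞} {J : DyadicInterval} (h : t < A J) :
    ∃ Q ∈ stopping A t, cell J ⊆ cell Q ∧ Q.1 ≤ J.1 := by
  let T : Set DyadicInterval := {P | t < A P ∧ cell J ⊆ cell P ∧ P.1 ≤ J.1}
  have hT : T.Nonempty := ⟨J, h, subset_rfl, le_rfl⟩
  let f : DyadicInterval → ℕ+ := fun P => P.1
  have hmin := fun P (hP : P ∈ T) => Function.argminOn_le f T hP
  have hmem := Function.argminOn_mem f T hT
  set Q := Function.argminOn f T hT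
  refine ⟨Q, ⟨hmem.1, fun P hQP hlt => ?_⟩, hmem.2.1, hmem.2.2⟩
  by_contra hc
  exact absurd (hmin P ⟨not_le.1 hc, hmem.2.1.trans hQP, hlt.le.trans hmem.2.2⟩) (not_le.2 hlt)

/-- The union of the cells of a family. -/
def cover (S : Set DyadicInterval) : Set UnitAddCircle := ⋃ Q : S, cell Q

lemma measurableSet_cover (S : Set DyadicInterval) : MeasurableSet (cover S) :=
  MeasurableSet.iUnion fun Q => measurableSet_cell Q

lemma mem_cover {S : Set DyadicInterval} {x : UnitAddCircle} :
    x ∈ cover S ↔ ∃ Q ∈ S, x ∈ cell Q := by simp [cover]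

lemma DisjointCells.pairwise {S : Set DyadicInterval} (hS : DisjointCells S) :
    Pairwise (Function.onFun Disjoint fun Q : S => cell Q) := by
  intro P Q hPQ
  rw [Function.onFun, Set.disjoint_left]
  intro x hx hx'
  exact hPQ (Subtype.ext (hS P P.2 Q Q.2 x hx hx'))

lemma DisjointCells.lintegral_cover {S : Set DyadicInterval} (hS : DisjointCells S)
    (f : UnitAddCircle → ℝ≥0∞) :
    ∫⁻ x in cover S, f x = ∑' Q : S, ∫⁻ x in cell Q, f x :=
  lintegral_iUnion (fun Q : S => measurableSet_cell Q) hS.pairwise f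

lemma DisjointCells.tsum_lintegral_le {S : Set DyadicInterval} (hS : DisjointCells S)
    (f : UnitAddCircle → ℝ≥0∞) :
    ∑' Q : S, ∫⁻ x in cell Q, f x ≤ ∫⁻ x, f x := by
  rw [← hS.lintegral_cover]
  exact setLIntegral_le_lintegral _ _

/-- The average over a dyadic interval. -/
def avg (f : UnitAddCircle → ℝ≥0∞) (Q : DyadicInterval) : ℝ≥0∞ :=
  (elen Q)⁻¹ * ∫⁻ x in cell Q, f x

lemma elen_mul_avg (f : UnitAddCircle → ℝ≥0∞) (Q : DyadicInterval) :
    elen Q * avg f Q = ∫⁻ x in cell Q, f x := by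
  rw [avg, ← mul_assoc, elen_mul_inv, one_mul]

lemma mul_elen_le_of_stopping {f : UnitAddCircle → ℝ≥0∞} {t : ℝ≥0∞} {Q : DyadicInterval}
    (hQ : Q ∈ stopping (avg f) t) : t * elen Q ≤ ∫⁻ x in cell Q, f x := by
  rw [← elen_mul_avg, mul_comm]
  gcongr
  exact hQ.1.le

lemma tsum_elen_stopping_le (f : UnitAddCircle → ℝ≥0∞) (t : ℝ≥0∞) :
    t * ∑' Q : stopping (avg f) t, elen Q ≤ ∫⁻ x, f x := by
  rw [← ENNReal.tsum_mul_left]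
  exact (ENNReal.tsum_le_tsum fun Q => mul_elen_le_of_stopping Q.2).trans
    ((disjointCells_stopping _ _).tsum_lintegral_le f)

lemma len_eq_half {I J : DyadicInterval} (h : (J.1 : ℕ) = I.1 + 1) : len I = 2 * len J := by
  unfold len
  rw [h, pow_succ]
  field_simp

/-- The dyadic parent was not selected, so its mean is at most `t`, and passing to one half at most
doubles a mean. An interval of level one has no parent, since the circle is not a dyadic interval;
there the bound on the total integral takes its place. -/
lemma avg_le_two_mul {f : UnitAddCircle → ℝ≥0∞} {t : ℝ≥0∞} (hf : ∫⁻ x, f x ≤ t)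
    {Q : DyadicInterval} (hQ : Q ∈ stopping (avg f) t) : avg f Q ≤ 2 * t := by
  by_cases h1 : Q.1 = 1
  · have : elen Q = 2⁻¹ := by
      rw [elen, len, h1]
      simp [ENNReal.ofReal_inv_of_pos]
    rw [avg, this, inv_inv]
    gcongr
    exact (setLIntegral_le_lintegral _ _).trans hf
  · obtain ⟨x, hx⟩ := cell_nonempty Q
    have hlt : 1 < Q.1 := lt_of_le_of_ne one_le (Ne.symm h1)
    obtain ⟨k, hk⟩ := PNat.exists_eq_succ_of_ne_one h1
    set P := cellOf k x
    have hPk : P.1 = k := rfl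
    have hPQ : P.1 < Q.1 := by rw [hk, hPk]; exact PNat.lt_add_right _ _
    have hsub : cell Q ⊆ cell P := cell_subset_of_mem hPQ.le (mem_cell_cellOf k x) hx
    have h2 := hQ.2 P hsub hPQ
    have hl : elen P = 2 * elen Q := by
      rw [elen, elen, len_eq_half (I := P) (J := Q) (by rw [hk, hPk]; rfl),
        ENNReal.ofReal_mul (by norm_num)]
      simp
    have h3 : elen Q * avg f Q ≤ elen Q * (2 * t) := by
      calc elen Q * avg f Q = ∫⁻ x in cell Q, f x := elen_mul_avg f Q
        _ ≤ ∫⁻ x in cell P, f x := lintegral_mono_set hsub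
        _ = elen P * avg f P := (elen_mul_avg f P).symm
        _ ≤ elen P * t := by gcongr
        _ = _ := by rw [hl]; ring
    exact (ENNReal.mul_le_mul_iff_right (elen_ne_zero _) (elen_ne_top _)).1 h3

/-- Lebesgue differentiation along dyadic intervals. -/
lemma ae_le_of_avg_le {f : UnitAddCircle → ℝ≥0∞} (hf : Measurable f) (hfi : ∫⁻ x, f x ≠ ⊤) :
    ∀ᵐ x : UnitAddCircle, ∀ t : ℝ≥0∞, (∀ Q, x ∈ cell Q → avg f Q ≤ t) → f x ≤ t := by
  have hint : Integrable (fun x => (f x).toReal) :=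
    integrable_toReal_of_lintegral_ne_top hf.aemeasurable hfi
  filter_upwards [IsUnifLocDoublingMeasure.ae_tendsto_average (μ := volume)
    hint.locallyIntegrable 1, ae_lt_top hf hfi] with x hx hfx t ht
  by_cases htop : t = ⊤
  · simp [htop]
  let Q : ℕ → DyadicInterval := fun n => cellOf n.succPNat x
  have hQ : ∀ n, x ∈ cell (Q n) := fun n => mem_cell_cellOf _ _
  have hlen : ∀ n, len (Q n) / 2 = (1 / 2) * ((1 / 2) * (1 / 2) ^ n) := by
    intro n
    simp only [len, Q, cellOf, Nat.succPNat_coe, Nat.succ_eq_add_one, pow_succ]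
    simp; ring
  -- The balls have to contain `x` and shrink but need not be centred at it, so the midpoint balls
  -- of the cells containing `x` are allowed.
  have h := hx (l := Filter.atTop) (fun n => mid (Q n)) (fun n => len (Q n) / 2) (by
    rw [tendsto_nhdsWithin_iff]
    constructor
    · simp_rw [hlen]
      have := (tendsto_pow_atTop_nhds_zero_of_lt_one (r := (1 / 2 : ℝ)) (by norm_num)
        (by norm_num))
      have h := (this.const_mul (1 / 2)).const_mul (1 / 2)
      simp only [mul_zero] at h
      exact h
    · exact Filter.Eventually.of_forall fun n => by
        have := len_pos (Q n)
        simp only [Set.mem_Ioi]; positivity) (Filter.Eventually.of_forall fun n => by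
    rw [one_mul]
    exact arc_subset_closedBall _ (cell_subset_arc _ (hQ n)))
  have h2 : (f x).toReal ≤ t.toReal := by
    refine le_of_tendsto h (Filter.Eventually.of_forall fun n => ?_)
    rw [setAverage_congr (cell_ae_eq_midBall (Q n)).symm, setAverage_eq, integral_toReal
      hf.aemeasurable ((ae_lt_top hf hfi).filter_mono (ae_mono Measure.restrict_le_self)),
      Measure.real, volume_cell, smul_eq_mul, ← ENNReal.toReal_inv, ← ENNReal.toReal_mul]
    exact ENNReal.toReal_mono htop (ht _ (hQ n))
  exact (ENNReal.toReal_le_toReal hfx.ne htop).1 h2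

lemma ae_le_off_stopping {f : UnitAddCircle → ℝ≥0∞} (hf : Measurable f) (hfi : ∫⁻ x, f x ≠ ⊤)
    (t : ℝ≥0∞) : ∀ᵐ x : UnitAddCircle, x ∉ cover (stopping (avg f) t) → f x ≤ t := by
  filter_upwards [ae_le_of_avg_le hf hfi] with x hx hxc
  apply hx
  intro Q hQ
  by_contra hc
  obtain ⟨P, hP, hsub, -⟩ := exists_stopping (not_le.1 hc)
  exact hxc (mem_cover.2 ⟨P, hP, hsub hQ⟩)

/-- The enlargement of a dyadic interval. -/
def star (Q : DyadicInterval) : Set UnitAddCircle := {y | dec Q y ≤ 2}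

lemma measurableSet_star (Q : DyadicInterval) : MeasurableSet (star Q) :=
  (isClosed_le (continuous_dec Q) continuous_const).measurableSet

lemma setLIntegral_star_le (Q : DyadicInterval) (w : UnitAddCircle → ℝ≥0∞) :
    ∫⁻ x in star Q, w x ≤ 4 * ∫⁻ x, om Q x * w x := by
  calc ∫⁻ x in star Q, w x ≤ ∫⁻ x in star Q, 4 * (om Q x * w x) := by
        apply setLIntegral_mono' (measurableSet_star Q)
        intro x hx
        rw [← mul_assoc]
        exact le_mul_of_one_le_left' (one_le_four_om hx)
    _ ≤ ∫⁻ x, 4 * (om Q x * w x) := setLIntegral_le_lintegral _ _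
    _ = _ := lintegral_const_mul' _ _ (by norm_num)

lemma volume_star_le (Q : DyadicInterval) : volume (star Q) ≤ 4 * omC * elen Q := by
  have h := setLIntegral_star_le Q 1
  simp only [Pi.one_apply, lintegral_const, MeasurableSet.univ, Measure.restrict_apply,
    Set.univ_inter, one_mul, mul_one] at h
  refine h.trans ?_
  rw [mul_assoc]
  gcongr
  exact lintegral_om_le Q

lemma len_le_dist_of_notMem_star {Q : DyadicInterval} {y v : UnitAddCircle} (hy : y ∉ star Q)
    (hv : v ∈ arc Q) : len Q ≤ dist v y := by
  have hl := len_pos Q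
  have h1 : len Q < Metric.infDist y (arc Q) := by
    have h2 : ¬ dec Q y ≤ 2 := hy
    unfold dec at h2
    by_contra hc
    apply h2
    have := (div_le_one hl).2 (not_lt.1 hc)
    linarith
  rw [dist_comm]
  exact h1.le.trans (Metric.infDist_le_dist_of_mem hv)

/-- A point of `J` outside `star Q` is at distance at least `len Q` from `v`, while moving from `v`
to `u` changes distances by at most `len Q`. Hence the weight of `J` is nearly constant on `Q`,
whatever the relative size of the two intervals. -/
lemma dec_le_two_mul {Q J : DyadicInterval} {y u v : UnitAddCircle} (hy : y ∉ star Q)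
    (hyJ : y ∈ arc J) (hu : u ∈ arc Q) (hv : v ∈ arc Q) : dec J u ≤ 2 * dec J v := by
  have h1 := len_div_le_dec hyJ (len_le_dist_of_notMem_star hy hv)
  have h2 := dec_le_add J u v
  have h3 := (div_le_div_iff_of_pos_right (len_pos J)).2 (dist_le_of_mem_arc hu hv)
  linarith

/-- Replace a function by its averages on the intervals of a family. -/
def condAvg (S : Set DyadicInterval) (f : UnitAddCircle → ℝ≥0∞) (x : UnitAddCircle) : ℝ≥0∞ :=
  (cover S)ᶜ.indicator f x + ∑' Q : S, (cell Q).indicator (fun _ => avg f Q) x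

lemma condAvg_of_mem {S : Set DyadicInterval} (hS : DisjointCells S) (f : UnitAddCircle → ℝ≥0∞)
    {Q : DyadicInterval} (hQ : Q ∈ S) {x : UnitAddCircle} (hx : x ∈ cell Q) :
    condAvg S f x = avg f Q := by
  have h1 : x ∉ (cover S)ᶜ := fun h => h (mem_cover.2 ⟨Q, hQ, hx⟩)
  rw [condAvg, Set.indicator_of_notMem h1, zero_add, tsum_eq_single (⟨Q, hQ⟩ : S)]
  · simp [hx]
  · intro P hP
    apply Set.indicator_of_notMem
    intro hxP
    exact hP (Subtype.ext (hS P P.2 Q hQ x hxP hx))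

lemma condAvg_of_notMem {S : Set DyadicInterval} (f : UnitAddCircle → ℝ≥0∞)
    {x : UnitAddCircle} (hx : x ∉ cover S) : condAvg S f x = f x := by
  have h1 : x ∈ (cover S)ᶜ := hx
  rw [condAvg, Set.indicator_of_mem h1]
  have : ∀ Q : S, (cell Q).indicator (fun _ => avg f Q) x = 0 := fun Q =>
    Set.indicator_of_notMem (fun hQ => hx (mem_cover.2 ⟨Q, Q.2, hQ⟩)) _
  simp [this]

lemma measurable_condAvg (S : Set DyadicInterval) {f : UnitAddCircle → ℝ≥0∞} (hf : Measurable f) :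
    Measurable (condAvg S f) :=
  (hf.indicator (measurableSet_cover S).compl).add
    (Measurable.tsum fun Q => measurable_const.indicator (measurableSet_cell Q))

/-! ### The maximal function -/

/-- The maximal function built from the weights of the dyadic intervals. -/
def Mx (f : UnitAddCircle → ℝ≥0∞) (x : UnitAddCircle) : ℝ≥0∞ :=
  ⨆ J : DyadicInterval, (elen J)⁻¹ * (∫⁻ y, om J y * f y) * chi J x

lemma measurable_Mx (f : UnitAddCircle → ℝ≥0∞) : Measurable (Mx f) :=
  Measurable.iSup fun J => (measurable_chi J).const_mul _

lemma le_Mx (f : UnitAddCircle → ℝ≥0∞) {J : DyadicInterval} {x : UnitAddCircle} (hx : x ∈ arc J) :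
    (elen J)⁻¹ * ∫⁻ y, om J y * f y ≤ Mx f x := by
  refine le_trans ?_ (le_iSup _ J)
  rw [chi_eq_one hx, mul_one]

lemma Mx_le {f : UnitAddCircle → ℝ≥0∞} {x : UnitAddCircle} {c : ℝ≥0∞}
    (h : ∀ J, x ∈ arc J → (elen J)⁻¹ * ∫⁻ y, om J y * f y ≤ c) : Mx f x ≤ c := by
  refine iSup_le fun J => ?_
  by_cases hx : x ∈ arc J
  · rw [chi_eq_one hx, mul_one]; exact h J hx
  · rw [chi_eq_zero hx, mul_zero]; exact zero_le

lemma Mx_mono_ae {f g : UnitAddCircle → ℝ≥0∞} (h : f ≤ᵐ[volume] g) (x : UnitAddCircle) :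
    Mx f x ≤ Mx g x := by
  refine iSup_mono fun J => mul_le_mul_left (mul_le_mul_right ?_ _) _
  apply lintegral_mono_ae
  filter_upwards [h] with y hy
  gcongr

lemma Mx_le_of_le {f : UnitAddCircle → ℝ≥0∞} {c : ℝ≥0∞} (h : ∀ᵐ x, f x ≤ c)
    (x : UnitAddCircle) : Mx f x ≤ omC * c := by
  refine Mx_le fun J _ => ?_
  have : ∫⁻ y, om J y * f y ≤ (omC * elen J) * c := by
    calc ∫⁻ y, om J y * f y ≤ ∫⁻ y, om J y * c := by
          apply lintegral_mono_ae
          filter_upwards [h] with y hy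
          gcongr
      _ = (∫⁻ y, om J y) * c := lintegral_mul_const _ (measurable_om J)
      _ ≤ _ := by gcongr; exact lintegral_om_le J
  calc (elen J)⁻¹ * ∫⁻ y, om J y * f y ≤ (elen J)⁻¹ * ((omC * elen J) * c) := by gcongr
    _ = ((elen J)⁻¹ * elen J) * (omC * c) := by ring
    _ = _ := by rw [elen_inv_mul, one_mul]

lemma Mx_add_le {f g : UnitAddCircle → ℝ≥0∞} (hf : Measurable f) (x : UnitAddCircle) :
    Mx (fun y => f y + g y) x ≤ Mx f x + Mx g x := by
  refine Mx_le fun J hx => ?_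
  simp_rw [mul_add]
  rw [lintegral_add_left (by exact (measurable_om J).mul hf), mul_add]
  exact add_le_add (le_Mx f hx) (le_Mx g hx)

lemma Mx_const_mul {f : UnitAddCircle → ℝ≥0∞} {c : ℝ≥0∞} (hc : c ≠ ⊤) (x : UnitAddCircle) :
    Mx (fun y => c * f y) x = c * Mx f x := by
  unfold Mx
  rw [ENNReal.mul_iSup]
  congr 1; ext J
  have : ∀ y, om J y * (c * f y) = c * (om J y * f y) := fun y => by ring
  simp_rw [this]
  rw [lintegral_const_mul' _ _ hc]
  ring

lemma avg_le_Mx (f : UnitAddCircle → ℝ≥0∞) {Q : DyadicInterval} {x : UnitAddCircle}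
    (hx : x ∈ cell Q) : avg f Q ≤ Mx f x := by
  refine le_trans ?_ (le_Mx f (cell_subset_arc Q hx))
  refine mul_le_mul_right ?_ _
  calc ∫⁻ y in cell Q, f y = ∫⁻ y in cell Q, om Q y * f y := by
        apply setLIntegral_congr_fun (measurableSet_cell Q)
        intro y hy
        simp [om_of_mem (cell_subset_arc Q hy)]
    _ ≤ _ := setLIntegral_le_lintegral _ _

/-- The enlargement of a half circle is the whole circle, so its weight is everywhere at least 1/4.
This serves the case where the total integral exceeds the stopping height. -/
lemma lintegral_le_four_Mx (f : UnitAddCircle → ℝ≥0∞) (x : UnitAddCircle) :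
    ∫⁻ y, f y ≤ 4 * Mx f x := by
  set J := cellOf 1 x
  have hlen : len J = 1 / 2 := by simp [len, J, cellOf]
  have hx : x ∈ arc J := cell_subset_arc _ (mem_cell_cellOf 1 x)
  have huniv : star J = Set.univ := by
    rw [Set.eq_univ_iff_forall]
    intro y
    have h1 : dist y x ≤ 1 / 2 := by
      rw [dist_eq_norm]
      simpa using AddCircle.norm_le_half_period (1 : ℝ) (x := y - x) one_ne_zero
    have h2 := Metric.infDist_le_dist_of_mem (x := y) hx
    have : Metric.infDist y (arc J) / len J ≤ 1 := (div_le_one (len_pos J)).2 (by linarith)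
    change dec J y ≤ 2
    unfold dec; linarith
  have h := setLIntegral_star_le J f
  rw [huniv, Measure.restrict_univ] at h
  refine h.trans ?_
  gcongr
  refine le_trans ?_ (le_Mx f hx)
  apply le_mul_of_one_le_left'
  rw [ENNReal.one_le_inv, elen, ENNReal.ofReal_le_one, hlen]
  norm_num

/-- Away from the enlarged intervals, averaging does not change the maximal function much. -/
lemma Mx_le_condAvg {S : Set DyadicInterval} (hS : DisjointCells S) {f : UnitAddCircle → ℝ≥0∞}
    {x : UnitAddCircle} (hx : ∀ Q ∈ S, x ∉ star Q) : Mx f x ≤ 4 * Mx (condAvg S f) x := by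
  refine Mx_le fun J hxJ => ?_
  have key : ∫⁻ y, om J y * f y ≤ 4 * ∫⁻ y, om J y * condAvg S f y := by
    rw [← lintegral_add_compl _ (measurableSet_cover S),
      ← lintegral_add_compl (fun y => om J y * condAvg S f y) (measurableSet_cover S), mul_add]
    refine add_le_add ?_ ?_
    · rw [hS.lintegral_cover, hS.lintegral_cover, ← ENNReal.tsum_mul_left]
      refine ENNReal.tsum_le_tsum fun Q => ?_
      -- The weight at `u` is at most four times the weight at any `v` in the same cell. Integrating
      -- over `v` then replaces `f` by its mean on `Q`.
      have h1 : ∀ v ∈ cell (Q : DyadicInterval), ∫⁻ u in cell Q, om J u * f u ≤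
          4 * om J v * ∫⁻ u in cell Q, f u := by
        intro v hv
        rw [← lintegral_const_mul' _ _ 
          (ENNReal.mul_ne_top (by norm_num) (ne_top_of_le_ne_top ENNReal.one_ne_top (om_le_one J v)))]
        apply setLIntegral_mono' (measurableSet_cell _)
        intro u hu
        gcongr
        exact om_le_four_om (dec_le_two_mul (hx Q Q.2) hxJ (cell_subset_arc _ hv)
          (cell_subset_arc _ hu))
      have h2 : ∫⁻ y in cell (Q : DyadicInterval), om J y * condAvg S f y =
          (∫⁻ y in cell (Q : DyadicInterval), om J y) * avg f Q := by
        rw [← lintegral_mul_const _ (measurable_om J)]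
        apply setLIntegral_congr_fun (measurableSet_cell _)
        intro y hy
        simp only [condAvg_of_mem hS f Q.2 hy]
      rw [h2]
      have h3 : elen Q * ∫⁻ u in cell (Q : DyadicInterval), om J u * f u ≤
          elen Q * (4 * ((∫⁻ y in cell (Q : DyadicInterval), om J y) * avg f Q)) := by
        calc elen Q * ∫⁻ u in cell (Q : DyadicInterval), om J u * f u
            = ∫⁻ v in cell (Q : DyadicInterval), ∫⁻ u in cell (Q : DyadicInterval),
                om J u * f u := by
              rw [setLIntegral_const, volume_cell, mul_comm]
          _ ≤ ∫⁻ v in cell (Q : DyadicInterval), (4 * om J v) *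
                ∫⁻ u in cell (Q : DyadicInterval), f u :=
              setLIntegral_mono' (measurableSet_cell _) h1
          _ = 4 * (∫⁻ y in cell (Q : DyadicInterval), om J y) *
                ∫⁻ u in cell (Q : DyadicInterval), f u := by
              rw [lintegral_mul_const _ ((measurable_om J).const_mul _),
                lintegral_const_mul _ (measurable_om J)]
          _ = _ := by rw [← elen_mul_avg f Q]; ring
      exact (ENNReal.mul_le_mul_iff_right (elen_ne_zero _) (elen_ne_top _)).1 h3
    · refine le_trans (le_of_eq ?_) (le_mul_of_one_le_left' (by norm_num))
      apply setLIntegral_congr_fun (measurableSet_cover S).compl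
      intro y hy
      simp only [condAvg_of_notMem f hy]
  calc (elen J)⁻¹ * ∫⁻ y, om J y * f y
      ≤ (elen J)⁻¹ * (4 * ∫⁻ y, om J y * condAvg S f y) := by gcongr
    _ = 4 * ((elen J)⁻¹ * ∫⁻ y, om J y * condAvg S f y) := by ring
    _ ≤ _ := by gcongr; exact le_Mx _ hxJ

lemma condAvg_le {f : UnitAddCircle → ℝ≥0∞} (hf : Measurable f) {t : ℝ≥0∞} (ht : t ≠ ⊤)
    (hfi : ∫⁻ x, f x ≤ t) :
    ∀ᵐ x : UnitAddCircle, condAvg (stopping (avg f) t) f x ≤ 2 * t := by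
  filter_upwards [ae_le_off_stopping hf (ne_top_of_le_ne_top ht hfi) t] with x hx
  by_cases hc : x ∈ cover (stopping (avg f) t)
  · obtain ⟨Q, hQ, hxQ⟩ := mem_cover.1 hc
    rw [condAvg_of_mem (disjointCells_stopping _ _) f hQ hxQ]
    exact avg_le_two_mul hfi hQ
  · rw [condAvg_of_notMem f hc]
    exact (hx hc).trans (le_mul_of_one_le_left' (by norm_num))

/-- The weighted weak type inequality of Fefferman and Stein. -/
lemma Mx_weak {f w : UnitAddCircle → ℝ≥0∞} (hf : Measurable f) {t : ℝ≥0∞}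
    (ht : t ≠ ⊤) :
    t * ∫⁻ x in {x | 8 * omC * t < Mx f x}, w x ≤ 4 * ∫⁻ x, f x * Mx w x := by
  by_cases hfi : ∫⁻ x, f x ≤ t
  · set S := stopping (avg f) t with hSdef
    have hS : DisjointCells S := disjointCells_stopping _ _
    -- The level comes from here: off the enlargements `Mx f` is at most `4 Mx (condAvg S f)`, and
    -- the averaged function is at most `2 t`.
    have hsub : {x | 8 * omC * t < Mx f x} ⊆ ⋃ Q : S, star Q := by
      intro x hx
      by_contra hc
      simp only [Set.mem_iUnion, not_exists] at hc
      have h1 := Mx_le_condAvg (f := f) hS (x := x) fun Q hQ => hc ⟨Q, hQ⟩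
      have h2 := Mx_le_of_le (condAvg_le hf ht hfi) x
      refine absurd (show 8 * omC * t < Mx f x from hx) (not_lt.2 (h1.trans ?_))
      calc 4 * Mx (condAvg S f) x ≤ 4 * (omC * (2 * t)) := by gcongr
        _ = _ := by ring
    calc t * ∫⁻ x in {x | 8 * omC * t < Mx f x}, w x
        ≤ t * ∑' Q : S, ∫⁻ x in star Q, w x := by
          gcongr
          exact (lintegral_mono_set hsub).trans (lintegral_iUnion_le _ _)
      _ = ∑' Q : S, t * ∫⁻ x in star Q, w x := ENNReal.tsum_mul_left.symm
      _ ≤ ∑' Q : S, 4 * ∫⁻ x in cell Q, f x * Mx w x := by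
          refine ENNReal.tsum_le_tsum fun Q => ?_
          -- The stopping rule bounds `t` by the mean of `f`. The integral of `w` over the
          -- enlargement, divided by `elen Q`, is up to the factor 4 a mean that enters `Mx w` at
          -- every point of the cell.
          calc t * ∫⁻ x in star Q, w x ≤ avg f Q * (4 * ∫⁻ x, om Q x * w x) := by
                gcongr
                · exact Q.2.1.le
                · exact setLIntegral_star_le _ _
            _ = 4 * ((∫⁻ x in cell Q, f x) * ((elen Q)⁻¹ * ∫⁻ x, om Q x * w x)) := by
                unfold avg; ring
            _ = 4 * ∫⁻ x in cell Q, f x * ((elen Q)⁻¹ * ∫⁻ x, om Q x * w x) := by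
                rw [lintegral_mul_const _ hf]
            _ ≤ _ := by
                gcongr 4 * ?_
                apply setLIntegral_mono' (measurableSet_cell _)
                intro x hx
                gcongr
                exact le_Mx w (cell_subset_arc _ hx)
      _ = 4 * ∑' Q : S, ∫⁻ x in cell Q, f x * Mx w x := ENNReal.tsum_mul_left
      _ ≤ _ := by gcongr; exact hS.tsum_lintegral_le _
  -- With total mass above `t` no stopping is needed: the integral of `w` over the circle is at most
  -- `4 Mx w x` at every point.
  · calc t * ∫⁻ x in {x | 8 * omC * t < Mx f x}, w x
        ≤ (∫⁻ x, f x) * ∫⁻ x, w x := by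
          gcongr
          · exact (not_le.1 hfi).le
          · exact Measure.restrict_le_self
      _ = ∫⁻ x, f x * ∫⁻ y, w y := (lintegral_mul_const _ hf).symm
      _ ≤ ∫⁻ x, 4 * (f x * Mx w x) := by
          apply lintegral_mono
          intro x
          calc f x * ∫⁻ y, w y ≤ f x * (4 * Mx w x) := by
                gcongr; exact lintegral_le_four_Mx w x
            _ = _ := by ring
      _ = _ := lintegral_const_mul' _ _ (by norm_num)


/-! ### Interpolation of distributional inequalities -/

lemma lintegral_Ioo_rpow {a s : ℝ} (ha : 0 ≤ a) (hs : -1 < s) :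
    ∫⁻ t in Set.Ioo 0 a, ENNReal.ofReal (t ^ s) = ENNReal.ofReal (a ^ (s + 1) / (s + 1)) := by
  rw [setLIntegral_congr Ioo_ae_eq_Ioc, ← ofReal_integral_eq_lintegral_ofReal]
  · rw [← intervalIntegral.integral_of_le ha, integral_rpow (Or.inl hs),
      Real.zero_rpow (by linarith), sub_zero]
  · exact (intervalIntegrable_iff_integrableOn_Ioc_of_le ha).1
      (intervalIntegral.intervalIntegrable_rpow' hs)
  · filter_upwards [ae_restrict_mem measurableSet_Ioc] with t ht
    exact Real.rpow_nonneg ht.1.le s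

lemma lintegral_Ioi_rpow {a s : ℝ} (ha : 0 < a) (hs : s < -1) :
    ∫⁻ t in Set.Ioi a, ENNReal.ofReal (t ^ s) = ENNReal.ofReal (-a ^ (s + 1) / (s + 1)) := by
  rw [← ofReal_integral_eq_lintegral_ofReal]
  · rw [integral_Ioi_rpow_of_lt hs ha]
  · exact integrableOn_Ioi_rpow_of_lt hs ha
  · filter_upwards [ae_restrict_mem measurableSet_Ioi] with t ht
    exact Real.rpow_nonneg (ha.trans ht).le s

lemma lintegral_rpow_sub_one {a p : ℝ} (ha : 0 ≤ a) (hp : 0 < p) :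
    ∫⁻ t in Set.Ioo 0 a, ENNReal.ofReal (p * t ^ (p - 1)) = ENNReal.ofReal (a ^ p) := by
  simp_rw [ENNReal.ofReal_mul hp.le]
  rw [lintegral_const_mul' _ _ (by simp), lintegral_Ioo_rpow ha (by linarith),
    ← ENNReal.ofReal_mul hp.le]
  congr 1
  rw [sub_add_cancel]
  field_simp

lemma setLIntegral_Ioi_ite_ge {g : ℝ → ℝ≥0∞} {a : ℝ} {v : ℝ≥0∞} (h : ENNReal.ofReal a ≤ v) :
    ∫⁻ t in Set.Ioo 0 a, g t ≤
      ∫⁻ t in Set.Ioi (0 : ℝ), g t * (if ENNReal.ofReal t < v then 1 else 0) := by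
  calc ∫⁻ t in Set.Ioo 0 a, g t
      = ∫⁻ t in Set.Ioo 0 a, g t * (if ENNReal.ofReal t < v then 1 else 0) := by
        apply setLIntegral_congr_fun measurableSet_Ioo
        intro t ht
        have : ENNReal.ofReal t < v :=
          ((ENNReal.ofReal_lt_ofReal_iff (ht.1.trans ht.2)).2 ht.2).trans_le h
        simp [this]
    _ ≤ _ := lintegral_mono_set fun t ht => ht.1

/-- The layer-cake formula as an inequality. At `v = ⊤` every finite truncation is available, and
these are unbounded. -/
lemma rpow_le_lintegral {p : ℝ} (hp : 0 < p) (v : ℝ≥0∞) :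
    v ^ p ≤ ∫⁻ t in Set.Ioi (0 : ℝ),
      ENNReal.ofReal (p * t ^ (p - 1)) * (if ENNReal.ofReal t < v then 1 else 0) := by
  have key : ∀ a : ℝ≥0, (a : ℝ≥0∞) ≤ v → (a : ℝ≥0∞) ^ p ≤ ∫⁻ t in Set.Ioi (0 : ℝ),
      ENNReal.ofReal (p * t ^ (p - 1)) * (if ENNReal.ofReal t < v then 1 else 0) := by
    intro a ha
    refine le_trans (le_of_eq ?_) (setLIntegral_Ioi_ite_ge (a := (a : ℝ)) (by simpa using ha))
    rw [lintegral_rpow_sub_one a.coe_nonneg hp, ← ENNReal.ofReal_rpow_of_nonneg a.coe_nonneg hp.le]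
    simp
  induction v with
  | top =>
    rw [ENNReal.top_rpow_of_pos hp, top_le_iff]
    by_contra hc
    obtain ⟨n, hn⟩ := ENNReal.lt_iff_exists_nnreal_btwn.1 (lt_top_iff_ne_top.2 hc)
    replace hn := hn.1
    obtain ⟨m, hm⟩ : ∃ m : ℝ≥0, n ≤ m ^ p := by
      refine ⟨n ^ p⁻¹, ?_⟩
      rw [NNReal.rpow_inv_rpow hp.ne']
    refine absurd (key m le_top) (not_le.2 (hn.trans_le ?_))
    rw [← ENNReal.coe_rpow_of_nonneg _ hp.le]
    exact_mod_cast hm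
  | coe a => exact key a le_rfl

variable {α β : Type*} [MeasurableSpace α] [MeasurableSpace β]

lemma measurable_ite_lt {v : β → ℝ≥0∞} (hv : Measurable v) :
    Measurable fun q : β × ℝ => (if ENNReal.ofReal q.2 < v q.1 then 1 else 0 : ℝ≥0∞) :=
  Measurable.ite (measurableSet_lt (by fun_prop) (by fun_prop)) measurable_const measurable_const

lemma lintegral_rpow_le_lintegral_measure {p : ℝ} (hp : 0 < p) {ν : Measure β} [SFinite ν]
    {v : β → ℝ≥0∞} (hv : Measurable v) :
    ∫⁻ x, v x ^ p ∂ν ≤ ∫⁻ t in Set.Ioi (0 : ℝ),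
      ENNReal.ofReal (p * t ^ (p - 1)) * ν {x | ENNReal.ofReal t < v x} := by
  calc ∫⁻ x, v x ^ p ∂ν ≤ ∫⁻ x, (∫⁻ t in Set.Ioi (0 : ℝ), ENNReal.ofReal (p * t ^ (p - 1)) *
        (if ENNReal.ofReal t < v x then 1 else 0)) ∂ν := lintegral_mono fun x => rpow_le_lintegral hp _
    _ = ∫⁻ t in Set.Ioi (0 : ℝ), ∫⁻ x, ENNReal.ofReal (p * t ^ (p - 1)) *
        (if ENNReal.ofReal t < v x then 1 else 0) ∂ν := by
      apply lintegral_lintegral_swap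
      apply Measurable.aemeasurable
      exact Measurable.mul (by fun_prop) (measurable_ite_lt hv)
    _ = _ := by
      congr 1; ext t
      rw [lintegral_const_mul' _ _ ENNReal.ofReal_ne_top]
      congr 1
      have : MeasurableSet {x | ENNReal.ofReal t < v x} := measurableSet_lt measurable_const hv
      rw [← lintegral_indicator_one this]
      congr 1; ext x
      by_cases hx : ENNReal.ofReal t < v x <;> simp [Set.indicator, hx]

lemma lintegral_restrict_lt {μ : Measure α} {u : α → ℝ≥0∞} (hu : Measurable u) (c : ℝ≥0∞)
    (g : α → ℝ≥0∞) :
    ∫⁻ x in {x | c < u x}, g x ∂μ = ∫⁻ x, g x * (if c < u x then 1 else 0) ∂μ := by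
  have : MeasurableSet {x | c < u x} := measurableSet_lt measurable_const hu
  rw [← lintegral_indicator this]
  congr 1; ext x
  by_cases h : c < u x <;> simp [Set.indicator, h]

lemma lintegral_restrict_le {μ : Measure α} {u : α → ℝ≥0∞} (hu : Measurable u) (c : ℝ≥0∞)
    (g : α → ℝ≥0∞) :
    ∫⁻ x in {x | u x ≤ c}, g x ∂μ = ∫⁻ x, g x * (if c < u x then 0 else 1) ∂μ := by
  have : MeasurableSet {x | u x ≤ c} := measurableSet_le hu measurable_const
  rw [← lintegral_indicator this]
  congr 1; ext x
  by_cases h : c < u x <;> simp [Set.indicator, h, not_le.2, not_lt.1]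

/-- `∫_{t < u} t^(p-2) u dt` is a multiple of `u ^ p`. -/
lemma lintegral_large_le {p : ℝ} (hp : 1 < p) (u : ℝ≥0∞) :
    ∫⁻ t in Set.Ioi (0 : ℝ), ENNReal.ofReal (p * t ^ (p - 2)) *
      (u * (if ENNReal.ofReal t < u then 1 else 0)) ≤ ENNReal.ofReal (p / (p - 1)) * u ^ p := by
  induction u with
  | top =>
    rw [ENNReal.top_rpow_of_pos (by linarith), ENNReal.mul_top]
    · exact le_top
    · have : 0 < p / (p - 1) := div_pos (by linarith) (by linarith)
      simpa using this
  | coe a =>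
    have h1 : ∀ t ∈ Set.Ioi (0 : ℝ), ENNReal.ofReal (p * t ^ (p - 2)) *
        ((a : ℝ≥0∞) * (if ENNReal.ofReal t < a then 1 else 0)) =
        (Set.Ioo 0 (a : ℝ)).indicator
          (fun t => ENNReal.ofReal (p * a) * ENNReal.ofReal (t ^ (p - 2))) t := by
      intro t ht
      by_cases h : t < a
      · have h' : ENNReal.ofReal t < a := by
          rw [← ENNReal.ofReal_coe_nnreal]
          exact (ENNReal.ofReal_lt_ofReal_iff (lt_trans ht h)).2 h
        rw [Set.indicator_of_mem (show t ∈ Set.Ioo 0 (a : ℝ) from ⟨ht, h⟩), if_pos h', mul_one,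
          ENNReal.ofReal_mul (by linarith), ENNReal.ofReal_mul (by linarith),
          ENNReal.ofReal_coe_nnreal]
        ring
      · have h' : ¬ ENNReal.ofReal t < a := by
          rw [not_lt, ← ENNReal.ofReal_coe_nnreal]
          exact ENNReal.ofReal_le_ofReal (not_lt.1 h)
        rw [Set.indicator_of_notMem (fun hm => h hm.2), if_neg h', mul_zero, mul_zero]
    rw [setLIntegral_congr_fun measurableSet_Ioi h1, setLIntegral_indicator measurableSet_Ioo,
      Set.inter_eq_left.2 (show Set.Ioo 0 (a : ℝ) ⊆ Set.Ioi 0 from fun t ht => ht.1), lintegral_const_mul' _ _ (by simp),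
      lintegral_Ioo_rpow a.coe_nonneg (by linarith), ← ENNReal.ofReal_mul (by have := a.coe_nonneg; positivity),
      ← ENNReal.ofReal_coe_nnreal, ENNReal.ofReal_rpow_of_nonneg a.coe_nonneg (by linarith),
      ← ENNReal.ofReal_mul (div_nonneg (by linarith) (by linarith))]
    apply le_of_eq
    congr 1
    rw [show p - 2 + 1 = p - 1 by ring]
    have : (a : ℝ) * (a : ℝ) ^ (p - 1) = (a : ℝ) ^ p := by
      rcases eq_or_ne (a : ℝ) 0 with h0 | h0
      · rw [h0, Real.zero_rpow (by linarith), Real.zero_rpow (by linarith), mul_zero]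
      · have hpos : 0 < (a : ℝ) := lt_of_le_of_ne a.coe_nonneg (Ne.symm h0)
        rw [← Real.rpow_one_add' a.coe_nonneg (by linarith)]
        congr 1; ring
    rw [← this]
    ring

/-- `∫_{t ≥ u} t^(p-3) u^2 dt` is a multiple of `u ^ p`. -/
lemma lintegral_small_le {p : ℝ} (hp : 1 ≤ p) (hp2 : p < 2) (u : ℝ≥0∞) :
    ∫⁻ t in Set.Ioi (0 : ℝ), ENNReal.ofReal (p * t ^ (p - 3)) *
      (u ^ 2 * (if ENNReal.ofReal t < u then 0 else 1)) ≤ ENNReal.ofReal (p / (2 - p)) * u ^ p := by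
  have hK : 0 < p / (2 - p) := div_pos (by linarith) (by linarith)
  induction u with
  | top =>
    rw [ENNReal.top_rpow_of_pos (by linarith), ENNReal.mul_top (by simpa using hK)]
    exact le_top
  | coe a =>
    rcases eq_or_ne a 0 with rfl | h0
    · simp
    have hpos : 0 < (a : ℝ) := lt_of_le_of_ne a.coe_nonneg (Ne.symm (by exact_mod_cast h0))
    have h1 : ∀ t ∈ Set.Ioi (0 : ℝ), ENNReal.ofReal (p * t ^ (p - 3)) *
        ((a : ℝ≥0∞) ^ 2 * (if ENNReal.ofReal t < a then 0 else 1)) =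
        (Set.Ici (a : ℝ)).indicator
          (fun t => ENNReal.ofReal (p * a ^ 2) * ENNReal.ofReal (t ^ (p - 3))) t := by
      intro t ht
      by_cases h : t < a
      · have h' : ENNReal.ofReal t < a := by
          rw [← ENNReal.ofReal_coe_nnreal]
          exact (ENNReal.ofReal_lt_ofReal_iff (lt_trans ht h)).2 h
        rw [Set.indicator_of_notMem (show t ∉ Set.Ici (a : ℝ) from fun hm => not_le.2 h hm), if_pos h', mul_zero, mul_zero]
      · have h' : ¬ ENNReal.ofReal t < a := by
          rw [not_lt, ← ENNReal.ofReal_coe_nnreal]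
          exact ENNReal.ofReal_le_ofReal (not_lt.1 h)
        rw [Set.indicator_of_mem (show t ∈ Set.Ici (a : ℝ) from not_lt.1 h), if_neg h', mul_one,
          ENNReal.ofReal_mul (by linarith), ENNReal.ofReal_mul (by linarith),
          ENNReal.ofReal_pow a.coe_nonneg, ENNReal.ofReal_coe_nnreal]
        ring
    rw [setLIntegral_congr_fun measurableSet_Ioi h1, setLIntegral_indicator measurableSet_Ici,
      Set.inter_eq_left.2 (show Set.Ici (a : ℝ) ⊆ Set.Ioi 0 from fun t ht => hpos.trans_le ht), setLIntegral_congr Ioi_ae_eq_Ici.symm,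
      lintegral_const_mul' _ _ (by simp),
      lintegral_Ioi_rpow hpos (by linarith), ← ENNReal.ofReal_mul (by positivity),
      ← ENNReal.ofReal_coe_nnreal, ENNReal.ofReal_rpow_of_nonneg a.coe_nonneg (by linarith),
      ← ENNReal.ofReal_mul hK.le]
    apply le_of_eq
    congr 1
    rw [show p - 3 + 1 = p - 2 by ring]
    have : (a : ℝ) ^ 2 * (a : ℝ) ^ (p - 2) = (a : ℝ) ^ p := by
      rw [← Real.rpow_natCast, ← Real.rpow_add hpos]
      congr 1; push_cast; ring
    rw [← this]
    have h2 : p - 2 ≠ 0 := by linarith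
    have h3 : 2 - p ≠ 0 := by linarith
    field_simp
    ring

lemma ofReal_rpow_mul_inv {p t : ℝ} (hp : 0 ≤ p) (ht : 0 < t) (s : ℝ) :
    ENNReal.ofReal (p * t ^ s) * (ENNReal.ofReal t)⁻¹ = ENNReal.ofReal (p * t ^ (s - 1)) := by
  rw [← ENNReal.ofReal_inv_of_pos ht, ← ENNReal.ofReal_mul (by positivity), Real.rpow_sub_one ht.ne']
  congr 1
  field_simp

lemma measure_le_of_mul_le {t : ℝ} (ht : 0 < t) {a b : ℝ≥0∞} (h : ENNReal.ofReal t * a ≤ b) :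
    a ≤ (ENNReal.ofReal t)⁻¹ * b := by
  rw [mul_comm] at h
  rw [mul_comm, ← div_eq_mul_inv]
  exact (ENNReal.le_div_iff_mul_le (Or.inl (by simpa using ht)) (Or.inl (by simp))).2 h

lemma lintegral_lintegral_large_le {p : ℝ} (hp : 1 < p) {μ : Measure α} [SFinite μ]
    {u : α → ℝ≥0∞} (hu : Measurable u) :
    ∫⁻ t in Set.Ioi (0 : ℝ), ENNReal.ofReal (p * t ^ (p - 2)) *
      ∫⁻ x in {x | ENNReal.ofReal t < u x}, u x ∂μ ≤
      ENNReal.ofReal (p / (p - 1)) * ∫⁻ x, u x ^ p ∂μ := by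
  calc _ = ∫⁻ t in Set.Ioi (0 : ℝ), ∫⁻ x, ENNReal.ofReal (p * t ^ (p - 2)) *
        (u x * (if ENNReal.ofReal t < u x then 1 else 0)) ∂μ := by
        congr 1; ext t
        rw [lintegral_restrict_lt hu, lintegral_const_mul' _ _ ENNReal.ofReal_ne_top]
    _ = ∫⁻ x, (∫⁻ t in Set.Ioi (0 : ℝ), ENNReal.ofReal (p * t ^ (p - 2)) *
        (u x * (if ENNReal.ofReal t < u x then 1 else 0))) ∂μ := by
        symm
        apply lintegral_lintegral_swap
        apply Measurable.aemeasurable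
        exact Measurable.mul (by fun_prop) (Measurable.mul (by fun_prop) (measurable_ite_lt hu))
    _ ≤ ∫⁻ x, ENNReal.ofReal (p / (p - 1)) * u x ^ p ∂μ :=
        lintegral_mono fun x => lintegral_large_le hp _
    _ = _ := lintegral_const_mul' _ _ ENNReal.ofReal_ne_top

lemma lintegral_lintegral_small_le {p : ℝ} (hp : 1 ≤ p) (hp2 : p < 2) {μ : Measure α} [SFinite μ]
    {u : α → ℝ≥0∞} (hu : Measurable u) :
    ∫⁻ t in Set.Ioi (0 : ℝ), ENNReal.ofReal (p * t ^ (p - 3)) *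
      ∫⁻ x in {x | u x ≤ ENNReal.ofReal t}, u x ^ 2 ∂μ ≤
      ENNReal.ofReal (p / (2 - p)) * ∫⁻ x, u x ^ p ∂μ := by
  calc _ = ∫⁻ t in Set.Ioi (0 : ℝ), ∫⁻ x, ENNReal.ofReal (p * t ^ (p - 3)) *
        (u x ^ 2 * (if ENNReal.ofReal t < u x then 0 else 1)) ∂μ := by
        congr 1; ext t
        rw [lintegral_restrict_le hu, lintegral_const_mul' _ _ ENNReal.ofReal_ne_top]
    _ = ∫⁻ x, (∫⁻ t in Set.Ioi (0 : ℝ), ENNReal.ofReal (p * t ^ (p - 3)) *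
        (u x ^ 2 * (if ENNReal.ofReal t < u x then 0 else 1))) ∂μ := by
        symm
        apply lintegral_lintegral_swap
        apply Measurable.aemeasurable
        refine Measurable.mul (by fun_prop) (Measurable.mul (by fun_prop) ?_)
        exact Measurable.ite (measurableSet_lt (by fun_prop) (by fun_prop)) measurable_const
          measurable_const
    _ ≤ ∫⁻ x, ENNReal.ofReal (p / (2 - p)) * u x ^ p ∂μ :=
        lintegral_mono fun x => lintegral_small_le hp hp2 _
    _ = _ := lintegral_const_mul' _ _ ENNReal.ofReal_ne_top

/-- Interpolation between a weak `(1,1)` and an `L^∞` inequality. -/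
lemma lintegral_rpow_le_of_weak {p : ℝ} (hp : 1 < p) {μ : Measure α} {ν : Measure β} [SFinite μ]
    [SFinite ν] {u : α → ℝ≥0∞} {v : β → ℝ≥0∞} (hu : Measurable u) (hv : Measurable v) {A : ℝ≥0∞}
    (hA : A ≠ ⊤) (h : ∀ t : ℝ, 0 < t → ENNReal.ofReal t * ν {x | ENNReal.ofReal t < v x} ≤
      A * ∫⁻ x in {x | ENNReal.ofReal t < u x}, u x ∂μ) :
    ∫⁻ x, v x ^ p ∂ν ≤ A * ENNReal.ofReal (p / (p - 1)) * ∫⁻ x, u x ^ p ∂μ := by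
  calc ∫⁻ x, v x ^ p ∂ν ≤ ∫⁻ t in Set.Ioi (0 : ℝ),
        ENNReal.ofReal (p * t ^ (p - 1)) * ν {x | ENNReal.ofReal t < v x} :=
        lintegral_rpow_le_lintegral_measure (by linarith) hv
    _ ≤ ∫⁻ t in Set.Ioi (0 : ℝ), A * (ENNReal.ofReal (p * t ^ (p - 2)) *
          ∫⁻ x in {x | ENNReal.ofReal t < u x}, u x ∂μ) := by
        apply setLIntegral_mono' measurableSet_Ioi
        intro t ht
        calc _ ≤ ENNReal.ofReal (p * t ^ (p - 1)) * ((ENNReal.ofReal t)⁻¹ *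
              (A * ∫⁻ x in {x | ENNReal.ofReal t < u x}, u x ∂μ)) := by
              gcongr
              exact measure_le_of_mul_le ht (h t ht)
          _ = (ENNReal.ofReal (p * t ^ (p - 1)) * (ENNReal.ofReal t)⁻¹) *
              (A * ∫⁻ x in {x | ENNReal.ofReal t < u x}, u x ∂μ) := by ring
          _ = _ := by
              rw [ofReal_rpow_mul_inv (by linarith) ht, show p - 1 - 1 = p - 2 by ring]; ring
    _ = A * ∫⁻ t in Set.Ioi (0 : ℝ), ENNReal.ofReal (p * t ^ (p - 2)) *
          ∫⁻ x in {x | ENNReal.ofReal t < u x}, u x ∂μ := lintegral_const_mul' _ _ hA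
    _ ≤ A * (ENNReal.ofReal (p / (p - 1)) * ∫⁻ x, u x ^ p ∂μ) := by
        gcongr; exact lintegral_lintegral_large_le hp hu
    _ = _ := by ring

/-- The distributional inequality that follows from weak `(1,1)` and strong `(2,2)` bounds. -/
def WeakDist (μ : Measure α) (A : ℝ≥0∞) (u v : α → ℝ≥0∞) : Prop :=
  ∀ t : ℝ, 0 < t → ENNReal.ofReal t * μ {x | ENNReal.ofReal t < v x} ≤
    A * (∫⁻ x in {x | ENNReal.ofReal t < u x}, u x ∂μ +
      (ENNReal.ofReal t)⁻¹ * ∫⁻ x in {x | u x ≤ ENNReal.ofReal t}, u x ^ 2 ∂μ)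

/-- Marcinkiewicz interpolation: integrate the hypothesis against `p t^(p-1) dt`. The large part
needs `1 < p`, the small part needs `p < 2`. -/
lemma lintegral_rpow_le_of_weakDist {p : ℝ} (hp : 1 < p) (hp2 : p < 2) {μ : Measure α} [SFinite μ]
    {u v : α → ℝ≥0∞} (hu : Measurable u) (hv : Measurable v) {A : ℝ≥0∞} (hA : A ≠ ⊤)
    (h : WeakDist μ A u v) :
    ∫⁻ x, v x ^ p ∂μ ≤
      A * (ENNReal.ofReal (p / (p - 1)) + ENNReal.ofReal (p / (2 - p))) * ∫⁻ x, u x ^ p ∂μ := by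
  calc ∫⁻ x, v x ^ p ∂μ ≤ ∫⁻ t in Set.Ioi (0 : ℝ),
        ENNReal.ofReal (p * t ^ (p - 1)) * μ {x | ENNReal.ofReal t < v x} :=
        lintegral_rpow_le_lintegral_measure (by linarith) hv
    _ ≤ ∫⁻ t in Set.Ioi (0 : ℝ), A * (ENNReal.ofReal (p * t ^ (p - 2)) *
          ∫⁻ x in {x | ENNReal.ofReal t < u x}, u x ∂μ + ENNReal.ofReal (p * t ^ (p - 3)) *
          ∫⁻ x in {x | u x ≤ ENNReal.ofReal t}, u x ^ 2 ∂μ) := by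
        apply setLIntegral_mono' measurableSet_Ioi
        intro t ht
        have e1 := ofReal_rpow_mul_inv (p := p) (by linarith) ht (p - 1)
        have e2 := ofReal_rpow_mul_inv (p := p) (by linarith) ht (p - 2)
        rw [show p - 1 - 1 = p - 2 by ring] at e1
        rw [show p - 2 - 1 = p - 3 by ring] at e2
        rw [← e2, ← e1]
        refine (mul_le_mul_right (measure_le_of_mul_le ht (h t ht)) _).trans_eq ?_
        ring
    _ = A * ((∫⁻ t in Set.Ioi (0 : ℝ), ENNReal.ofReal (p * t ^ (p - 2)) *
          ∫⁻ x in {x | ENNReal.ofReal t < u x}, u x ∂μ) + ∫⁻ t in Set.Ioi (0 : ℝ),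
          ENNReal.ofReal (p * t ^ (p - 3)) *
          ∫⁻ x in {x | u x ≤ ENNReal.ofReal t}, u x ^ 2 ∂μ) := by
        rw [lintegral_const_mul' _ _ hA, lintegral_add_left]
        refine Measurable.mul (by fun_prop) ?_
        simp_rw [lintegral_restrict_lt hu]
        apply Measurable.lintegral_prod_left'
          (f := fun q : α × ℝ => u q.1 * (if ENNReal.ofReal q.2 < u q.1 then 1 else 0))
        exact (hu.comp measurable_fst).mul (measurable_ite_lt hu)
    _ ≤ A * (ENNReal.ofReal (p / (p - 1)) * ∫⁻ x, u x ^ p ∂μ +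
          ENNReal.ofReal (p / (2 - p)) * ∫⁻ x, u x ^ p ∂μ) := by
        exact mul_le_mul_right (add_le_add (lintegral_lintegral_large_le hp hu)
          (lintegral_lintegral_small_le hp.le hp2 hu)) _
    _ = _ := by ring

/-- Where `u ≤ t`, the quantity `t⁻¹ u²` is at most `u`, so the two terms together are at most the
integral of `u`. -/
lemma WeakDist.weak {μ : Measure α} {u v : α → ℝ≥0∞} (hu : Measurable u) {A : ℝ≥0∞}
    (h : WeakDist μ A u v) {t : ℝ} (ht : 0 < t) :
    ENNReal.ofReal t * μ {x | ENNReal.ofReal t < v x} ≤ A * ∫⁻ x, u x ∂μ := by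
  refine (h t ht).trans ?_
  refine mul_le_mul_right ?_ _
  have hm : MeasurableSet {x | ENNReal.ofReal t < u x} := measurableSet_lt measurable_const hu
  refine le_trans (add_le_add le_rfl ?_) (lintegral_add_compl u hm).le
  have : {x | ENNReal.ofReal t < u x}ᶜ = {x | u x ≤ ENNReal.ofReal t} := by ext; simp
  rw [this, ← lintegral_const_mul' _ _ (by simpa using ht)]
  apply setLIntegral_mono' (measurableSet_le hu measurable_const)
  intro x hx
  calc (ENNReal.ofReal t)⁻¹ * u x ^ 2 ≤ (ENNReal.ofReal t)⁻¹ * (ENNReal.ofReal t * u x) := by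
        rw [sq]; gcongr; exact hx
    _ = u x := by
        rw [← mul_assoc, ENNReal.inv_mul_cancel (by simpa using ht) ENNReal.ofReal_ne_top, one_mul]

/-- A distributional inequality together with all `L^p` bounds, `1 < p < ∞`. -/
structure Controlled (μ : Measure α) (A : ℝ≥0∞) (K : ℝ → ℝ≥0∞) (u v : α → ℝ≥0∞) : Prop where
  dist : WeakDist μ A u v
  strong : ∀ p : ℝ, 1 < p → ∫⁻ x, v x ^ p ∂μ ≤ K p * ∫⁻ x, u x ^ p ∂μ

/-- Slicewise control implies control on the product. -/
lemma Controlled.prod {μ : Measure α} {ν : Measure β} [SFinite μ] [SFinite ν] {A : ℝ≥0∞}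
    {K : ℝ → ℝ≥0∞} (hA : A ≠ ⊤) (hK : ∀ p, 1 < p → K p ≠ ⊤) {u v : α × β → ℝ≥0∞} (hu : Measurable u)
    (hv : Measurable v)
    (h : ∀ᵐ x ∂μ, Controlled ν A K (fun y => u (x, y)) (fun y => v (x, y))) :
    Controlled (μ.prod ν) A K u v := by
  constructor
  · intro t ht
    have hm1 : MeasurableSet {x | ENNReal.ofReal t < v x} := measurableSet_lt measurable_const hv
    have hm2 : Measurable fun q : α × β => u q * (if ENNReal.ofReal t < u q then 1 else 0) :=
      hu.mul (Measurable.ite (measurableSet_lt measurable_const hu) measurable_const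
        measurable_const)
    have hm3 : Measurable fun q : α × β => u q ^ 2 * (if ENNReal.ofReal t < u q then 0 else 1) :=
      (hu.pow_const 2).mul (Measurable.ite (measurableSet_lt measurable_const hu) measurable_const
        measurable_const)
    -- Each term is an integral over the product, so the inequality holds as soon as it holds on
    -- almost every slice with the same constant.
    rw [lintegral_restrict_lt hu, lintegral_restrict_le hu, lintegral_prod _ hm2.aemeasurable,
      lintegral_prod _ hm3.aemeasurable, Measure.prod_apply hm1,
      ← lintegral_const_mul' _ _ ENNReal.ofReal_ne_top,
      ← lintegral_const_mul' _ _ (by simpa using ht),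
      ← lintegral_add_left hm2.lintegral_prod_right', ← lintegral_const_mul' _ _ hA]
    apply lintegral_mono_ae
    filter_upwards [h] with x hx
    have := hx.dist t ht
    have hux : Measurable fun y => u (x, y) := hu.comp measurable_prodMk_left
    rw [lintegral_restrict_lt hux, lintegral_restrict_le hux] at this
    exact this
  · intro p hp
    rw [lintegral_prod _ (hu.pow_const p).aemeasurable, lintegral_prod _ (hv.pow_const p).aemeasurable,
      ← lintegral_const_mul' _ _ (hK p hp)]
    apply lintegral_mono_ae
    filter_upwards [h] with x hx
    exact hx.strong p hp


/-! ### The Zygmund space -/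

section Zygmund

variable {X : Type*} [MeasurableSpace X] {μ : Measure X}

/-- The distribution function. -/
def dist1 (μ : Measure X) (u : X → ℝ≥0∞) (l : ℝ) : ℝ≥0∞ := μ {x | ENNReal.ofReal l < u x}

lemma antitone_dist1 (u : X → ℝ≥0∞) : Antitone (dist1 μ u) := fun _ _ h =>
  measure_mono fun _ hx => (ENNReal.ofReal_le_ofReal h).trans_lt hx

lemma measurable_dist1 (u : X → ℝ≥0∞) : Measurable (dist1 μ u) := (antitone_dist1 u).measurable

/-- The largest possible integral over a set of measure `τ`. -/
def topInt (μ : Measure X) (u : X → ℝ≥0∞) (τ : ℝ≥0∞) : ℝ≥0∞ :=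
  ∫⁻ l in Set.Ioi (0 : ℝ), min τ (dist1 μ u l)

lemma topInt_mono (u : X → ℝ≥0∞) : Monotone (topInt μ u) := fun _ _ h =>
  lintegral_mono fun _ => min_le_min_right _ h

/-- Layer cake on `E`: the part of a superlevel set inside `E` is bounded both by the measure of `E`
and by the distribution function. -/
lemma setLIntegral_le_topInt [SFinite μ] {u : X → ℝ≥0∞} (hu : Measurable u) (E : Set X) :
    ∫⁻ x in E, u x ∂μ ≤ topInt μ u (μ E) := by
  have h := lintegral_rpow_le_lintegral_measure (p := 1) one_pos (ν := μ.restrict E) hu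
  simp only [ENNReal.rpow_one, sub_self, Real.rpow_zero, mul_one, ENNReal.ofReal_one, one_mul] at h
  refine h.trans (lintegral_mono fun l => le_min ?_ (Measure.restrict_le_self _))
  refine (measure_mono (Set.subset_univ _)).trans ?_
  simp

lemma ofReal_le_rearr {f : X → ℂ} {l s : ℝ}
    (h : ENNReal.ofReal s < dist1 μ (fun x => ‖f x‖ₑ) l) :
    ENNReal.ofReal l ≤ rearr μ f s := by
  refine le_iInf₂ fun m hm => ?_
  by_contra hc
  rw [not_le] at hc
  refine absurd h (not_lt.2 ((measure_mono ?_).trans hm))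
  intro x hx
  have h1 : (m : ℝ≥0∞) < ‖f x‖ₑ := hc.trans hx
  rw [enorm_eq_nnnorm, ENNReal.coe_lt_coe] at h1
  exact_mod_cast h1

/-- Both integrals measure the region below the graph of the distribution function, sliced along the
two axes; Tonelli exchanges them. -/
lemma topInt_le_lintegral_rearr [IsProbabilityMeasure μ] (f : X → ℂ) (t : ℝ) :
    topInt μ (fun x => ‖f x‖ₑ) (ENNReal.ofReal t) ≤ ∫⁻ s in Set.Ioc 0 t, rearr μ f s := by
  set d := dist1 μ (fun x => ‖f x‖ₑ) with hd
  have hmd : Measurable d := measurable_dist1 _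
  have hjm : Measurable fun q : ℝ × ℝ => (if ENNReal.ofReal q.1 < d q.2 then 1 else 0 : ℝ≥0∞) :=
    Measurable.ite (measurableSet_lt (by fun_prop) (by fun_prop)) measurable_const measurable_const
  calc topInt μ (fun x => ‖f x‖ₑ) (ENNReal.ofReal t)
      ≤ ∫⁻ l in Set.Ioi (0 : ℝ), (∫⁻ s in Set.Ioc 0 t,
          (if ENNReal.ofReal s < d l then 1 else 0)) := by
        apply lintegral_mono
        intro l
        have hdl : d l ≠ ⊤ := measure_ne_top _ _
        have hsub : Set.Ioo 0 (min t (d l).toReal) ⊆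
            {s | ENNReal.ofReal s < d l} ∩ Set.Ioc 0 t := by
          intro s hs
          have h2 := hs.2
          rw [lt_min_iff] at h2
          exact ⟨(ENNReal.ofReal_lt_iff_lt_toReal hs.1.le hdl).2 h2.2, hs.1, h2.1.le⟩
        have hm : MeasurableSet {s : ℝ | ENNReal.ofReal s < d l} :=
          measurableSet_lt (by fun_prop) measurable_const
        calc min (ENNReal.ofReal t) (d l) = volume (Set.Ioo 0 (min t (d l).toReal)) := by
              rw [Real.volume_Ioo, sub_zero, ENNReal.ofReal_min, ENNReal.ofReal_toReal hdl]
          _ ≤ volume ({s | ENNReal.ofReal s < d l} ∩ Set.Ioc 0 t) := measure_mono hsub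
          _ = ∫⁻ s in Set.Ioc 0 t, {s | ENNReal.ofReal s < d l}.indicator 1 s := by
              rw [lintegral_indicator_one hm, Measure.restrict_apply hm]
          _ = _ := by
              congr 1; ext s
              by_cases hx : ENNReal.ofReal s < d l <;> simp [Set.indicator, hx]
    _ = ∫⁻ s in Set.Ioc 0 t, (∫⁻ l in Set.Ioi (0 : ℝ),
          (if ENNReal.ofReal s < d l then 1 else 0)) := by
        symm
        exact lintegral_lintegral_swap hjm.aemeasurable
    _ ≤ ∫⁻ s in Set.Ioc 0 t, rearr μ f s := by
        apply lintegral_mono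
        intro s
        have hm : MeasurableSet {l : ℝ | ENNReal.ofReal s < d l} :=
          measurableSet_lt measurable_const hmd
        calc ∫⁻ l in Set.Ioi (0 : ℝ), (if ENNReal.ofReal s < d l then 1 else 0 : ℝ≥0∞)
            = ∫⁻ l in Set.Ioi (0 : ℝ), {l : ℝ | ENNReal.ofReal s < d l}.indicator 1 l := by
              congr 1; ext l
              by_cases hx : ENNReal.ofReal s < d l <;> simp [Set.indicator, hx]
          _ = volume ({l | ENNReal.ofReal s < d l} ∩ Set.Ioi 0) := by
              rw [lintegral_indicator_one hm, Measure.restrict_apply hm]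
          _ ≤ rearr μ f s := by
              by_cases htop : rearr μ f s = ⊤
              · rw [htop]; exact le_top
              calc _ ≤ volume (Set.Ioc 0 (rearr μ f s).toReal) := by
                    apply measure_mono
                    rintro l ⟨hl, hl0⟩
                    exact ⟨hl0, (ENNReal.ofReal_le_iff_le_toReal htop).1 (ofReal_le_rearr hl)⟩
                _ = _ := by rw [Real.volume_Ioc, sub_zero, ENNReal.ofReal_toReal htop]

lemma mul_topInt_one_le (u : X → ℝ≥0∞) {τ : ℝ≥0∞} (hτ : τ ≤ 1) :
    τ * topInt μ u 1 ≤ topInt μ u τ := by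
  rw [topInt, topInt, ← lintegral_const_mul' _ _ (ne_top_of_le_ne_top ENNReal.one_ne_top hτ)]
  refine lintegral_mono fun l => le_min ?_ ?_
  · exact (mul_le_mul_right (min_le_left _ _) _).trans_eq (mul_one _)
  · exact (mul_le_of_le_one_left' hτ).trans (min_le_right _ _)

lemma lintegral_le_topInt_one [IsProbabilityMeasure μ] {u : X → ℝ≥0∞} (hu : Measurable u) :
    ∫⁻ x, u x ∂μ ≤ topInt μ u 1 := by
  have := setLIntegral_le_topInt (μ := μ) hu Set.univ
  rwa [Measure.restrict_univ, measure_univ] at this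

lemma lintegral_topInt_le [IsProbabilityMeasure μ] (f : X → ℂ) :
    ∫⁻ t in Set.Ioo (0 : ℝ) 1, ENNReal.ofReal (1 / t) *
      topInt μ (fun x => ‖f x‖ₑ) (ENNReal.ofReal t) ≤ LlogLNorm μ f := by
  unfold LlogLNorm rearr2
  refine le_trans ?_ (lintegral_mono_set Set.Ioo_subset_Ioc_self)
  apply setLIntegral_mono' measurableSet_Ioo
  intro t _
  gcongr
  exact topInt_le_lintegral_rearr f t

/-- By concavity, `topInt` at `t` divided by `t` is at least its value at 1, which dominates the
`L¹` norm; average over `0 < t < 1`. -/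
lemma lintegral_enorm_le_LlogLNorm [IsProbabilityMeasure μ] {f : X → ℂ} (hf : Measurable f) :
    ∫⁻ x, ‖f x‖ₑ ∂μ ≤ LlogLNorm μ f := by
  refine le_trans ?_ (lintegral_topInt_le f)
  calc ∫⁻ x, ‖f x‖ₑ ∂μ = ∫⁻ t in Set.Ioo (0 : ℝ) 1, (∫⁻ x, ‖f x‖ₑ ∂μ) := by
        rw [setLIntegral_const, Real.volume_Ioo]; simp
    _ ≤ _ := by
        apply setLIntegral_mono' measurableSet_Ioo
        intro t ht
        have h1 : ENNReal.ofReal t ≤ 1 := by rw [ENNReal.ofReal_le_one]; exact ht.2.le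
        calc ∫⁻ x, ‖f x‖ₑ ∂μ ≤ topInt μ (fun x => ‖f x‖ₑ) 1 := lintegral_le_topInt_one hf.enorm
          _ = ENNReal.ofReal (1 / t) * (ENNReal.ofReal t * topInt μ (fun x => ‖f x‖ₑ) 1) := by
              rw [← mul_assoc, ← ENNReal.ofReal_mul (by have := ht.1; positivity),
                one_div_mul_cancel ht.1.ne', ENNReal.ofReal_one, one_mul]
          _ ≤ _ := by gcongr; exact mul_topInt_one_le _ h1

/-- The substitution `s = N / t` preserves `dt / t`. It converts the Chebyshev bound `N / t` on the
size of a superlevel set into an integral over `0 < s < 1`. -/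
lemma lintegral_Ioi_subst {N : ℝ} (hN : 0 < N) (Φ : ℝ≥0∞ → ℝ≥0∞) :
    ∫⁻ t in Set.Ioi N, ENNReal.ofReal (1 / t) * Φ (ENNReal.ofReal (N / t)) ≤
      ∫⁻ s in Set.Ioo (0 : ℝ) 1, ENNReal.ofReal (1 / s) * Φ (ENNReal.ofReal s) := by
  have himg : Set.Ioi N ⊆ (fun s : ℝ => N / s) '' Set.Ioo 0 1 := by
    intro t ht
    have ht' : N < t := ht
    have htp : 0 < t := hN.trans ht'
    refine ⟨N / t, ⟨by positivity, (div_lt_one htp).2 ht'⟩, ?_⟩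
    field_simp
  refine (lintegral_mono_set himg).trans ?_
  rw [lintegral_image_eq_lintegral_abs_deriv_mul (f' := fun s => -N / s ^ 2) measurableSet_Ioo]
  · apply setLIntegral_mono' measurableSet_Ioo
    intro s hs
    have hs0 := hs.1
    rw [← mul_assoc, ← ENNReal.ofReal_mul (abs_nonneg _)]
    apply le_of_eq
    have e1 : |(-N / s ^ 2)| * (1 / (N / s)) = 1 / s := by
      rw [abs_div, abs_neg, abs_of_pos hN, abs_of_pos (by positivity)]
      field_simp
    have e2 : N / (N / s) = s := by field_simp
    rw [e1, e2]
  · intro s hs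
    have h := (hasDerivAt_inv hs.1.ne').const_mul N
    have h2 : HasDerivAt (fun s : ℝ => N / s) (-N / s ^ 2) s := by
      refine (h.congr_deriv ?_).congr_of_eventuallyEq
        (Filter.Eventually.of_forall fun x => div_eq_mul_inv N x)
      rw [neg_div, mul_neg, div_eq_mul_inv]
    exact h2.hasDerivWithinAt
  · intro a ha b hb hab
    have h1 := ha.1
    have h2 := hb.1
    simp only at hab
    field_simp at hab
    exact hab.symm

/-- Weak `(1,1)` and strong `(2,2)` bounds imply a bound from the Zygmund space to `L^1`. -/
lemma WeakDist.lintegral_le [IsProbabilityMeasure μ] {f : X → ℂ} (hf : Measurable f)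
    {v : X → ℝ≥0∞} (hv : Measurable v) {A : ℝ≥0∞} (hA : A ≠ ⊤)
    (h : WeakDist μ A (fun x => ‖f x‖ₑ) v) :
    ∫⁻ x, v x ∂μ ≤ (1 + 2 * A) * LlogLNorm μ f := by
  set N := LlogLNorm μ f with hNdef
  set u : X → ℝ≥0∞ := fun x => ‖f x‖ₑ with hudef
  have hu : Measurable u := hf.enorm
  by_cases hN : N = ⊤
  · rw [hN, ENNReal.mul_top (by simp)]; exact le_top
  have huN : ∫⁻ x, u x ∂μ ≤ N := lintegral_enorm_le_LlogLNorm hf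
  -- A positive `M` above the norm is used because the norm may vanish; it is sent to the norm at
  -- the end. Heights below `M` are paid for by the total mass 1.
  have key : ∀ M : ℝ, 0 < M → N ≤ ENNReal.ofReal M →
      ∫⁻ x, v x ∂μ ≤ ENNReal.ofReal M + 2 * A * N := by
    intro M hM hNM
    have h1 := lintegral_rpow_le_lintegral_measure (p := 1) one_pos (ν := μ) hv
    simp only [ENNReal.rpow_one, sub_self, Real.rpow_zero, mul_one, ENNReal.ofReal_one,
      one_mul] at h1
    have hunion : Set.Ioi (0 : ℝ) = Set.Ioc 0 M ∪ Set.Ioi M :=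
      (Set.Ioc_union_Ioi_eq_Ioi hM.le).symm
    rw [hunion] at h1
    refine h1.trans ((lintegral_union_le _ _ _).trans ?_)
    refine add_le_add ?_ ?_
    · calc _ ≤ ∫⁻ t in Set.Ioc (0 : ℝ) M, 1 := lintegral_mono fun t => prob_le_one
        _ = _ := by simp
    · calc ∫⁻ t in Set.Ioi M, μ {x | ENNReal.ofReal t < v x}
          ≤ ∫⁻ t in Set.Ioi M, A * (ENNReal.ofReal (1 / t) * topInt μ u (ENNReal.ofReal (M / t)) +
            ENNReal.ofReal (1 * t ^ ((1 : ℝ) - 3)) *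
              ∫⁻ x in {x | u x ≤ ENNReal.ofReal t}, u x ^ 2 ∂μ) := by
            apply setLIntegral_mono' measurableSet_Ioi
            intro t ht
            have ht0 : 0 < t := hM.trans ht
            refine (measure_le_of_mul_le ht0 (h t ht0)).trans ?_
            have e1 : (ENNReal.ofReal t)⁻¹ = ENNReal.ofReal (1 / t) := by
              rw [one_div, ENNReal.ofReal_inv_of_pos ht0]
            have e2 : (ENNReal.ofReal t)⁻¹ * (ENNReal.ofReal t)⁻¹ =
                ENNReal.ofReal (1 * t ^ ((1 : ℝ) - 3)) := by
              rw [← ENNReal.ofReal_inv_of_pos ht0, ← ENNReal.ofReal_mul (by positivity),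
                show (1 : ℝ) - 3 = ((-2 : ℤ) : ℝ) by norm_num, Real.rpow_intCast]
              congr 1
              rw [zpow_neg, one_mul]
              field_simp
            -- By Chebyshev the set has measure at most `M / t`, so the integral over it is at most
            -- `topInt` there.
            have h2 : ∫⁻ x in {x | ENNReal.ofReal t < u x}, u x ∂μ ≤
                topInt μ u (ENNReal.ofReal (M / t)) := by
              refine (setLIntegral_le_topInt hu _).trans (topInt_mono u ?_)
              have h3 : ENNReal.ofReal t * μ {x | ENNReal.ofReal t < u x} ≤ ENNReal.ofReal M := by
                refine le_trans ?_ ((mul_meas_ge_le_lintegral hu (ENNReal.ofReal t)).trans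
                  (huN.trans hNM))
                exact mul_le_mul_right (measure_mono fun x (hx : ENNReal.ofReal t < u x) => hx.le) _
              refine (measure_le_of_mul_le ht0 h3).trans_eq ?_
              rw [e1, ← ENNReal.ofReal_mul (by positivity)]
              congr 1; field_simp
            calc (ENNReal.ofReal t)⁻¹ * (A * (∫⁻ x in {x | ENNReal.ofReal t < u x}, u x ∂μ +
                  (ENNReal.ofReal t)⁻¹ * ∫⁻ x in {x | u x ≤ ENNReal.ofReal t}, u x ^ 2 ∂μ))
                ≤ (ENNReal.ofReal t)⁻¹ * (A * (topInt μ u (ENNReal.ofReal (M / t)) +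
                  (ENNReal.ofReal t)⁻¹ * ∫⁻ x in {x | u x ≤ ENNReal.ofReal t}, u x ^ 2 ∂μ)) := by
                  gcongr
              _ = _ := by rw [← e2, ← e1]; ring
        _ = A * ((∫⁻ t in Set.Ioi M, ENNReal.ofReal (1 / t) *
              topInt μ u (ENNReal.ofReal (M / t))) +
            ∫⁻ t in Set.Ioi M, ENNReal.ofReal (1 * t ^ ((1 : ℝ) - 3)) *
              ∫⁻ x in {x | u x ≤ ENNReal.ofReal t}, u x ^ 2 ∂μ) := by
            rw [lintegral_const_mul' _ _ hA, lintegral_add_left]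
            exact Measurable.mul (by fun_prop) ((topInt_mono u).measurable.comp (by fun_prop))
        _ ≤ A * (N + N) := by
            gcongr
            · exact (lintegral_Ioi_subst hM _).trans (lintegral_topInt_le f)
            -- The small part at exponent `p = 1` has constant `1 / (2 - 1) = 1`, hence costs only
            -- the `L¹` norm.
            · refine (lintegral_mono_set (Set.Ioi_subset_Ioi hM.le)).trans
                ((lintegral_lintegral_small_le le_rfl (by norm_num) hu).trans ?_)
              norm_num
              exact huN
        _ = 2 * A * N := by ring
  refine ENNReal.le_of_forall_pos_le_add fun ε hε _ => ?_
  have hNε : N + ε = ENNReal.ofReal (N.toReal + ε) := by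
    rw [ENNReal.ofReal_add ENNReal.toReal_nonneg ε.coe_nonneg, ENNReal.ofReal_toReal hN]
    simp
  have := key (N.toReal + ε) (by have := ENNReal.toReal_nonneg (a := N); positivity)
    (by rw [← hNε]; exact le_self_add)
  refine this.trans_eq ?_
  rw [← hNε]
  ring

end Zygmund


/-! ### Bounds for the maximal function -/

lemma omC_ne_zero : omC ≠ 0 := by
  unfold omC
  simp [Real.pi_pos]

/-- The constant in the weighted maximal inequality. -/
def weightK (p : ℝ) : ℝ≥0∞ := 32 * ENNReal.ofReal (p / (p - 1)) * (2 * omC) ^ p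

lemma weightK_ne_top (p : ℝ) : weightK p ≠ ⊤ := by
  unfold weightK
  have h1 : 2 * omC ≠ 0 := mul_ne_zero (by norm_num) omC_ne_zero
  have h2 : 2 * omC ≠ ⊤ := ENNReal.mul_ne_top (by norm_num) omC_ne_top
  exact ENNReal.mul_ne_top (ENNReal.mul_ne_top (by norm_num) (by simp))
    (ENNReal.rpow_ne_top_of_ne_zero h1 h2)

lemma lintegral_withDensity_lt {f w : UnitAddCircle → ℝ≥0∞} (hf : Measurable f)
    (hw : Measurable w) (c : ℝ≥0∞) (g : UnitAddCircle → ℝ≥0∞) (hg : Measurable g) :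
    ∫⁻ x in {x | c < f x}, g x ∂(volume.withDensity w) = ∫⁻ x in {x | c < f x}, g x * w x := by
  rw [setLIntegral_withDensity_eq_setLIntegral_mul _ hw hg (measurableSet_lt measurable_const hf)]
  simp_rw [Pi.mul_apply, mul_comm]

/-- Cut `f` at height `T / (2 omC)`. The lower part has maximal function at most `T / 2`, so the
upper part must exceed `T / 2 = 8 omC * (T / (16 omC))`, the level in `Mx_weak`. The final constant
is `16 omC * 4 = 32 * (2 omC)`. -/
lemma Mx_weak_large {f w : UnitAddCircle → ℝ≥0∞} (hf : Measurable f) (t : ℝ) :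
    ENNReal.ofReal t * ∫⁻ x in {x | ENNReal.ofReal t < Mx f x}, w x ≤
      32 * ∫⁻ x in {x | ENNReal.ofReal t < 2 * omC * f x}, 2 * omC * f x * Mx w x := by
  have hT : ENNReal.ofReal t ≠ ⊤ := ENNReal.ofReal_ne_top
  set T := ENNReal.ofReal t
  have hmE : MeasurableSet {x | T < 2 * omC * f x} :=
    measurableSet_lt measurable_const (hf.const_mul _)
  set f₁ := {x | T < 2 * omC * f x}.indicator f with hf₁
  set f₂ := {x | T < 2 * omC * f x}ᶜ.indicator f with hf₂
  have hc0 : 16 * omC ≠ 0 := mul_ne_zero (by norm_num) omC_ne_zero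
  have hct : 16 * omC ≠ ⊤ := ENNReal.mul_ne_top (by norm_num) omC_ne_top
  have hd0 : 2 * omC ≠ 0 := mul_ne_zero (by norm_num) omC_ne_zero
  have hdt : 2 * omC ≠ ⊤ := ENNReal.mul_ne_top (by norm_num) omC_ne_top
  have hsub : {x | T < Mx f x} ⊆ {x | 8 * omC * (T / (16 * omC)) < Mx f₁ x} := by
    intro x hx
    have h1 : Mx f x ≤ Mx f₁ x + Mx f₂ x := by
      refine le_trans (le_of_eq ?_) (Mx_add_le (hf.indicator hmE) x)
      congr 1; ext y
      exact (Set.indicator_self_add_compl_apply _ f y).symm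
    have h2 : Mx f₂ x ≤ omC * (T / (2 * omC)) := by
      refine Mx_le_of_le (Filter.Eventually.of_forall fun y => ?_) x
      by_cases hy : T < 2 * omC * f y
      · rw [hf₂, Set.indicator_of_notMem (by simpa using hy)]; exact zero_le
      · rw [hf₂, Set.indicator_of_mem (by simpa using hy),
          ENNReal.le_div_iff_mul_le (Or.inl hd0) (Or.inl hdt), mul_comm]
        exact not_lt.1 hy
    have e1 : omC * (T / (2 * omC)) = T / 2 := by
      rw [div_eq_mul_inv, ENNReal.mul_inv (by simp) (by simp), div_eq_mul_inv]
      rw [show omC * (T * (2⁻¹ * omC⁻¹)) = T * 2⁻¹ * (omC * omC⁻¹) by ring,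
        ENNReal.mul_inv_cancel omC_ne_zero omC_ne_top, mul_one]
    have e2 : 8 * omC * (T / (16 * omC)) = T / 2 := by
      rw [show (16 : ℝ≥0∞) * omC = (8 * omC) * 2 by ring, ← mul_div_assoc,
        ENNReal.mul_div_mul_left _ _ (mul_ne_zero (by norm_num) omC_ne_zero)
          (ENNReal.mul_ne_top (by norm_num) omC_ne_top)]
    change 8 * omC * (T / (16 * omC)) < Mx f₁ x
    rw [e2]
    by_contra hc
    refine absurd (show T < Mx f x from hx) (not_lt.2 ?_)
    calc Mx f x ≤ T / 2 + T / 2 := h1.trans (add_le_add (not_lt.1 hc) (h2.trans_eq e1))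
      _ = T := ENNReal.add_halves T
  have h3 := Mx_weak (w := w) (hf.indicator hmE) (t := T / (16 * omC)) (ENNReal.div_ne_top hT hc0)
  have h4 : ∫⁻ x, f₁ x * Mx w x = ∫⁻ x in {x | T < 2 * omC * f x}, f x * Mx w x := by
    rw [← lintegral_indicator hmE]
    congr 1; ext x
    by_cases hx : x ∈ {x | T < 2 * omC * f x}
    · simp only [hf₁, Set.indicator_of_mem hx]
    · simp only [hf₁, Set.indicator_of_notMem hx, zero_mul]
  have h5 : ∫⁻ x in {x | T < 2 * omC * f x}, 2 * omC * f x * Mx w x =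
      2 * omC * ∫⁻ x in {x | T < 2 * omC * f x}, f x * Mx w x := by
    rw [← lintegral_const_mul' _ _ hdt]
    simp_rw [mul_assoc]
  rw [h5, ← h4]
  calc T * ∫⁻ x in {x | T < Mx f x}, w x
      ≤ T * ∫⁻ x in {x | 8 * omC * (T / (16 * omC)) < Mx f₁ x}, w x := by
        exact mul_le_mul_right (lintegral_mono_set hsub) _
    _ = (16 * omC) * (T / (16 * omC) *
          ∫⁻ x in {x | 8 * omC * (T / (16 * omC)) < Mx f₁ x}, w x) := by
        rw [← mul_assoc, ENNReal.mul_div_cancel hc0 hct]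
    _ ≤ (16 * omC) * (4 * ∫⁻ x, f₁ x * Mx w x) := mul_le_mul_right h3 _
    _ = _ := by ring

/-- The weighted maximal inequality of Fefferman and Stein. -/
lemma Mx_weighted {p : ℝ} (hp : 1 < p) {f w : UnitAddCircle → ℝ≥0∞} (hf : Measurable f)
    (hw : Measurable w) :
    ∫⁻ x, Mx f x ^ p * w x ≤ weightK p * ∫⁻ x, f x ^ p * Mx w x := by
  -- Interpolation between two different measures: density `Mx w` for the input and `w` for the
  -- output.
  have h := lintegral_rpow_le_of_weak hp (μ := volume.withDensity (Mx w))
    (ν := volume.withDensity w) (u := fun x => 2 * omC * f x) (v := Mx f)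
    (hf.const_mul _) (measurable_Mx f) (A := 32) (by norm_num) (by
      intro t _
      rw [withDensity_apply _ (measurableSet_lt measurable_const (measurable_Mx f)),
        lintegral_withDensity_lt (hf.const_mul _) (measurable_Mx w) _ _ (hf.const_mul _)]
      exact Mx_weak_large hf t)
  rw [lintegral_withDensity_eq_lintegral_mul _ hw ((measurable_Mx f).pow_const p),
    lintegral_withDensity_eq_lintegral_mul _ (measurable_Mx w) ((hf.const_mul _).pow_const p)] at h
  calc ∫⁻ x, Mx f x ^ p * w x = ∫⁻ x, (w * fun x => Mx f x ^ p) x := by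
        simp_rw [Pi.mul_apply, mul_comm]
    _ ≤ _ := h
    _ = 32 * ENNReal.ofReal (p / (p - 1)) * ∫⁻ x, (2 * omC) ^ p * (f x ^ p * Mx w x) := by
        congr 1
        refine lintegral_congr fun x => ?_
        rw [Pi.mul_apply, ENNReal.mul_rpow_of_nonneg _ _ (by linarith)]
        ring
    _ = _ := by
        rw [lintegral_const_mul _ (by exact (hf.pow_const p).mul (measurable_Mx w)), weightK]
        ring

/-- The constant in the maximal inequality. -/
def maxK (p : ℝ) : ℝ≥0∞ := weightK p * omC

lemma maxK_ne_top (p : ℝ) : maxK p ≠ ⊤ := ENNReal.mul_ne_top (weightK_ne_top p) omC_ne_top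

lemma lintegral_Mx_rpow_le {p : ℝ} (hp : 1 < p) {f : UnitAddCircle → ℝ≥0∞} (hf : Measurable f) :
    ∫⁻ x, Mx f x ^ p ≤ maxK p * ∫⁻ x, f x ^ p := by
  have h := Mx_weighted hp hf (measurable_const (a := (1 : ℝ≥0∞)))
  simp only [mul_one] at h
  refine h.trans ?_
  rw [maxK, mul_assoc]
  gcongr
  rw [mul_comm, ← lintegral_mul_const _ (hf.pow_const p)]
  apply lintegral_mono
  intro x
  dsimp only
  gcongr
  have := Mx_le_of_le (f := fun _ => 1) (c := 1) (by simp) x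
  rwa [mul_one] at this

lemma lintegral_Mx_sq_le {f : UnitAddCircle → ℝ≥0∞} (hf : Measurable f) :
    ∫⁻ x, Mx f x ^ 2 ≤ maxK 2 * ∫⁻ x, f x ^ 2 := by
  simpa using lintegral_Mx_rpow_le (p := 2) (by norm_num) hf

/-- A family of weighted inequalities implies an `L^q` inequality. -/
lemma lintegral_rpow_le_of_weighted {q : ℝ} (hq : 1 < q) {G b : UnitAddCircle → ℝ≥0∞}
    (hG : Measurable G) (hb : Measurable b) {C : ℝ≥0∞}
    (h : ∀ w : UnitAddCircle → ℝ≥0∞, Measurable w → ∫⁻ x, G x * w x ≤ C * ∫⁻ x, b x * Mx w x) :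
    ∫⁻ x, G x ^ q ≤ C ^ q * maxK (q / (q - 1)) ^ (q - 1) * ∫⁻ x, b x ^ q := by
  have hq0 : 0 < q := by linarith
  have hq1 : 0 < q - 1 := by linarith
  set r := q / (q - 1) with hr
  have hr1 : 1 < r := by rw [hr, lt_div_iff₀ hq1]; linarith
  have hqr : q.HolderConjugate r := Real.HolderConjugate.conjExponent hq
  have hri : 1 / r = (q - 1) / q := by rw [hr, one_div_div]
  set B := ∫⁻ x, b x ^ q
  -- Truncating `G` makes `X` finite, so that a power of it can be cancelled; monotone convergence
  -- removes the truncation.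
  have key : ∀ n : ℕ, ∫⁻ x, (min (G x) n) ^ q ≤ C ^ q * maxK r ^ (q - 1) * B := by
    intro n
    set X := ∫⁻ x, (min (G x) n) ^ q with hX
    have hmin : Measurable fun x => min (G x) (n : ℝ≥0∞) := hG.min measurable_const
    have hXtop : X ≠ ⊤ := by
      refine ne_top_of_le_ne_top ?_ (lintegral_mono (g := fun _ => (n : ℝ≥0∞) ^ q) fun x =>
        ENNReal.rpow_le_rpow (min_le_right _ _) hq0.le)
      simp [ENNReal.rpow_eq_top_iff, hq0.not_gt]
    by_cases hX0 : X = 0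
    · rw [hX0]; exact zero_le
    have hpow : ∀ a : ℝ≥0∞, (a ^ (q - 1)) ^ r = a ^ q := by
      intro a
      rw [← ENNReal.rpow_mul, hr]
      congr 1
      field_simp
    -- Duality: test the hypothesis with the weight `min(G, n)^(q-1)`, then use Hölder and the
    -- maximal inequality at the conjugate exponent `r`, where `(q - 1) r = q`.
    have h1 : X ≤ C * (B ^ (1 / q) * (maxK r * X) ^ (1 / r)) := by
      calc X ≤ ∫⁻ x, G x * (min (G x) n) ^ (q - 1) := by
            apply lintegral_mono
            intro x
            calc (min (G x) (n : ℝ≥0∞)) ^ q = min (G x) n ^ (1 + (q - 1)) := by congr 1; ring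
              _ = min (G x) n * (min (G x) n) ^ (q - 1) := by
                  rw [ENNReal.rpow_add_of_nonneg _ _ zero_le_one hq1.le, ENNReal.rpow_one]
              _ ≤ _ := mul_le_mul_left (min_le_left _ _) _
        _ ≤ C * ∫⁻ x, b x * Mx (fun x => (min (G x) n) ^ (q - 1)) x := h _ (hmin.pow_const _)
        _ ≤ _ := by
            gcongr
            refine (ENNReal.lintegral_mul_le_Lp_mul_Lq volume hqr hb.aemeasurable
              (measurable_Mx _).aemeasurable).trans ?_
            refine mul_le_mul_right (ENNReal.rpow_le_rpow ?_ (by positivity)) _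
            refine (lintegral_Mx_rpow_le hr1 (hmin.pow_const _)).trans_eq ?_
            simp_rw [hpow]
            rfl
    have h2 : X ^ (1 / r) ≠ 0 := by
      simp [ENNReal.rpow_eq_zero_iff, hX0, hXtop]
    have h3 : X ^ (1 / r) ≠ ⊤ := ENNReal.rpow_ne_top_of_nonneg (by positivity) hXtop
    have h4 : X ^ (1 / q) ≤ C * B ^ (1 / q) * maxK r ^ (1 / r) := by
      rw [← ENNReal.mul_le_mul_iff_left h2 h3, ← ENNReal.rpow_add _ _ hX0 hXtop,
        show 1 / q + 1 / r = 1 by rw [hri]; field_simp; ring, ENNReal.rpow_one]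
      refine h1.trans_eq ?_
      rw [ENNReal.mul_rpow_of_nonneg _ _ (by positivity)]
      ring
    calc X = (X ^ (1 / q)) ^ q := by
          rw [← ENNReal.rpow_mul, one_div_mul_cancel hq0.ne', ENNReal.rpow_one]
      _ ≤ (C * B ^ (1 / q) * maxK r ^ (1 / r)) ^ q := ENNReal.rpow_le_rpow h4 hq0.le
      _ = _ := by
          rw [ENNReal.mul_rpow_of_nonneg _ _ hq0.le, ENNReal.mul_rpow_of_nonneg _ _ hq0.le,
            ← ENNReal.rpow_mul, ← ENNReal.rpow_mul, one_div_mul_cancel hq0.ne', ENNReal.rpow_one,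
            hri, div_mul_cancel₀ _ hq0.ne']
          ring
  have hsup : ∀ x, G x ^ q = ⨆ n : ℕ, (min (G x) n) ^ q := by
    intro x
    have h1 : G x = ⨆ n : ℕ, min (G x) n := by
      rw [← inf_iSup_eq, ENNReal.iSup_natCast, inf_top_eq]
    have hmono : Monotone fun a : ℝ≥0∞ => a ^ q := ENNReal.monotone_rpow_of_nonneg hq0.le
    conv_lhs => rw [h1]
    exact hmono.map_iSup_of_continuousAt ENNReal.continuous_rpow_const.continuousAt (by simp [hq0])
  simp_rw [hsup]
  rw [lintegral_iSup (fun n => (hG.min measurable_const).pow_const q)]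
  · exact iSup_le key
  · intro m n hmn x
    exact ENNReal.rpow_le_rpow (min_le_min_left _ (by exact_mod_cast hmn)) hq0.le

/-! ### General criteria -/

/-- The constant for the strong type inequalities. -/
def strongK (A B D : ℝ≥0∞) (K : ℝ → ℝ≥0∞) (p : ℝ) : ℝ≥0∞ :=
  if p < 2 then A * (ENNReal.ofReal (p / (p - 1)) + ENNReal.ofReal (p / (2 - p))) else
    if p = 2 then B else D ^ (p / 2) * maxK (p / 2 / (p / 2 - 1)) ^ (p / 2 - 1) * K (p / 2)

lemma strongK_ne_top {A B D : ℝ≥0∞} {K : ℝ → ℝ≥0∞} (hA : A ≠ ⊤) (hB : B ≠ ⊤) (hD : D ≠ ⊤)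
    (hK : ∀ q, K q ≠ ⊤) (p : ℝ) : strongK A B D K p ≠ ⊤ := by
  unfold strongK
  split_ifs with h1 h2
  · exact ENNReal.mul_ne_top hA (by simp)
  · exact hB
  · have h3 : 2 < p := lt_of_le_of_ne (not_lt.1 h1) (Ne.symm h2)
    exact ENNReal.mul_ne_top (ENNReal.mul_ne_top
      (ENNReal.rpow_ne_top_of_nonneg (by linarith) hD)
      (ENNReal.rpow_ne_top_of_nonneg (by linarith) (maxK_ne_top _))) (hK _)

/-- Exponents below 2 come by interpolation and 2 by hypothesis. Above 2, duality is applied to `v²`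
at the exponent `p / 2`. The majorant `b` is `u²` for maximal functions and `Mx (u²)` for square
functions. -/
lemma Controlled.of_weighted {A B D : ℝ≥0∞} {K : ℝ → ℝ≥0∞} (hA : A ≠ ⊤)
    {u v b : UnitAddCircle → ℝ≥0∞} (hu : Measurable u) (hv : Measurable v) (hb : Measurable b)
    (h1 : WeakDist volume A u v) (h2 : ∫⁻ x, v x ^ 2 ≤ B * ∫⁻ x, u x ^ 2)
    (h3 : ∀ w : UnitAddCircle → ℝ≥0∞, Measurable w →
      ∫⁻ x, v x ^ 2 * w x ≤ D * ∫⁻ x, b x * Mx w x)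
    (h4 : ∀ q : ℝ, 1 < q → ∫⁻ x, b x ^ q ≤ K q * ∫⁻ x, (u x ^ 2) ^ q) :
    Controlled volume A (strongK A B D K) u v := by
  refine ⟨h1, fun p hp => ?_⟩
  unfold strongK
  split_ifs with hp2 hp2'
  · exact lintegral_rpow_le_of_weakDist hp hp2 hu hv hA h1
  · subst hp2'
    simpa using h2
  · have h5 : 2 < p := lt_of_le_of_ne (not_lt.1 hp2) (Ne.symm hp2')
    have hq : 1 < p / 2 := by linarith
    have e : ∀ a : ℝ≥0∞, a ^ p = (a ^ 2) ^ (p / 2) := by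
      intro a
      rw [← ENNReal.rpow_natCast, ← ENNReal.rpow_mul]
      congr 1
      push_cast; ring
    simp_rw [e]
    refine (lintegral_rpow_le_of_weighted hq (hv.pow_const 2) hb h3).trans ?_
    rw [mul_assoc _ (K _)]
    gcongr
    exact h4 _ hq

/-- `v₁` and `v₂` are the images of the parts of the input above and below `t`. If both are at most
`t / 2`, then `v ≤ t`. The halved height gives `2 A`, and Chebyshev for the square of `v₂` gives `4
B`. Sublinearity in squared form suits square functions directly. -/
lemma WeakDist.of_split {X : Type*} [MeasurableSpace X] {μ : Measure X} {A B : ℝ≥0∞}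
    {u v : X → ℝ≥0∞}
    (h : ∀ t : ℝ, 0 < t → ∃ v₁ v₂ : X → ℝ≥0∞, Measurable v₂ ∧
      (∀ x, v x ^ 2 ≤ 2 * v₁ x ^ 2 + 2 * v₂ x ^ 2) ∧
      (∀ s : ℝ, 0 < s → ENNReal.ofReal s * μ {x | ENNReal.ofReal s < v₁ x} ≤
        A * ∫⁻ x in {x | ENNReal.ofReal t < u x}, u x ∂μ) ∧
      ∫⁻ x, v₂ x ^ 2 ∂μ ≤ B * ∫⁻ x in {x | u x ≤ ENNReal.ofReal t}, u x ^ 2 ∂μ) :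
    WeakDist μ (2 * A + 4 * B) u v := by
  intro t ht
  obtain ⟨v₁, v₂, hv₂, hv, h1, h2⟩ := h t ht
  have hT0 : ENNReal.ofReal t ≠ 0 := by simpa using ht
  have hTt : ENNReal.ofReal t ≠ ⊤ := ENNReal.ofReal_ne_top
  have hhalf : ENNReal.ofReal (t / 2) = ENNReal.ofReal t / 2 := by
    rw [ENNReal.ofReal_div_of_pos two_pos]; simp
  have h1' := h1 (t / 2) (by positivity)
  rw [hhalf] at h1'
  set T := ENNReal.ofReal t
  set U₁ := ∫⁻ x in {x | T < u x}, u x ∂μ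
  set U₂ := ∫⁻ x in {x | u x ≤ T}, u x ^ 2 ∂μ
  have e2 : 2 * (T / 2) = T := ENNReal.mul_div_cancel (by norm_num) (by norm_num)
  have hsub : {x | T < v x} ⊆ {x | T / 2 < v₁ x} ∪ {x | (T / 2) ^ 2 ≤ v₂ x ^ 2} := by
    intro x hx
    by_contra hc
    rw [Set.mem_union, not_or] at hc
    have hc1 : v₁ x ≤ T / 2 := not_lt.1 hc.1
    have hc2 : v₂ x ^ 2 ≤ (T / 2) ^ 2 := le_of_not_ge hc.2
    have : v x ^ 2 ≤ T ^ 2 := by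
      calc v x ^ 2 ≤ 2 * (T / 2) ^ 2 + 2 * (T / 2) ^ 2 := (hv x).trans (by gcongr)
        _ = (2 * (T / 2)) ^ 2 := by ring
        _ = T ^ 2 := by rw [e2]
    exact absurd (show T < v x from hx) (not_lt.2 ((ENNReal.pow_le_pow_left_iff two_ne_zero).1 this))
  have h3 : (T / 2) ^ 2 * μ {x | (T / 2) ^ 2 ≤ v₂ x ^ 2} ≤ B * U₂ :=
    (mul_meas_ge_le_lintegral (hv₂.pow_const 2) _).trans h2
  calc T * μ {x | T < v x} ≤ T * (μ {x | T / 2 < v₁ x} + μ {x | (T / 2) ^ 2 ≤ v₂ x ^ 2}) := by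
        gcongr
        exact (measure_mono hsub).trans (measure_union_le _ _)
    _ = 2 * (T / 2) * μ {x | T / 2 < v₁ x} +
        T⁻¹ * (2 * (T / 2)) * (2 * (T / 2)) * μ {x | (T / 2) ^ 2 ≤ v₂ x ^ 2} := by
        rw [e2, ENNReal.inv_mul_cancel hT0 hTt, one_mul, mul_add]
    _ = 2 * (T / 2 * μ {x | T / 2 < v₁ x}) +
        4 * T⁻¹ * ((T / 2) ^ 2 * μ {x | (T / 2) ^ 2 ≤ v₂ x ^ 2}) := by ring
    _ ≤ 2 * (A * U₁) + 4 * T⁻¹ * (B * U₂) := by gcongr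
    _ = (2 * A) * U₁ + (4 * B) * (T⁻¹ * U₂) := by ring
    _ ≤ (2 * A + 4 * B) * U₁ + (2 * A + 4 * B) * (T⁻¹ * U₂) := by
        gcongr
        · exact le_self_add
        · exact le_add_self
    _ = _ := by ring


/-! ### The vector-valued maximal inequality -/

section L2

variable {ι : Type*}

/-- The `ℓ²` norm of a family of extended nonnegative reals. -/
def l2 (a : ι → ℝ≥0∞) : ℝ≥0∞ := (∑' i, a i ^ 2) ^ (1 / 2 : ℝ)

lemma rpow_half_sq (a : ℝ≥0∞) : (a ^ (1 / 2 : ℝ)) ^ 2 = a := by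
  rw [← ENNReal.rpow_natCast, ← ENNReal.rpow_mul]
  norm_num

lemma l2_sq (a : ι → ℝ≥0∞) : l2 a ^ 2 = ∑' i, a i ^ 2 := rpow_half_sq _

lemma l2_le_iff {a : ι → ℝ≥0∞} {c : ℝ≥0∞} : l2 a ≤ c ↔ ∑' i, a i ^ 2 ≤ c ^ 2 := by
  rw [← l2_sq, ENNReal.pow_le_pow_left_iff two_ne_zero]

lemma l2_mono {a b : ι → ℝ≥0∞} (h : ∀ i, a i ≤ b i) : l2 a ≤ l2 b := by
  unfold l2
  gcongr with i
  exact h i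

lemma le_l2 (a : ι → ℝ≥0∞) (i : ι) : a i ≤ l2 a := by
  rw [← ENNReal.pow_le_pow_left_iff two_ne_zero, l2_sq]
  exact ENNReal.le_tsum i

lemma l2_const_mul (c : ℝ≥0∞) (a : ι → ℝ≥0∞) : l2 (fun i => c * a i) = c * l2 a := by
  apply le_antisymm
  · rw [l2_le_iff, mul_pow, l2_sq, ← ENNReal.tsum_mul_left]
    simp_rw [mul_pow]; rfl
  · rw [← ENNReal.pow_le_pow_left_iff two_ne_zero, mul_pow, l2_sq, l2_sq, ← ENNReal.tsum_mul_left]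
    simp_rw [mul_pow]; rfl

lemma sum_mul_le_l2 (s : Finset ι) (a b : ι → ℝ≥0∞) :
    ∑ i ∈ s, a i * b i ≤ (∑ i ∈ s, a i ^ 2) ^ (1 / 2 : ℝ) * l2 b := by
  have h := ENNReal.inner_le_Lp_mul_Lq s a b (p := 2) (q := 2) Real.HolderConjugate.two_two
  simp only [ENNReal.rpow_ofNat] at h
  refine h.trans ?_
  unfold l2
  gcongr
  exact ENNReal.sum_le_tsum s

variable {X : Type*} [MeasurableSpace X] {μ : Measure X}

lemma measurable_l2 [Countable ι] {F : ι → X → ℝ≥0∞} (hF : ∀ i, Measurable (F i)) :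
    Measurable fun x => l2 fun i => F i x :=
  (Measurable.tsum fun i => (hF i).pow_const 2).pow_const _

/-- Minkowski's integral inequality for `ℓ²`. -/
lemma l2_lintegral_le {F : ι → X → ℝ≥0∞} (hF : ∀ i, Measurable (F i)) :
    l2 (fun i => ∫⁻ x, F i x ∂μ) ≤ ∫⁻ x, l2 (fun i => F i x) ∂μ := by
  rw [l2_le_iff, ENNReal.tsum_eq_iSup_sum]
  refine iSup_le fun s => ?_
  set R := ∫⁻ x, l2 (fun i => F i x) ∂μ with hR
  by_cases hRt : R = ⊤
  · rw [hRt]; simp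
  set a : ι → ℝ≥0∞ := fun i => ∫⁻ x, F i x ∂μ
  have ha : ∀ i, a i ≠ ⊤ := fun i =>
    ne_top_of_le_ne_top hRt (lintegral_mono fun x => le_l2 (fun i => F i x) i)
  set Y := ∑ i ∈ s, a i ^ 2 with hY
  have hYt : Y ≠ ⊤ := ENNReal.sum_ne_top.2 fun i _ => ENNReal.pow_ne_top (ha i)
  by_cases hY0 : Y = 0
  · rw [hY0]; exact zero_le
  -- Test the vector of integrals against itself; finiteness of the partial sum then permits
  -- division by `Y ^ (1/2)`.
  have h1 : Y ≤ Y ^ (1 / 2 : ℝ) * R := by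
    calc Y = ∑ i ∈ s, ∫⁻ x, a i * F i x ∂μ := by
          refine Finset.sum_congr rfl fun i _ => ?_
          rw [lintegral_const_mul _ (hF i), sq]
      _ = ∫⁻ x, ∑ i ∈ s, a i * F i x ∂μ :=
          (lintegral_finsetSum _ fun i _ => (hF i).const_mul _).symm
      _ ≤ ∫⁻ x, Y ^ (1 / 2 : ℝ) * l2 (fun i => F i x) ∂μ :=
          lintegral_mono fun x => sum_mul_le_l2 s a _
      _ = _ := lintegral_const_mul' _ _ (ENNReal.rpow_ne_top_of_nonneg (by norm_num) hYt)
  have h2 : Y ^ (1 / 2 : ℝ) ≠ 0 := by simp [hY0]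
  have h3 : Y ^ (1 / 2 : ℝ) ≠ ⊤ := ENNReal.rpow_ne_top_of_nonneg (by norm_num) hYt
  have h4 : Y ^ (1 / 2 : ℝ) ≤ R := by
    rw [← ENNReal.mul_le_mul_iff_right h2 h3, ← sq, rpow_half_sq]
    exact h1
  calc Y = (Y ^ (1 / 2 : ℝ)) ^ 2 := (rpow_half_sq Y).symm
    _ ≤ R ^ 2 := by gcongr

end L2

instance : IsProbabilityMeasure (volume : Measure UnitAddCircle) := ⟨UnitAddCircle.measure_univ⟩

lemma lintegral_condAvg {S : Set DyadicInterval} (hS : DisjointCells S)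
    (f : UnitAddCircle → ℝ≥0∞) : ∫⁻ x, condAvg S f x = ∫⁻ x, f x := by
  rw [← lintegral_add_compl _ (measurableSet_cover S), ← lintegral_add_compl f (measurableSet_cover S)]
  congr 1
  · rw [hS.lintegral_cover, hS.lintegral_cover]
    congr 1; ext Q
    rw [← elen_mul_avg f Q, setLIntegral_congr_fun (measurableSet_cell _) (g := fun _ => avg f Q)
      (fun x hx => condAvg_of_mem hS f Q.2 hx), setLIntegral_const, volume_cell, mul_comm]
  · apply setLIntegral_congr_fun (measurableSet_cover S).compl
    intro x hx
    exact condAvg_of_notMem f hx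

variable {ι : Type*}

/-- By Minkowski, one stopping family chosen for the scalar `ℓ²` norm controls the averages of all
components together. -/
lemma l2_condAvg_le {S : Set DyadicInterval} (hS : DisjointCells S)
    {N : ι → UnitAddCircle → ℝ≥0∞} (hN : ∀ i, Measurable (N i)) (x : UnitAddCircle) :
    l2 (fun i => condAvg S (N i) x) ≤ condAvg S (fun y => l2 fun i => N i y) x := by
  by_cases hx : x ∈ cover S
  · obtain ⟨Q, hQ, hxQ⟩ := mem_cover.1 hx
    simp_rw [condAvg_of_mem hS _ hQ hxQ]
    unfold avg
    rw [l2_const_mul]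
    gcongr
    exact l2_lintegral_le hN
  · simp_rw [condAvg_of_notMem _ hx]; rfl

variable [Countable ι]

lemma lintegral_l2_Mx_sq_le {N : ι → UnitAddCircle → ℝ≥0∞} (hN : ∀ i, Measurable (N i)) :
    ∫⁻ x, l2 (fun i => Mx (N i) x) ^ 2 ≤ maxK 2 * ∫⁻ x, l2 (fun i => N i x) ^ 2 := by
  simp_rw [l2_sq]
  rw [lintegral_tsum fun i => ((measurable_Mx _).pow_const 2).aemeasurable,
    lintegral_tsum fun i => ((hN i).pow_const 2).aemeasurable, ← ENNReal.tsum_mul_left]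
  exact ENNReal.tsum_le_tsum fun i => lintegral_Mx_sq_le (hN i)

/-- The exceptional set of a stopping family is small. -/
lemma mul_volume_iUnion_star_le (u : UnitAddCircle → ℝ≥0∞) (t : ℝ≥0∞) :
    t * volume (⋃ Q : stopping (avg u) t, star Q) ≤ 4 * omC * ∫⁻ x, u x := by
  calc t * volume (⋃ Q : stopping (avg u) t, star Q)
      ≤ t * ∑' Q : stopping (avg u) t, 4 * omC * elen Q := by
        gcongr
        exact (measure_iUnion_le _).trans (ENNReal.tsum_le_tsum fun Q => volume_star_le _)
    _ = 4 * omC * (t * ∑' Q : stopping (avg u) t, elen Q) := by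
        rw [ENNReal.tsum_mul_left]; ring
    _ ≤ _ := by gcongr; exact tsum_elen_stopping_le u t

/-- Stop on the `ℓ²` norm `u`. Off the enlargements every component is replaced by its averages. The
averaged family has norm at most `2 T` and `L¹` norm at most that of `u`, so its squared `L²` norm
is at most `2 T ∫ u`, and Chebyshev applies to the `L²` maximal bound. -/
lemma l2_Mx_weak {N : ι → UnitAddCircle → ℝ≥0∞} (hN : ∀ i, Measurable (N i)) {t : ℝ}
    (ht : 0 < t) :
    ENNReal.ofReal t * volume {x | ENNReal.ofReal t < l2 fun i => Mx (N i) x} ≤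
      (1 + 4 * omC + 32 * maxK 2) * ∫⁻ x, l2 fun i => N i x := by
  set u : UnitAddCircle → ℝ≥0∞ := fun x => l2 fun i => N i x with hu
  set v : UnitAddCircle → ℝ≥0∞ := fun x => l2 fun i => Mx (N i) x with hv
  have hmu : Measurable u := measurable_l2 hN
  have hT0 : ENNReal.ofReal t ≠ 0 := by simpa using ht
  have hTt : ENNReal.ofReal t ≠ ⊤ := ENNReal.ofReal_ne_top
  set T := ENNReal.ofReal t
  by_cases hfi : ∫⁻ x, u x ≤ T
  · set S := stopping (avg u) T with hSdef
    have hS : DisjointCells S := disjointCells_stopping _ _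
    set V : UnitAddCircle → ℝ≥0∞ := fun x => l2 fun i => Mx (condAvg S (N i)) x with hV
    have hmV : Measurable V := measurable_l2 fun i => measurable_Mx _
    have hsub : {x | T < v x} ⊆ (⋃ Q : S, star Q) ∪ {x | T ^ 2 ≤ 16 * V x ^ 2} := by
      intro x hx
      by_cases hc : x ∈ ⋃ Q : S, star Q
      · exact Or.inl hc
      · refine Or.inr ?_
        simp only [Set.mem_iUnion, not_exists] at hc
        have h1 : v x ≤ 4 * V x := by
          rw [hv, hV]
          dsimp only
          rw [← l2_const_mul]
          exact l2_mono fun i => Mx_le_condAvg hS fun Q hQ => hc ⟨Q, hQ⟩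
        calc T ^ 2 ≤ (4 * V x) ^ 2 := by
              gcongr
              exact (le_of_lt hx).trans h1
          _ = _ := by ring
    have h2 : ∫⁻ x, V x ^ 2 ≤ maxK 2 * (2 * T * ∫⁻ x, u x) := by
      refine (lintegral_l2_Mx_sq_le fun i => measurable_condAvg S (hN i)).trans ?_
      gcongr
      calc ∫⁻ x, l2 (fun i => condAvg S (N i) x) ^ 2 ≤ ∫⁻ x, 2 * T * condAvg S u x := by
            apply lintegral_mono_ae
            filter_upwards [condAvg_le hmu hTt hfi] with x hx
            have h3 := l2_condAvg_le hS hN x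
            rw [sq]
            exact mul_le_mul' (h3.trans hx) h3
        _ = 2 * T * ∫⁻ x, u x := by
            rw [lintegral_const_mul _ (measurable_condAvg S hmu), lintegral_condAvg hS]
    have h4 : T ^ 2 * volume {x | T ^ 2 ≤ 16 * V x ^ 2} ≤ 16 * (maxK 2 * (2 * T * ∫⁻ x, u x)) := by
      refine (mul_meas_ge_le_lintegral ((hmV.pow_const 2).const_mul 16) _).trans ?_
      rw [lintegral_const_mul _ (hmV.pow_const 2)]
      gcongr
    calc T * volume {x | T < v x}
        ≤ T * (volume (⋃ Q : S, star Q) + volume {x | T ^ 2 ≤ 16 * V x ^ 2}) := by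
          gcongr
          exact (measure_mono hsub).trans (measure_union_le _ _)
      _ = T * volume (⋃ Q : S, star Q) +
          T⁻¹ * T * T * volume {x | T ^ 2 ≤ 16 * V x ^ 2} := by
          rw [ENNReal.inv_mul_cancel hT0 hTt, one_mul, mul_add]
      _ = T * volume (⋃ Q : S, star Q) +
          T⁻¹ * (T ^ 2 * volume {x | T ^ 2 ≤ 16 * V x ^ 2}) := by ring
      _ ≤ 4 * omC * (∫⁻ x, u x) + T⁻¹ * (16 * (maxK 2 * (2 * T * ∫⁻ x, u x))) :=
          add_le_add (mul_volume_iUnion_star_le u T) (mul_le_mul_right h4 _)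
      _ = 4 * omC * (∫⁻ x, u x) + (T⁻¹ * T) * (32 * maxK 2 * ∫⁻ x, u x) := by ring
      _ = (4 * omC + 32 * maxK 2) * ∫⁻ x, u x := by
          rw [ENNReal.inv_mul_cancel hT0 hTt]; ring
      _ ≤ _ := by
          refine mul_le_mul_left ?_ _
          rw [add_assoc]
          exact le_add_self
  · calc T * volume {x | T < v x} ≤ (∫⁻ x, u x) * 1 := by
          gcongr
          · exact (not_le.1 hfi).le
          · exact prob_le_one
      _ ≤ _ := by
          rw [mul_comm]
          refine mul_le_mul_left ?_ _
          rw [add_assoc]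
          exact le_self_add

/-- The distributional constant for the vector-valued maximal function. -/
def maxA : ℝ≥0∞ := 2 * (1 + 4 * omC + 32 * maxK 2) + 4 * maxK 2

lemma maxA_ne_top : maxA ≠ ⊤ := by
  unfold maxA
  have h1 := omC_ne_top
  have h2 := maxK_ne_top 2
  finiteness

/-- The strong constants for the vector-valued maximal function. -/
def maxS : ℝ → ℝ≥0∞ := strongK maxA (maxK 2) (weightK 2) (fun _ => 1)

lemma maxS_ne_top (p : ℝ) : maxS p ≠ ⊤ :=
  strongK_ne_top maxA_ne_top (maxK_ne_top 2) (weightK_ne_top 2) (fun _ => by simp) p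

lemma two_mul_sq_add_le (a b : ℝ≥0∞) : (a + b) ^ 2 ≤ 2 * a ^ 2 + 2 * b ^ 2 := by
  have h := ENNReal.rpow_add_le_mul_rpow_add_rpow a b (p := 2) (by norm_num)
  rw [show (2 : ℝ) - 1 = 1 by norm_num, ENNReal.rpow_one] at h
  simp only [ENNReal.rpow_ofNat] at h
  rwa [mul_add] at h

/-- The Fefferman–Stein vector-valued maximal inequalities. -/
lemma controlled_l2_Mx {N : ι → UnitAddCircle → ℝ≥0∞} (hN : ∀ i, Measurable (N i)) :
    Controlled volume maxA maxS (fun x => l2 fun i => N i x) (fun x => l2 fun i => Mx (N i) x) := by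
  have hmu : Measurable fun x => l2 fun i => N i x := measurable_l2 hN
  refine Controlled.of_weighted maxA_ne_top hmu (measurable_l2 fun i => measurable_Mx _)
    (hmu.pow_const 2) (WeakDist.of_split fun t ht => ?_) (lintegral_l2_Mx_sq_le hN) ?_ ?_
  · have hmE : MeasurableSet {x | ENNReal.ofReal t < l2 fun i => N i x} :=
      measurableSet_lt measurable_const hmu
    set E := {x | ENNReal.ofReal t < l2 fun i => N i x} with hE
    have hEc : Eᶜ = {x | (l2 fun i => N i x) ≤ ENNReal.ofReal t} := by ext; simp [hE]
    have hind : ∀ (F : Set UnitAddCircle) x, (l2 fun i => F.indicator (N i) x) =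
        F.indicator (fun y => l2 fun i => N i y) x := by
      intro F x
      by_cases hx : x ∈ F
      · simp [hx]
      · simp [hx, l2]
    refine ⟨fun x => l2 fun i => Mx (E.indicator (N i)) x,
      fun x => l2 fun i => Mx (Eᶜ.indicator (N i)) x, measurable_l2 fun i => measurable_Mx _,
      fun x => ?_, fun s hs => ?_, ?_⟩
    · rw [l2_sq, l2_sq, l2_sq, ← ENNReal.tsum_mul_left, ← ENNReal.tsum_mul_left,
        ← ENNReal.summable.tsum_add ENNReal.summable]
      refine ENNReal.tsum_le_tsum fun i => le_trans ?_ (two_mul_sq_add_le _ _)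
      gcongr
      refine le_trans (le_of_eq ?_) (Mx_add_le ((hN i).indicator hmE) x)
      congr 1; ext y
      exact (Set.indicator_self_add_compl_apply _ (N i) y).symm
    · refine (l2_Mx_weak (fun i => (hN i).indicator hmE) hs).trans_eq ?_
      simp_rw [hind]
      rw [lintegral_indicator hmE]
    · refine (lintegral_l2_Mx_sq_le fun i => (hN i).indicator hmE.compl).trans_eq ?_
      simp_rw [hind]
      rw [← hEc, ← lintegral_indicator hmE.compl]
      congr 2; ext x
      by_cases hx : x ∈ Eᶜ
      · simp only [Set.indicator_of_mem hx]
      · simp only [Set.indicator_of_notMem hx]; simp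
  -- The weighted inequality at exponent 2 adds up over the components, so the majorant is the
  -- squared `ℓ²` norm itself.
  · intro w hw
    simp_rw [l2_sq, ← ENNReal.tsum_mul_right]
    rw [lintegral_tsum (f := fun i x => Mx (N i) x ^ 2 * w x)
        fun i => (((measurable_Mx _).pow_const 2).mul hw).aemeasurable,
      lintegral_tsum (f := fun i x => N i x ^ 2 * Mx w x)
        fun i => (((hN i).pow_const 2).mul (measurable_Mx w)).aemeasurable,
      ← ENNReal.tsum_mul_left]
    refine ENNReal.tsum_le_tsum fun i => ?_
    have := Mx_weighted (p := 2) (by norm_num) (hN i) hw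
    simpa using this
  · intro q _
    rw [one_mul]

/-- The maximal function is controlled. -/
lemma controlled_Mx {f : UnitAddCircle → ℝ≥0∞} (hf : Measurable f) :
    Controlled volume maxA maxS f (Mx f) := by
  have h := controlled_l2_Mx (ι := Unit) (N := fun _ => f) fun _ => hf
  have e : ∀ a : ℝ≥0∞, (l2 fun _ : Unit => a) = a := by
    intro a
    rw [l2, tsum_fintype, Finset.sum_const, Finset.card_univ, Fintype.card_unit, one_smul,
      ← ENNReal.rpow_natCast, ← ENNReal.rpow_mul]
    norm_num
  simp_rw [e] at h
  exact h


/-! ### Square functions -/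

/-- The size and smoothness conditions on a family that are used below. -/
structure Good (C : ℝ≥0) (φ : DyadicInterval → UnitAddCircle → ℂ) : Prop where
  cont : ∀ I, Continuous (φ I)
  size : ∀ I x, ‖φ I x‖ ≤ C / dec I x ^ 5
  lip : ∀ I x y, ‖φ I x - φ I y‖ ≤
    C * (dist x y / len I) * (1 + dist x y / len I) ^ 2 / dec I x ^ 2

lemma continuous_of_isAdapted {C : ℕ → ℝ} {I : DyadicInterval} {φ : UnitAddCircle → ℂ}
    (h : IsAdapted C I φ) : Continuous φ :=
  (QuotientAddGroup.isQuotientMap_mk (AddSubgroup.zmultiples (1 : ℝ))).continuous_iff.2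
    h.smooth.continuous

/-- Subtracting the nearest integer realizes the circle distance on the line, where derivative
bounds can be integrated. -/
lemma exists_lift (x y : UnitAddCircle) :
    ∃ a b : ℝ, (a : UnitAddCircle) = x ∧ (b : UnitAddCircle) = y ∧ |a - b| = dist x y := by
  obtain ⟨s, hs⟩ : ∃ s : ℝ, (s : UnitAddCircle) = x - y ∧ |s| = ‖x - y‖ := by
    set r := pos (x - y) with hr
    refine ⟨r - round r, ?_, ?_⟩
    · rw [AddCircle.coe_sub, hr, coe_pos]
      have : ((round (pos (x - y)) : ℝ) : UnitAddCircle) = 0 := by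
        rw [AddCircle.coe_eq_zero_iff]
        exact ⟨round (pos (x - y)), by simp⟩
      rw [this, sub_zero]
    · rw [← UnitAddCircle.norm_eq, hr, coe_pos]
  refine ⟨pos y + s, pos y, ?_, coe_pos y, ?_⟩
  · rw [AddCircle.coe_add, coe_pos, hs.1]; abel
  · rw [add_sub_cancel_left, hs.2, dist_eq_norm]

/-- The mean value inequality along a shortest arc. On that arc `dec I` drops from its value at `x`
by at most the factor `1 + dist x y / len I`, whence the polynomial factor. -/
lemma lip_of_isAdapted {C : ℕ → ℝ} {I : DyadicInterval} {φ : UnitAddCircle → ℂ}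
    (h : IsAdapted C I φ) (x y : UnitAddCircle) : ‖φ x - φ y‖ ≤
      C 2 * (dist x y / len I) * (1 + dist x y / len I) ^ 2 / dec I x ^ 2 := by
  obtain ⟨a, b, rfl, rfl, hab⟩ := exists_lift x y
  have hl := len_pos I
  have hC := h.const_pos 2
  set d := dist (a : UnitAddCircle) (b : UnitAddCircle) with hd
  have hd0 : 0 ≤ d := dist_nonneg
  have hW := dec_pos I (a : UnitAddCircle)
  have key := Convex.norm_image_sub_le_of_norm_deriv_le (𝕜 := ℝ)
    (f := fun t : ℝ => φ (t : UnitAddCircle)) (s := Set.uIcc a b) (x := b) (y := a)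
    (C := C 2 * (1 / len I) * ((1 + d / len I) ^ 2 / dec I (a : UnitAddCircle) ^ 2))
    (fun z _ => (h.smooth.differentiable (by simp)).differentiableAt) (by
      intro z hz
      refine (h.deriv_bound 2 z).trans ?_
      rw [div_eq_mul_inv]
      apply mul_le_mul_of_nonneg_left _ (by positivity)
      change (dec I (z : UnitAddCircle) ^ 2)⁻¹ ≤ _
      have hz1 : dist (a : UnitAddCircle) (z : UnitAddCircle) ≤ d := by
        refine (dist_coe_le a z).trans ?_
        rw [← hab, abs_sub_comm a z]
        have := Set.abs_sub_left_of_mem_uIcc hz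
        rwa [abs_sub_comm b a] at this
      have h1 := dec_le_add I (a : UnitAddCircle) (z : UnitAddCircle)
      have h2 := (div_le_div_iff_of_pos_right hl).2 hz1
      have h3 := one_le_dec I (z : UnitAddCircle)
      have hd' : 0 ≤ d / len I := by positivity
      have h4 : dec I (a : UnitAddCircle) ≤ (1 + d / len I) * dec I (z : UnitAddCircle) := by
        nlinarith
      rw [inv_eq_one_div, div_le_div_iff₀ (by positivity) (by positivity), one_mul, ← mul_pow]
      exact pow_le_pow_left₀ hW.le h4 2)
    (convex_uIcc a b) Set.right_mem_uIcc Set.left_mem_uIcc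
  refine key.trans_eq ?_
  rw [Real.norm_eq_abs, hab]
  ring

/-- Adapted families have the size and smoothness used below. -/
lemma IsAdaptedFamily.good {C : ℕ → ℝ} {φ : DyadicInterval → UnitAddCircle → ℂ}
    (h : IsAdaptedFamily C φ) : Good (max (C 5) (C 2)).toNNReal φ := by
  refine ⟨fun I => continuous_of_isAdapted (h I), fun I x => ?_, fun I x y => ?_⟩
  · refine ((h I).bound 5 x).trans ?_
    have := dec_pos I x
    change C 5 / dec I x ^ 5 ≤ _
    gcongr
    exact (le_max_left _ _).trans (Real.le_coe_toNNReal _)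
  · refine (lip_of_isAdapted (h I) x y).trans ?_
    have := dec_pos I x
    have := len_pos I
    gcongr
    exact (le_max_right _ _).trans (Real.le_coe_toNNReal _)

/-! ### Decay, oscillation and almost orthogonality of adapted functions -/

section Good

variable {C : ℝ≥0} {φ : DyadicInterval → UnitAddCircle → ℂ}

lemma enorm_le_of_norm_le {F : Type*} [SeminormedAddGroup F] {a : F} {c : ℝ} (h : ‖a‖ ≤ c) :
    ‖a‖ₑ ≤ ENNReal.ofReal c := by
  rw [← ofReal_norm]
  exact ENNReal.ofReal_le_ofReal h

lemma ofReal_mul_om {I : DyadicInterval} {x : UnitAddCircle} {c : ℝ} (hc : 0 ≤ c) :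
    ENNReal.ofReal (c / dec I x ^ 2) = ENNReal.ofReal c * om I x := by
  rw [om, ← ENNReal.ofReal_mul hc, mul_one_div]

lemma Good.enorm_le (h : Good C φ) (I : DyadicInterval) (x : UnitAddCircle) :
    ‖φ I x‖ₑ ≤ C * om I x := by
  have h1 := one_le_dec I x
  have h2 : (C : ℝ) / dec I x ^ 5 ≤ C / dec I x ^ 2 :=
    div_le_div_of_nonneg_left C.coe_nonneg (by positivity) (pow_le_pow_right₀ h1 (by norm_num))
  refine (enorm_le_of_norm_le ((h.size I x).trans h2)).trans_eq ?_
  rw [ofReal_mul_om C.coe_nonneg, ENNReal.ofReal_coe_nnreal]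

lemma Good.norm_le (h : Good C φ) (I : DyadicInterval) (x : UnitAddCircle) : ‖φ I x‖ ≤ C := by
  refine (h.size I x).trans ?_
  have := one_le_dec I x
  rw [div_le_iff₀ (by positivity)]
  have h1 : (1 : ℝ) ≤ dec I x ^ 5 := one_le_pow₀ this
  nlinarith [C.coe_nonneg]

/-- A bound for `φ_J` far from the interval `Q`. -/
lemma Good.enorm_le_rho (h : Good C φ) {Q J : DyadicInterval} (hQJ : len J ≤ len Q)
    {x : UnitAddCircle} (hx : len Q / len J ≤ dec J x) :
    ‖φ J x‖ₑ ≤ C * rho Q J * om J x := by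
  have hJ := len_pos J
  have hQ := len_pos Q
  have hW := one_le_dec J x
  have h1 : ‖φ J x‖ ≤ C * (len J / len Q) / dec J x ^ 2 := by
    refine (h.size J x).trans ?_
    rw [div_le_div_iff₀ (by positivity) (by positivity)]
    have h2 : 1 ≤ (len J / len Q) * dec J x ^ 3 := by
      have h3 : 1 ≤ len J / len Q * dec J x := by
        rw [div_le_iff₀ hJ] at hx
        rw [div_mul_eq_mul_div, le_div_iff₀ hQ]
        linarith
      calc (1 : ℝ) ≤ len J / len Q * dec J x := h3
        _ ≤ len J / len Q * dec J x ^ 3 := by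
            gcongr
            exact le_self_pow₀ hW (by norm_num)
    calc (C : ℝ) * dec J x ^ 2 = C * dec J x ^ 2 * 1 := by ring
      _ ≤ C * dec J x ^ 2 * ((len J / len Q) * dec J x ^ 3) := by gcongr
      _ = _ := by ring
  refine (enorm_le_of_norm_le h1).trans_eq ?_
  have hr : rho Q J = ENNReal.ofReal (len J / len Q) := by
    rw [rho, min_eq_right]
    rw [div_le_div_iff₀ hQ hJ]
    nlinarith
  rw [ofReal_mul_om (by positivity), ENNReal.ofReal_mul C.coe_nonneg, hr,
    ENNReal.ofReal_coe_nnreal]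

/-- The oscillation of `φ_J` on a shorter interval `Q`. -/
lemma Good.enorm_sub_le_rho (h : Good C φ) {Q J : DyadicInterval} (hQJ : len Q ≤ len J)
    {x c : UnitAddCircle} (hx : x ∈ arc Q) (hc : c ∈ arc Q) :
    ‖φ J x - φ J c‖ₑ ≤ 4 * C * rho Q J * om J x := by
  have hJ := len_pos J
  have hQ := len_pos Q
  have hW := one_le_dec J x
  have hd := dist_le_of_mem_arc hx hc
  have hq1 : len Q / len J ≤ 1 := (div_le_one hJ).2 hQJ
  have h1 : ‖φ J x - φ J c‖ ≤ 4 * C * (len Q / len J) / dec J x ^ 2 := by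
    refine (h.lip J x c).trans ?_
    gcongr ?_ / _
    have h2 : dist x c / len J ≤ len Q / len J := by gcongr
    have h0 : 0 ≤ dist x c / len J := by positivity
    calc C * (dist x c / len J) * (1 + dist x c / len J) ^ 2
        ≤ C * (len Q / len J) * (1 + 1) ^ 2 := by
          gcongr
          linarith
      _ = _ := by ring
  refine (enorm_le_of_norm_le h1).trans_eq ?_
  have hr : rho Q J = ENNReal.ofReal (len Q / len J) := by
    rw [rho, min_eq_left]
    rw [div_le_div_iff₀ hJ hQ]
    nlinarith
  rw [ofReal_mul_om (by positivity), ENNReal.ofReal_mul (by positivity), hr,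
    ENNReal.ofReal_mul (by norm_num), ENNReal.ofReal_coe_nnreal]
  simp

/-- Almost orthogonality, pointwise form. -/
lemma Good.enorm_sub_mul_le (h : Good C φ) {I J : DyadicInterval} (hIJ : len I ≤ len J)
    {c : UnitAddCircle} (hc : c ∈ arc I) (x : UnitAddCircle) :
    ‖φ J x - φ J c‖ₑ * ‖φ I x‖ₑ ≤ 8 * C ^ 2 * rho J I * (om J x * om I x) := by
  have hJ := len_pos J
  have hI := len_pos I
  have hWJ := one_le_dec J x
  have hWI := one_le_dec I x
  have hWJ0 := dec_pos J x
  have hWI0 := dec_pos I x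
  have h1 := one_add_dist_le hc x
  set a := dist x c / len I with ha
  have ha0 : 0 ≤ a := by positivity
  set r := len I / len J with hr
  have hr0 : 0 < r := by positivity
  have hr1 : r ≤ 1 := (div_le_one hJ).2 hIJ
  have e : dist x c / len J = a * r := by rw [ha, hr]; field_simp
  -- The Lipschitz bound grows like the third power of `dec I x`. This is why five powers of decay
  -- are kept in `Good`: two remain to form `om I`.
  have h2 : ‖φ J x - φ J c‖ ≤ C * (8 * r * dec I x ^ 3) / dec J x ^ 2 := by
    refine (h.lip J x c).trans ?_
    rw [e]
    gcongr ?_ / _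
    calc C * (a * r) * (1 + a * r) ^ 2 ≤ C * ((2 * dec I x) * r) * (2 * dec I x) ^ 2 := by
          gcongr
          · linarith
          · nlinarith
      _ = _ := by ring
  have h3 : ‖φ J x - φ J c‖ * ‖φ I x‖ ≤ (8 * C ^ 2 * r) / dec J x ^ 2 * (1 / dec I x ^ 2) := by
    calc ‖φ J x - φ J c‖ * ‖φ I x‖ ≤ (C * (8 * r * dec I x ^ 3) / dec J x ^ 2) *
          (C / dec I x ^ 5) := mul_le_mul h2 (h.size I x) (norm_nonneg _) (by positivity)
      _ = _ := by field_simp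
  rw [← ofReal_norm, ← ofReal_norm, ← ENNReal.ofReal_mul (norm_nonneg _)]
  refine (ENNReal.ofReal_le_ofReal h3).trans_eq ?_
  have hrho : rho J I = ENNReal.ofReal r := by
    rw [rho, min_eq_right]
    rw [div_le_div_iff₀ hJ hI]
    nlinarith
  rw [ENNReal.ofReal_mul (by positivity), ofReal_mul_om (by positivity),
    ENNReal.ofReal_mul (by positivity), ENNReal.ofReal_mul (by positivity), hrho, om, om,
    ENNReal.ofReal_pow C.coe_nonneg, ENNReal.ofReal_coe_nnreal]
  simp only [ENNReal.ofReal_ofNat]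
  ring

lemma Good.aestronglyMeasurable (h : Good C φ) (I : DyadicInterval) (μ : Measure UnitAddCircle) :
    AEStronglyMeasurable (φ I) μ := (h.cont I).aestronglyMeasurable

lemma Good.integrable (h : Good C φ) (I : DyadicInterval) : Integrable (φ I) :=
  Integrable.of_bound (h.aestronglyMeasurable I _) C (Filter.Eventually.of_forall (h.norm_le I))

/-- The function on the shorter interval has mean zero, so the value of the longer one at a point of
the short arc may be subtracted; the smooth variation yields the ratio of lengths. -/
lemma enorm_integral_mul_conj_le_of_len_le (h : Good C φ) (hz : ZeroMean φ) {I J : DyadicInterval}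
    (hIJ : len I ≤ len J) : ‖∫ x, φ J x * conj (φ I x)‖ₑ ≤
      8 * C ^ 2 * rho J I * ∫⁻ x, om J x * om I x := by
  obtain ⟨c, hc⟩ := arc_nonempty I
  have hint : Integrable fun x => φ J x * conj (φ I x) := by
    refine Integrable.of_bound ((h.aestronglyMeasurable J _).mul
      (Complex.continuous_conj.comp (h.cont I)).aestronglyMeasurable) (C * C)
      (Filter.Eventually.of_forall fun x => ?_)
    rw [norm_mul, RCLike.norm_conj]
    exact mul_le_mul (h.norm_le J x) (h.norm_le I x) (norm_nonneg _) C.coe_nonneg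
  have hint2 : Integrable fun x => φ J c * conj (φ I x) := by
    refine Integrable.const_mul ?_ _
    exact (h.integrable I).congr' (Complex.continuous_conj.comp (h.cont I)).aestronglyMeasurable
      (Filter.Eventually.of_forall fun x => by simp)
  have e : ∫ x, φ J x * conj (φ I x) = ∫ x, (φ J x - φ J c) * conj (φ I x) := by
    simp_rw [sub_mul]
    rw [integral_sub hint hint2, integral_const_mul, integral_conj, hz I]
    simp
  rw [e]
  refine (enorm_integral_le_lintegral_enorm _).trans ?_
  rw [← lintegral_const_mul _ (by exact (measurable_om J).mul (measurable_om I))]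
  apply lintegral_mono
  intro x
  dsimp only
  rw [enorm_mul, RCLike.enorm_conj]
  exact h.enorm_sub_mul_le hIJ hc x

lemma enorm_integral_mul_conj_le (h : Good C φ) (hz : ZeroMean φ) (I J : DyadicInterval) :
    ‖∫ x, φ J x * conj (φ I x)‖ₑ ≤ 8 * C ^ 2 * rho J I * ∫⁻ x, om J x * om I x := by
  rcases le_total (len I) (len J) with hl | hl
  · exact enorm_integral_mul_conj_le_of_len_le h hz hl
  · have h1 := enorm_integral_mul_conj_le_of_len_le h hz hl
    rw [rho_comm]
    simp_rw [mul_comm (om J _)]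
    refine le_trans (le_of_eq ?_) h1
    rw [← RCLike.enorm_conj, ← integral_conj]
    simp [mul_comm]

/-- The row sums of the Gram matrix, as required by the Schur test. -/
lemma tsum_enorm_integral_mul_conj_le (h : Good C φ) (hz : ZeroMean φ) (J : DyadicInterval) :
    ∑' I, ‖∫ x, φ J x * conj (φ I x)‖ₑ ≤ 24 * C ^ 2 * omC ^ 2 * elen J := by
  calc ∑' I, ‖∫ x, φ J x * conj (φ I x)‖ₑ
      ≤ ∑' I, 8 * (C : ℝ≥0∞) ^ 2 * ∫⁻ x, om J x * (rho J I * om I x) := by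
        refine ENNReal.tsum_le_tsum fun I => (enorm_integral_mul_conj_le h hz I J).trans_eq ?_
        rw [mul_assoc, ← lintegral_const_mul _ (by exact (measurable_om J).mul (measurable_om I))]
        congr 2; ext x; ring
    _ = 8 * (C : ℝ≥0∞) ^ 2 * ∫⁻ x, om J x * ∑' I, rho J I * om I x := by
        rw [ENNReal.tsum_mul_left, ← lintegral_tsum fun I => by
          exact ((measurable_om J).mul ((measurable_om I).const_mul _)).aemeasurable]
        simp_rw [ENNReal.tsum_mul_left]
    _ ≤ 8 * (C : ℝ≥0∞) ^ 2 * ∫⁻ x, om J x * (3 * omC) := by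
        gcongr with x
        exact tsum_rho_mul_om_le J x
    _ ≤ 8 * (C : ℝ≥0∞) ^ 2 * ((omC * elen J) * (3 * omC)) := by
        rw [lintegral_mul_const _ (measurable_om J)]
        gcongr
        exact lintegral_om_le J
    _ = _ := by ring

end Good


/-! ### Bessel's inequality for Hilbert-space-valued functions -/

section Square

variable {C : ℝ≥0} {φ : DyadicInterval → UnitAddCircle → ℂ}
variable {E : Type*} [NormedAddCommGroup E] [InnerProductSpace ℂ E]

lemma Good.integrable_smul (h : Good C φ) (J : DyadicInterval) {F : UnitAddCircle → E}
    {μ : Measure UnitAddCircle} (hF : Integrable F μ) : Integrable (fun x => φ J x • F x) μ := by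
  refine (hF.norm.const_mul (C : ℝ)).mono' ((h.aestronglyMeasurable J μ).smul
    hF.aestronglyMeasurable) (Filter.Eventually.of_forall fun x => ?_)
  rw [norm_smul]
  exact mul_le_mul_of_nonneg_right (h.norm_le J x) (norm_nonneg _)

lemma ofReal_norm_sq {F : Type*} [SeminormedAddGroup F] (a : F) :
    ENNReal.ofReal (‖a‖ ^ 2) = ‖a‖ₑ ^ 2 := by
  rw [ENNReal.ofReal_pow (norm_nonneg _), ofReal_norm]

/-- The constant in Bessel's inequality. -/
def besselK (C : ℝ≥0) : ℝ≥0∞ := 48 * C ^ 2 * omC ^ 2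

lemma besselK_ne_top (C : ℝ≥0) : besselK C ≠ ⊤ := by
  have := omC_ne_top
  unfold besselK
  finiteness

/-- The dual form of Bessel's inequality. Expanding the square gives the Gram matrix, and the Schur
test applies with the crude bound `ab ≤ a² + b²`, which doubles the row-sum constant 24 to 48.
Vector coefficients enter only through Cauchy–Schwarz. -/
lemma lintegral_enorm_sum_sq_le (h : Good C φ) (hz : ZeroMean φ) (s : Finset DyadicInterval)
    (c : DyadicInterval → E) :
    ∫⁻ x, ‖∑ J ∈ s, (((1 / len J : ℝ) : ℂ) * conj (φ J x)) • c J‖ₑ ^ 2 ≤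
      besselK C * ∑ J ∈ s, (elen J)⁻¹ * ‖c J‖ₑ ^ 2 := by
  set G : UnitAddCircle → E :=
    fun x => ∑ J ∈ s, (((1 / len J : ℝ) : ℂ) * conj (φ J x)) • c J with hG
  have hGc : Continuous G := by
    refine continuous_finsetSum _ fun J _ => ?_
    exact (continuous_const.mul (Complex.continuous_conj.comp (h.cont J))).smul continuous_const
  have hcomp : ∀ f : UnitAddCircle → ℂ, Continuous f → Integrable f := fun f hf =>
    hf.integrable_of_hasCompactSupport (HasCompactSupport.of_compactSpace f)
  have hcompR : ∀ f : UnitAddCircle → ℝ, Continuous f → Integrable f := fun f hf =>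
    hf.integrable_of_hasCompactSupport (HasCompactSupport.of_compactSpace f)
  have hcc : ∀ J I, Continuous fun x => φ J x * conj (φ I x) := fun J I =>
    (h.cont J).mul (Complex.continuous_conj.comp (h.cont I))
  have e1 : ∀ x, ((‖G x‖ ^ 2 : ℝ) : ℂ) = ∑ J ∈ s, ∑ I ∈ s,
      (((1 / len J : ℝ) : ℂ) * ((1 / len I : ℝ) : ℂ) * inner ℂ (c J) (c I)) *
        (φ J x * conj (φ I x)) := by
    intro x
    have := inner_self_eq_norm_sq_to_K (𝕜 := ℂ) (G x)
    rw [Complex.ofReal_pow]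
    refine this.symm.trans ?_
    simp only [hG]
    rw [sum_inner]
    refine Finset.sum_congr rfl fun J _ => ?_
    rw [inner_sum]
    refine Finset.sum_congr rfl fun I _ => ?_
    rw [inner_smul_left, inner_smul_right, map_mul, Complex.conj_ofReal, Complex.conj_conj]
    ring
  have e2 : ∫⁻ x, ‖G x‖ₑ ^ 2 = ‖∫ x, ((‖G x‖ ^ 2 : ℝ) : ℂ)‖ₑ := by
    rw [integral_complex_ofReal, ← ofReal_norm]
    have hn : 0 ≤ ∫ x, ‖G x‖ ^ 2 := integral_nonneg fun x => by positivity
    rw [Complex.norm_real, Real.norm_eq_abs, abs_of_nonneg hn, ofReal_integral_eq_lintegral_ofReal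
      (hcompR (fun x => ‖G x‖ ^ 2) (hGc.norm.pow 2)) (Filter.Eventually.of_forall fun x => by positivity)]
    simp_rw [ofReal_norm_sq]
  have hK : ∀ J I, ‖∫ x, φ I x * conj (φ J x)‖ₑ = ‖∫ x, φ J x * conj (φ I x)‖ₑ := by
    intro J I
    rw [← RCLike.enorm_conj, ← integral_conj]
    simp [mul_comm]
  set b : DyadicInterval → ℝ≥0∞ := fun J => (elen J)⁻¹ * ‖c J‖ₑ with hb
  set K : DyadicInterval → DyadicInterval → ℝ≥0∞ := fun J I => ‖∫ x, φ J x * conj (φ I x)‖ₑ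
  have hsum : ∀ J, ∑ I ∈ s, K J I ≤ 24 * C ^ 2 * omC ^ 2 * elen J := fun J =>
    (ENNReal.sum_le_tsum s).trans (tsum_enorm_integral_mul_conj_le h hz J)
  have hbe : ∀ J, b J ^ 2 * elen J = (elen J)⁻¹ * ‖c J‖ₑ ^ 2 := by
    intro J
    rw [hb]
    dsimp only
    calc ((elen J)⁻¹ * ‖c J‖ₑ) ^ 2 * elen J = ((elen J)⁻¹ * elen J) * ((elen J)⁻¹ * ‖c J‖ₑ ^ 2) := by
          ring
      _ = _ := by rw [elen_inv_mul, one_mul]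
  have hhalf : ∑ J ∈ s, ∑ I ∈ s, b J ^ 2 * K J I ≤
      24 * C ^ 2 * omC ^ 2 * ∑ J ∈ s, (elen J)⁻¹ * ‖c J‖ₑ ^ 2 := by
    rw [Finset.mul_sum]
    refine Finset.sum_le_sum fun J _ => ?_
    rw [← Finset.mul_sum, ← hbe]
    refine (mul_le_mul_right (hsum J) _).trans_eq ?_
    ring
  rw [e2]
  simp_rw [e1]
  rw [integral_finsetSum _ fun J _ => integrable_finsetSum _ fun I _ =>
    (hcomp _ (hcc J I)).const_mul _]
  simp_rw [integral_finsetSum s fun I _ => (hcomp _ (hcc _ I)).const_mul _, integral_const_mul]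
  calc _ ≤ ∑ J ∈ s, ∑ I ∈ s, b J * b I * K J I := by
        refine (enorm_sum_le _ _).trans (Finset.sum_le_sum fun J _ => (enorm_sum_le _ _).trans
          (Finset.sum_le_sum fun I _ => ?_))
        rw [enorm_mul, enorm_mul, enorm_mul]
        have hl : ∀ J, ‖((1 / len J : ℝ) : ℂ)‖ₑ = (elen J)⁻¹ := by
          intro J
          have := len_pos J
          rw [elen_inv, ← ofReal_norm, Complex.norm_real, Real.norm_eq_abs, abs_of_pos (by positivity)]
        rw [hl, hl]
        have hin : ‖inner ℂ (c J) (c I)‖ₑ ≤ ‖c J‖ₑ * ‖c I‖ₑ := by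
          rw [← ofReal_norm, ← ofReal_norm, ← ofReal_norm, ← ENNReal.ofReal_mul (norm_nonneg _)]
          exact ENNReal.ofReal_le_ofReal (norm_inner_le_norm _ _)
        calc _ ≤ (elen J)⁻¹ * (elen I)⁻¹ * (‖c J‖ₑ * ‖c I‖ₑ) * K J I := by gcongr
          _ = _ := by rw [hb]; ring
    _ ≤ ∑ J ∈ s, ∑ I ∈ s, (b J ^ 2 * K J I + b I ^ 2 * K I J) := by
        refine Finset.sum_le_sum fun J _ => Finset.sum_le_sum fun I _ => ?_
        rw [show K I J = K J I from hK J I, ← add_mul]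
        gcongr
        rcases le_total (b J) (b I) with hc | hc
        · refine le_trans ?_ le_add_self
          rw [sq]; gcongr
        · refine le_trans ?_ le_self_add
          rw [sq]; gcongr
    _ = (∑ J ∈ s, ∑ I ∈ s, b J ^ 2 * K J I) + ∑ J ∈ s, ∑ I ∈ s, b J ^ 2 * K J I := by
        simp_rw [Finset.sum_add_distrib]
        congr 1
        exact Finset.sum_comm
    _ ≤ _ := by
        refine (add_le_add hhalf hhalf).trans_eq ?_
        rw [besselK]; ring

/-- Let `G` be the synthesis of the coefficients of `F`. The left side is the pairing of `G` with
`F`, and the norm of `G` is bounded by the left side again; a finite sum is finite, so it can be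
cancelled. -/
lemma bessel_finset [CompleteSpace E] (h : Good C φ) (hz : ZeroMean φ) {F : UnitAddCircle → E}
    (hF : MemLp F 2) (s : Finset DyadicInterval) :
    ∑ J ∈ s, (elen J)⁻¹ * ‖∫ y, φ J y • F y‖ₑ ^ 2 ≤ besselK C * ∫⁻ x, ‖F x‖ₑ ^ 2 := by
  have hFi : Integrable F := hF.integrable (by norm_num)
  set c : DyadicInterval → E := fun J => ∫ y, φ J y • F y with hc
  set G : UnitAddCircle → E :=
    fun x => ∑ J ∈ s, (((1 / len J : ℝ) : ℂ) * conj (φ J x)) • c J with hG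
  have hGc : Continuous G := by
    refine continuous_finsetSum _ fun J _ => ?_
    exact (continuous_const.mul (Complex.continuous_conj.comp (h.cont J))).smul continuous_const
  set Y := ∑ J ∈ s, (elen J)⁻¹ * ‖c J‖ₑ ^ 2 with hY
  set Z := ∫⁻ x, ‖F x‖ₑ ^ 2 with hZ
  have hYr : Y = ENNReal.ofReal (∑ J ∈ s, 1 / len J * ‖c J‖ ^ 2) := by
    rw [ENNReal.ofReal_sum_of_nonneg fun J _ => by have := len_pos J; positivity]
    refine Finset.sum_congr rfl fun J _ => ?_
    have := len_pos J
    rw [ENNReal.ofReal_mul (by positivity), ofReal_norm_sq, elen_inv]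
  have hYt : Y ≠ ⊤ := by rw [hYr]; simp
  have e1 : ((∑ J ∈ s, 1 / len J * ‖c J‖ ^ 2 : ℝ) : ℂ) = ∫ x, inner ℂ (G x) (F x) := by
    have e2 : ∀ x, inner ℂ (G x) (F x) =
        ∑ J ∈ s, ((1 / len J : ℝ) : ℂ) * inner ℂ (c J) (φ J x • F x) := by
      intro x
      simp only [hG]
      rw [sum_inner]
      refine Finset.sum_congr rfl fun J _ => ?_
      rw [inner_smul_left, inner_smul_right, map_mul, Complex.conj_ofReal, Complex.conj_conj]
      ring
    simp_rw [e2]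
    rw [integral_finsetSum _ fun J _ => ((h.integrable_smul J hFi).const_inner (c J)).const_mul _]
    push_cast
    refine Finset.sum_congr rfl fun J _ => ?_
    rw [integral_const_mul, integral_inner (h.integrable_smul J hFi)]
    have := inner_self_eq_norm_sq_to_K (𝕜 := ℂ) (c J)
    rw [show (∫ x, φ J x • F x) = c J from rfl, this]
    simp
  have h1 : Y ≤ (besselK C * Y) ^ (1 / 2 : ℝ) * Z ^ (1 / 2 : ℝ) := by
    calc Y = ‖((∑ J ∈ s, 1 / len J * ‖c J‖ ^ 2 : ℝ) : ℂ)‖ₑ := by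
          rw [hYr, ← ofReal_norm, Complex.norm_real, Real.norm_eq_abs, abs_of_nonneg]
          exact Finset.sum_nonneg fun J _ => by have := len_pos J; positivity
      _ = ‖∫ x, inner ℂ (G x) (F x)‖ₑ := by rw [e1]
      _ ≤ ∫⁻ x, ‖inner ℂ (G x) (F x)‖ₑ := enorm_integral_le_lintegral_enorm _
      _ ≤ ∫⁻ x, ((fun x => ‖G x‖ₑ) * fun x => ‖F x‖ₑ) x := by
          apply lintegral_mono
          intro x
          dsimp only [Pi.mul_apply]
          rw [← ofReal_norm, ← ofReal_norm, ← ofReal_norm, ← ENNReal.ofReal_mul (norm_nonneg _)]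
          exact ENNReal.ofReal_le_ofReal (norm_inner_le_norm _ _)
      _ ≤ (∫⁻ x, ‖G x‖ₑ ^ (2 : ℝ)) ^ (1 / 2 : ℝ) * (∫⁻ x, ‖F x‖ₑ ^ (2 : ℝ)) ^ (1 / 2 : ℝ) :=
          ENNReal.lintegral_mul_le_Lp_mul_Lq volume Real.HolderConjugate.two_two
            hGc.aestronglyMeasurable.enorm hF.aestronglyMeasurable.enorm
      _ ≤ _ := by
          simp only [ENNReal.rpow_ofNat]
          gcongr
          exact lintegral_enorm_sum_sq_le h hz s c
  by_cases hY0 : Y = 0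
  · rw [hY0]; exact zero_le
  have h2 : Y * Y ≤ Y * (besselK C * Z) := by
    calc Y * Y ≤ ((besselK C * Y) ^ (1 / 2 : ℝ) * Z ^ (1 / 2 : ℝ)) *
          ((besselK C * Y) ^ (1 / 2 : ℝ) * Z ^ (1 / 2 : ℝ)) := mul_le_mul' h1 h1
      _ = ((besselK C * Y) ^ (1 / 2 : ℝ)) ^ 2 * (Z ^ (1 / 2 : ℝ)) ^ 2 := by ring
      _ = _ := by rw [rpow_half_sq, rpow_half_sq]; ring
  exact (ENNReal.mul_le_mul_iff_right hY0 hYt).1 h2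

/-- The square function of a vector-valued function. -/
def Sq (φ : DyadicInterval → UnitAddCircle → ℂ) (F : UnitAddCircle → E) (x : UnitAddCircle) :
    ℝ≥0∞ :=
  l2 fun J : DyadicInterval => (elen J)⁻¹ * ‖∫ y, φ J y • F y‖ₑ * chi J x

lemma measurable_Sq (φ : DyadicInterval → UnitAddCircle → ℂ) (F : UnitAddCircle → E) :
    Measurable (Sq φ F) := measurable_l2 fun J => (measurable_chi J).const_mul _

lemma chi_sq (J : DyadicInterval) (x : UnitAddCircle) : chi J x ^ 2 = chi J x := by
  by_cases h : x ∈ arc J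
  · rw [chi_eq_one h, one_pow]
  · rw [chi_eq_zero h]; simp

lemma lintegral_Sq_sq_mul (φ : DyadicInterval → UnitAddCircle → ℂ) (F : UnitAddCircle → E)
    {w : UnitAddCircle → ℝ≥0∞} (hw : Measurable w) :
    ∫⁻ x, Sq φ F x ^ 2 * w x =
      ∑' J, (elen J)⁻¹ * ‖∫ y, φ J y • F y‖ₑ ^ 2 * avg w J := by
  unfold Sq
  simp_rw [l2_sq, ← ENNReal.tsum_mul_right, mul_pow, chi_sq]
  rw [lintegral_tsum fun J => by
    exact (((measurable_chi J).const_mul _).mul hw).aemeasurable]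
  congr 1; ext J
  have e : ∀ x, (elen J)⁻¹ ^ 2 * ‖∫ y, φ J y • F y‖ₑ ^ 2 * chi J x * w x =
      ((elen J)⁻¹ ^ 2 * ‖∫ y, φ J y • F y‖ₑ ^ 2) * (w x * chi J x) := fun x => by ring
  simp_rw [e]
  rw [lintegral_const_mul _ (by exact hw.mul (measurable_chi J)), lintegral_mul_chi, avg]
  ring

lemma lintegral_Sq_sq (φ : DyadicInterval → UnitAddCircle → ℂ) (F : UnitAddCircle → E) :
    ∫⁻ x, Sq φ F x ^ 2 = ∑' J, (elen J)⁻¹ * ‖∫ y, φ J y • F y‖ₑ ^ 2 := by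
  have h := lintegral_Sq_sq_mul φ F (measurable_const (a := (1 : ℝ≥0∞)))
  simp only [mul_one] at h
  rw [h]
  congr 1; ext J
  rw [avg, setLIntegral_const, one_mul, volume_cell, elen_inv_mul, mul_one]

lemma tsum_bessel [CompleteSpace E] (h : Good C φ) (hz : ZeroMean φ) {F : UnitAddCircle → E}
    (hF : MemLp F 2) :
    ∑' J, (elen J)⁻¹ * ‖∫ y, φ J y • F y‖ₑ ^ 2 ≤ besselK C * ∫⁻ x, ‖F x‖ₑ ^ 2 := by
  rw [ENNReal.tsum_eq_iSup_sum]
  exact iSup_le fun s => bessel_finset h hz hF s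

lemma memLp_two_of_lintegral {E : Type*} [NormedAddCommGroup E] {F : UnitAddCircle → E} (hF : AEStronglyMeasurable F)
    (h : ∫⁻ x, ‖F x‖ₑ ^ 2 ≠ ⊤) : MemLp F 2 := by
  refine ⟨hF, ?_⟩
  rw [eLpNorm_lt_top_iff_lintegral_rpow_enorm_lt_top (by norm_num) (by norm_num)]
  simpa using lt_top_iff_ne_top.2 h

/-- The summand 1 keeps the constant nonzero, so for `F` outside `L²` the right side is `⊤` and
nothing is left to prove. -/
lemma lintegral_Sq_sq_le [CompleteSpace E] (h : Good C φ) (hz : ZeroMean φ) {F : UnitAddCircle → E}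
    (hF : AEStronglyMeasurable F) :
    ∫⁻ x, Sq φ F x ^ 2 ≤ (1 + besselK C) * ∫⁻ x, ‖F x‖ₑ ^ 2 := by
  by_cases ht : ∫⁻ x, ‖F x‖ₑ ^ 2 = ⊤
  · rw [ht, ENNReal.mul_top (by simp)]; exact le_top
  · rw [lintegral_Sq_sq]
    refine (tsum_bessel h hz (memLp_two_of_lintegral hF ht)).trans ?_
    gcongr
    exact le_add_self

end Square


/-! ### Calderón–Zygmund decomposition and the weak type of the square function -/

lemma l2_le_tsum {ι : Type*} (a : ι → ℝ≥0∞) : l2 a ≤ ∑' i, a i := by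
  rw [l2_le_iff, sq, ← ENNReal.tsum_mul_right]
  refine ENNReal.tsum_le_tsum fun i => ?_
  rw [sq]
  exact mul_le_mul_right (ENNReal.le_tsum i) _

section CalderonZygmund

variable {C : ℝ≥0} {φ : DyadicInterval → UnitAddCircle → ℂ}
variable {E : Type*} [NormedAddCommGroup E] [InnerProductSpace ℂ E]

lemma Sq_sq_add_le (h : Good C φ) {F G : UnitAddCircle → E} (hF : Integrable F)
    (hG : Integrable G) (x : UnitAddCircle) :
    Sq φ (fun y => F y + G y) x ^ 2 ≤ 2 * Sq φ F x ^ 2 + 2 * Sq φ G x ^ 2 := by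
  unfold Sq
  rw [l2_sq, l2_sq, l2_sq, ← ENNReal.tsum_mul_left, ← ENNReal.tsum_mul_left,
    ← ENNReal.summable.tsum_add ENNReal.summable]
  refine ENNReal.tsum_le_tsum fun J => le_trans ?_ (two_mul_sq_add_le _ _)
  simp_rw [smul_add]
  rw [integral_add (h.integrable_smul J hF) (h.integrable_smul J hG), ← add_mul, ← mul_add]
  gcongr
  exact enorm_add_le _ _

/-- Cancellation of a mean zero function on an interval, seen from outside its enlargement. -/
lemma enorm_setIntegral_smul_le [CompleteSpace E] (h : Good C φ) {Q J : DyadicInterval}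
    {y : UnitAddCircle} (hy : y ∉ star Q) (hyJ : y ∈ arc J) {b : UnitAddCircle → E}
    (hb : IntegrableOn b (cell Q)) (hb0 : ∫ z in cell Q, b z = 0) :
    ‖∫ z in cell Q, φ J z • b z‖ₑ ≤
      ∫⁻ z in cell Q, 4 * C * (rho Q J * om J z) * ‖b z‖ₑ := by
  -- If `Q` is the shorter interval, the mean-zero condition gains the oscillation of `φ J` on `Q`.
  -- If `Q` is longer, no cancellation is needed: `J` meets the complement of `star Q`, so `φ J` is
  -- already small on `Q`.
  rcases le_total (len Q) (len J) with hl | hl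
  · obtain ⟨c, hc⟩ := arc_nonempty Q
    have e : ∫ z in cell Q, φ J z • b z = ∫ z in cell Q, (φ J z - φ J c) • b z := by
      simp_rw [sub_smul]
      rw [integral_sub (g := fun z => φ J c • b z) (h.integrable_smul J hb) (hb.smul (φ J c)),
        integral_smul, hb0, smul_zero,
        sub_zero]
    rw [e]
    refine (enorm_integral_le_lintegral_enorm _).trans
      (setLIntegral_mono' (measurableSet_cell Q) fun z hz => ?_)
    rw [enorm_smul]
    gcongr
    refine (h.enorm_sub_le_rho hl (cell_subset_arc Q hz) hc).trans_eq ?_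
    ring
  · refine (enorm_integral_le_lintegral_enorm _).trans
      (setLIntegral_mono' (measurableSet_cell Q) fun z hz => ?_)
    rw [enorm_smul]
    gcongr
    have h1 := len_div_le_dec hyJ (len_le_dist_of_notMem_star hy (cell_subset_arc Q hz))
    refine (h.enorm_le_rho hl h1).trans ?_
    calc (C : ℝ≥0∞) * rho Q J * om J z = 1 * (C * (rho Q J * om J z)) := by ring
      _ ≤ 4 * (C * (rho Q J * om J z)) := by gcongr; norm_num
      _ = _ := by ring

/-- The square function of the bad part, off the exceptional set. -/
lemma setLIntegral_Sq_le_of_cancel [CompleteSpace E] (h : Good C φ) {S : Set DyadicInterval}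
    (hS : DisjointCells S) {b : UnitAddCircle → E} (hb : Integrable b)
    (hb1 : ∀ x, x ∉ cover S → b x = 0) (hb0 : ∀ Q ∈ S, ∫ z in cell Q, b z = 0) :
    ∫⁻ x in (⋃ Q : S, star Q)ᶜ, Sq φ b x ≤ 12 * C * omC * ∫⁻ x, ‖b x‖ₑ := by
  have hmb : AEMeasurable (fun x => ‖b x‖ₑ) := hb.aestronglyMeasurable.enorm
  set X : DyadicInterval → DyadicInterval → ℝ≥0∞ := fun Q J =>
    ∫⁻ z in cell Q, 4 * C * (rho Q J * om J z) * ‖b z‖ₑ with hX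
  have hpt : ∀ x ∈ (⋃ Q : S, star Q)ᶜ,
      Sq φ b x ≤ ∑' J, (elen J)⁻¹ * (∑' Q : S, X Q J) * chi J x := by
    intro x hx
    simp only [Set.mem_compl_iff, Set.mem_iUnion, not_exists] at hx
    -- For the bad part the `ℓ²` norm may be replaced by `ℓ¹`, because the ratios of lengths make
    -- the whole sum over `J` converge.
    refine (l2_le_tsum _).trans (ENNReal.tsum_le_tsum fun J => ?_)
    by_cases hxJ : x ∈ arc J
    · refine mul_le_mul_left (mul_le_mul_right ?_ _) _
      have hi := h.integrable_smul J hb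
      have e : ∫ z, φ J z • b z = ∑' Q : S, ∫ z in cell Q, φ J z • b z := by
        rw [← integral_iUnion (fun Q : S => measurableSet_cell Q) hS.pairwise hi.integrableOn]
        refine (setIntegral_eq_integral_of_forall_compl_eq_zero fun z hz => ?_).symm
        rw [hb1 z hz, smul_zero]
      rw [e]
      refine enorm_tsum_le_tsum_enorm.trans (ENNReal.tsum_le_tsum fun Q => ?_)
      exact enorm_setIntegral_smul_le h (hx Q) hxJ hb.integrableOn (hb0 Q Q.2)
    · simp [chi_eq_zero hxJ]
  calc ∫⁻ x in (⋃ Q : S, star Q)ᶜ, Sq φ b x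
      ≤ ∫⁻ x in (⋃ Q : S, star Q)ᶜ, ∑' J, (elen J)⁻¹ * (∑' Q : S, X Q J) * chi J x :=
        setLIntegral_mono' (MeasurableSet.iUnion fun Q : S => measurableSet_star Q).compl hpt
    _ ≤ ∫⁻ x, ∑' J, (elen J)⁻¹ * (∑' Q : S, X Q J) * chi J x := setLIntegral_le_lintegral _ _
    _ = ∑' J, ∑' Q : S, X Q J := by
        rw [lintegral_tsum fun J => ((measurable_chi J).const_mul _).aemeasurable]
        congr 1; ext J
        rw [lintegral_mul_chi, setLIntegral_const, volume_cell]
        calc (elen J)⁻¹ * (∑' Q : S, X Q J) * elen J =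
            (elen J)⁻¹ * elen J * (∑' Q : S, X Q J) := by ring
          _ = _ := by rw [elen_inv_mul, one_mul]
    _ = ∑' Q : S, ∑' J, X Q J := ENNReal.tsum_comm
    _ ≤ ∑' Q : S, ∫⁻ z in cell Q, 12 * C * omC * ‖b z‖ₑ := by
        refine ENNReal.tsum_le_tsum fun Q => ?_
        rw [hX]
        dsimp only
        rw [← lintegral_tsum fun J => ?_]
        · apply lintegral_mono
          intro z
          dsimp only
          rw [ENNReal.tsum_mul_right, ENNReal.tsum_mul_left]
          refine mul_le_mul_left ?_ _
          calc _ ≤ 4 * (C : ℝ≥0∞) * (3 * omC) := by gcongr; exact tsum_rho_mul_om_le _ _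
            _ = _ := by ring
        · have := measurable_om J
          have := hmb.restrict (s := cell Q)
          fun_prop
    _ ≤ ∫⁻ z, 12 * C * omC * ‖b z‖ₑ := hS.tsum_lintegral_le _
    _ = _ := lintegral_const_mul'' _ hmb

open Classical in
/-- Replace a vector-valued function by its means on the intervals of a family. -/
def condMean (S : Set DyadicInterval) (F : UnitAddCircle → E) (x : UnitAddCircle) : E :=
  if h : ∃ Q ∈ S, x ∈ cell Q then ((1 / len h.choose : ℝ) : ℂ) • ∫ y in cell h.choose, F y else F x

lemma condMean_of_mem {S : Set DyadicInterval} (hS : DisjointCells S) (F : UnitAddCircle → E)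
    {Q : DyadicInterval} (hQ : Q ∈ S) {x : UnitAddCircle} (hx : x ∈ cell Q) :
    condMean S F x = ((1 / len Q : ℝ) : ℂ) • ∫ y in cell Q, F y := by
  have h : ∃ Q ∈ S, x ∈ cell Q := ⟨Q, hQ, hx⟩
  have e : h.choose = Q := hS _ h.choose_spec.1 _ hQ x h.choose_spec.2 hx
  rw [condMean, dif_pos h, e]

lemma condMean_of_notMem {S : Set DyadicInterval} (F : UnitAddCircle → E)
    {x : UnitAddCircle} (hx : x ∉ cover S) : condMean S F x = F x := by
  rw [condMean, dif_neg]
  rwa [mem_cover] at hx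

lemma enorm_one_div_len (J : DyadicInterval) : ‖((1 / len J : ℝ) : ℂ)‖ₑ = (elen J)⁻¹ := by
  have := len_pos J
  rw [elen_inv, ← ofReal_norm, Complex.norm_real, Real.norm_eq_abs, abs_of_pos (by positivity)]

lemma enorm_condMean_le {S : Set DyadicInterval} (hS : DisjointCells S) (F : UnitAddCircle → E)
    (x : UnitAddCircle) : ‖condMean S F x‖ₑ ≤ condAvg S (fun y => ‖F y‖ₑ) x := by
  by_cases hx : x ∈ cover S
  · obtain ⟨Q, hQ, hxQ⟩ := mem_cover.1 hx
    rw [condMean_of_mem hS F hQ hxQ, condAvg_of_mem hS _ hQ hxQ, enorm_smul, enorm_one_div_len, avg]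
    gcongr
    exact enorm_integral_le_lintegral_enorm _
  · rw [condMean_of_notMem F hx, condAvg_of_notMem _ hx]

lemma aestronglyMeasurable_condMean {S : Set DyadicInterval} (hS : DisjointCells S)
    {F : UnitAddCircle → E} (hF : AEStronglyMeasurable F) :
    AEStronglyMeasurable (condMean S F) := by
  rw [← Measure.restrict_univ (μ := (volume : Measure UnitAddCircle)),
    ← Set.union_compl_self (cover S), aestronglyMeasurable_union_iff]
  constructor
  · rw [cover, aestronglyMeasurable_iUnion_iff]
    intro Q
    refine (aestronglyMeasurable_const
      (b := ((1 / len (Q : DyadicInterval) : ℝ) : ℂ) • ∫ y in cell Q, F y)).congr ?_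
    filter_upwards [ae_restrict_mem (measurableSet_cell Q)] with x hx
    exact (condMean_of_mem hS F Q.2 hx).symm
  · refine hF.restrict.congr ?_
    filter_upwards [ae_restrict_mem (measurableSet_cover S).compl] with x hx
    exact (condMean_of_notMem F hx).symm

lemma setIntegral_condMean [CompleteSpace E] {S : Set DyadicInterval} (hS : DisjointCells S)
    (F : UnitAddCircle → E) {Q : DyadicInterval} (hQ : Q ∈ S) :
    ∫ x in cell Q, condMean S F x = ∫ x in cell Q, F x := by
  rw [setIntegral_congr_fun (measurableSet_cell Q)
    (g := fun _ => ((1 / len Q : ℝ) : ℂ) • ∫ y in cell Q, F y)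
    (fun x hx => condMean_of_mem hS F hQ hx), setIntegral_const, Measure.real, volume_cell, elen,
    ENNReal.toReal_ofReal (len_pos Q).le, Complex.coe_smul, smul_smul, mul_one_div_cancel
    (len_pos Q).ne', one_smul]

/-- The weak-type constant of the square function. -/
def sqW (C : ℝ≥0) : ℝ≥0∞ := 1 + 4 * omC + 8 * (1 + besselK C) + 48 * C * omC

/-- The good part is `condMean`, of norm at most `2 T` almost everywhere, and is treated in `L²`.
The bad part has integral zero on each stopping cell, and its square function is integrable off the
enlargements, whose union is small. -/
lemma Sq_weak [CompleteSpace E] (h : Good C φ) (hz : ZeroMean φ) {F : UnitAddCircle → E}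
    (hF : StronglyMeasurable F) (hFi : Integrable F) {t : ℝ} (ht : 0 < t) :
    ENNReal.ofReal t * volume {x | ENNReal.ofReal t < Sq φ F x} ≤ sqW C * ∫⁻ x, ‖F x‖ₑ := by
  set u : UnitAddCircle → ℝ≥0∞ := fun x => ‖F x‖ₑ with hu
  have hmu : Measurable u := hF.enorm
  have hT0 : ENNReal.ofReal t ≠ 0 := by simpa using ht
  have hTt : ENNReal.ofReal t ≠ ⊤ := ENNReal.ofReal_ne_top
  set T := ENNReal.ofReal t
  by_cases hfi : ∫⁻ x, u x ≤ T
  · set S := stopping (avg u) T with hSdef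
    have hS : DisjointCells S := disjointCells_stopping _ _
    set g := condMean S F with hg
    set b : UnitAddCircle → E := fun x => F x - g x with hb
    have hgm : AEStronglyMeasurable g := aestronglyMeasurable_condMean hS hF.aestronglyMeasurable
    have hgl : ∫⁻ x, ‖g x‖ₑ ≤ ∫⁻ x, u x :=
      (lintegral_mono fun x => enorm_condMean_le hS F x).trans_eq (lintegral_condAvg hS u)
    have hgi : Integrable g := ⟨hgm, hgl.trans_lt hFi.2⟩
    have hbi : Integrable b := hFi.sub hgi
    have hbl : ∫⁻ x, ‖b x‖ₑ ≤ 2 * ∫⁻ x, u x := by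
      calc ∫⁻ x, ‖b x‖ₑ ≤ ∫⁻ x, (u x + ‖g x‖ₑ) := lintegral_mono fun x => enorm_sub_le
        _ = (∫⁻ x, u x) + ∫⁻ x, ‖g x‖ₑ := lintegral_add_left hmu _
        _ ≤ (∫⁻ x, u x) + ∫⁻ x, u x := by gcongr
        _ = _ := by ring
    set W : Set UnitAddCircle := ⋃ Q : S, star Q with hW
    have hmW : MeasurableSet W := MeasurableSet.iUnion fun Q : S => measurableSet_star Q
    have hbad : ∫⁻ x in Wᶜ, Sq φ b x ≤ 12 * C * omC * (2 * ∫⁻ x, u x) := by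
      refine (setLIntegral_Sq_le_of_cancel h hS hbi (fun x hx => ?_) fun Q hQ => ?_).trans ?_
      · rw [hb]; dsimp only; rw [hg, condMean_of_notMem F hx, sub_self]
      · rw [hb, integral_sub hFi.integrableOn hgi.integrableOn, setIntegral_condMean hS F hQ,
          sub_self]
      · gcongr
    have hgood : ∫⁻ x, Sq φ g x ^ 2 ≤ (1 + besselK C) * (2 * T * ∫⁻ x, u x) := by
      refine (lintegral_Sq_sq_le h hz hgm).trans ?_
      gcongr
      calc ∫⁻ x, ‖g x‖ₑ ^ 2 ≤ ∫⁻ x, 2 * T * condAvg S u x := by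
            apply lintegral_mono_ae
            filter_upwards [condAvg_le hmu hTt hfi] with x hx
            have h3 := enorm_condMean_le hS F x
            rw [sq]
            exact mul_le_mul' (h3.trans hx) h3
        _ = 2 * T * ∫⁻ x, u x := by
            rw [lintegral_const_mul _ (measurable_condAvg S hmu), lintegral_condAvg hS]
    have hsub : {x | T < Sq φ F x} ⊆
        W ∪ ({x | T ^ 2 ≤ 4 * Sq φ g x ^ 2} ∪ {x | T ≤ 2 * Wᶜ.indicator (Sq φ b) x}) := by
      intro x hx
      by_cases hc : x ∈ W
      · exact Or.inl hc
      refine Or.inr ?_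
      by_contra hcon
      simp only [Set.mem_union, Set.mem_ofPred_eq, not_or, not_le] at hcon
      obtain ⟨h1, h2⟩ := hcon
      rw [Set.indicator_of_mem (show x ∈ Wᶜ from hc)] at h2
      have h3 := Sq_sq_add_le h hgi hbi x
      have e : (fun y => g y + b y) = F := by ext y; simp [hb]
      rw [e] at h3
      have h4 : T ^ 2 < Sq φ F x ^ 2 := ENNReal.pow_lt_pow_left two_ne_zero hx
      have h5 : 4 * Sq φ b x ^ 2 ≤ T ^ 2 := by
        calc 4 * Sq φ b x ^ 2 = (2 * Sq φ b x) ^ 2 := by ring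
          _ ≤ T ^ 2 := by gcongr
      have h7 : 2 * Sq φ F x ^ 2 ≤ 2 * T ^ 2 := by
        calc 2 * Sq φ F x ^ 2 ≤ 2 * (2 * Sq φ g x ^ 2 + 2 * Sq φ b x ^ 2) := by gcongr
          _ = 4 * Sq φ g x ^ 2 + 4 * Sq φ b x ^ 2 := by ring
          _ ≤ T ^ 2 + T ^ 2 := add_le_add h1.le h5
          _ = _ := by ring
      exact absurd ((ENNReal.mul_le_mul_iff_right two_ne_zero (by norm_num)).1 h7) (not_le.2 h4)
    have h4 : T ^ 2 * volume {x | T ^ 2 ≤ 4 * Sq φ g x ^ 2} ≤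
        4 * ((1 + besselK C) * (2 * T * ∫⁻ x, u x)) := by
      refine (mul_meas_ge_le_lintegral (((measurable_Sq φ g).pow_const 2).const_mul 4) _).trans ?_
      rw [lintegral_const_mul _ ((measurable_Sq φ g).pow_const 2)]
      gcongr
    have h5 : T * volume {x | T ≤ 2 * Wᶜ.indicator (Sq φ b) x} ≤
        2 * (12 * C * omC * (2 * ∫⁻ x, u x)) := by
      have hm := (measurable_Sq φ b).indicator hmW.compl
      refine (mul_meas_ge_le_lintegral (hm.const_mul 2) _).trans ?_
      rw [lintegral_const_mul _ hm, lintegral_indicator hmW.compl]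
      gcongr
    calc T * volume {x | T < Sq φ F x}
        ≤ T * (volume W + (volume {x | T ^ 2 ≤ 4 * Sq φ g x ^ 2} +
            volume {x | T ≤ 2 * Wᶜ.indicator (Sq φ b) x})) := by
          gcongr
          refine (measure_mono hsub).trans ((measure_union_le _ _).trans ?_)
          gcongr
          exact measure_union_le _ _
      _ = T * volume W + (T⁻¹ * T * T * volume {x | T ^ 2 ≤ 4 * Sq φ g x ^ 2} +
            T * volume {x | T ≤ 2 * Wᶜ.indicator (Sq φ b) x}) := by
          rw [ENNReal.inv_mul_cancel hT0 hTt, one_mul, mul_add, mul_add]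
      _ = T * volume W + (T⁻¹ * (T ^ 2 * volume {x | T ^ 2 ≤ 4 * Sq φ g x ^ 2}) +
            T * volume {x | T ≤ 2 * Wᶜ.indicator (Sq φ b) x}) := by ring
      _ ≤ 4 * omC * (∫⁻ x, u x) + (T⁻¹ * (4 * ((1 + besselK C) * (2 * T * ∫⁻ x, u x))) +
            2 * (12 * C * omC * (2 * ∫⁻ x, u x))) :=
          add_le_add (mul_volume_iUnion_star_le u T) (add_le_add (mul_le_mul_right h4 _) h5)
      _ = 4 * omC * (∫⁻ x, u x) + ((T⁻¹ * T) * (8 * (1 + besselK C) * ∫⁻ x, u x) +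
            48 * C * omC * ∫⁻ x, u x) := by ring
      _ = (4 * omC + 8 * (1 + besselK C) + 48 * C * omC) * ∫⁻ x, u x := by
          rw [ENNReal.inv_mul_cancel hT0 hTt]; ring
      _ ≤ _ := by
          refine mul_le_mul_left ?_ _
          rw [sqW, add_assoc 1, add_assoc 1]
          exact le_add_self
  · calc T * volume {x | T < Sq φ F x} ≤ (∫⁻ x, u x) * 1 := by
          gcongr
          · exact (not_le.1 hfi).le
          · exact prob_le_one
      _ ≤ _ := by
          rw [mul_comm]
          refine mul_le_mul_left ?_ _
          rw [sqW, add_assoc, add_assoc]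
          exact le_self_add

/-- The distributional constant of the square function. -/
def sqA (C : ℝ≥0) : ℝ≥0∞ := 2 * sqW C + 4 * (1 + besselK C)

lemma sqA_ne_top (C : ℝ≥0) : sqA C ≠ ⊤ := by
  have h1 := omC_ne_top
  have h2 := besselK_ne_top C
  unfold sqA sqW
  finiteness

lemma weakDist_Sq [CompleteSpace E] (h : Good C φ) (hz : ZeroMean φ) {F : UnitAddCircle → E}
    (hF : StronglyMeasurable F) (hFi : Integrable F) :
    WeakDist volume (sqA C) (fun x => ‖F x‖ₑ) (Sq φ F) := by
  refine WeakDist.of_split fun t ht => ?_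
  set D := {x | ENNReal.ofReal t < ‖F x‖ₑ} with hD
  have hmD : MeasurableSet D := measurableSet_lt measurable_const hF.enorm
  have hDc : Dᶜ = {x | ‖F x‖ₑ ≤ ENNReal.ofReal t} := by ext; simp [hD]
  refine ⟨Sq φ (D.indicator F), Sq φ (Dᶜ.indicator F), measurable_Sq _ _, fun x => ?_,
    fun s hs => ?_, ?_⟩
  · have := Sq_sq_add_le h (hFi.indicator hmD) (hFi.indicator hmD.compl) x
    simpa only [Set.indicator_self_add_compl_apply] using this
  · refine (Sq_weak h hz (hF.indicator hmD) (hFi.indicator hmD) hs).trans_eq ?_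
    simp_rw [enorm_indicator_eq_indicator_enorm]
    rw [lintegral_indicator hmD]
  · refine (lintegral_Sq_sq_le h hz (hF.indicator hmD.compl).aestronglyMeasurable).trans_eq ?_
    rw [← hDc, ← lintegral_indicator hmD.compl]
    congr 2; ext x
    by_cases hx : x ∈ Dᶜ
    · simp only [Set.indicator_of_mem hx]
    · simp only [Set.indicator_of_notMem hx]; simp

end CalderonZygmund


/-! ### Carleson embedding and square functions for exponents above two -/

lemma lintegral_ite_le (v : ℝ≥0∞) :
    ∫⁻ t in Set.Ioi (0 : ℝ), (if ENNReal.ofReal t < v then 1 else 0) ≤ v := by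
  by_cases hv : v = ⊤
  · rw [hv]; exact le_top
  calc ∫⁻ t in Set.Ioi (0 : ℝ), (if ENNReal.ofReal t < v then 1 else 0)
      ≤ ∫⁻ t in Set.Ioi (0 : ℝ), (Set.Iio v.toReal).indicator 1 t := by
        apply setLIntegral_mono' measurableSet_Ioi
        intro t ht
        split_ifs with h
        · rw [Set.indicator_of_mem]
          · rfl
          · exact (ENNReal.ofReal_lt_iff_lt_toReal (le_of_lt ht) hv).1 h
        · exact zero_le
    _ = volume (Set.Ioo 0 v.toReal) := by
        rw [lintegral_indicator_one measurableSet_Iio, Measure.restrict_apply measurableSet_Iio,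
          Set.inter_comm, Set.Ioi_inter_Iio]
    _ = v := by rw [Real.volume_Ioo, sub_zero, ENNReal.ofReal_toReal hv]

lemma le_lintegral_ite (v : ℝ≥0∞) :
    v ≤ ∫⁻ t in Set.Ioi (0 : ℝ), (if ENNReal.ofReal t < v then 1 else 0) := by
  have h := rpow_le_lintegral one_pos v
  simpa using h

section Carleson

variable {C : ℝ≥0} {φ : DyadicInterval → UnitAddCircle → ℂ}
variable {E : Type*} [NormedAddCommGroup E] [InnerProductSpace ℂ E]

/-- The dyadic intervals contained in `Q`. -/
def inside (Q : DyadicInterval) : Set DyadicInterval := {J | cell J ⊆ cell Q ∧ Q.1 ≤ J.1}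

lemma len_le_of_level_le {Q J : DyadicInterval} (h : Q.1 ≤ J.1) : len J ≤ len Q := by
  unfold len
  have : (Q.1 : ℕ) ≤ J.1 := h
  gcongr
  norm_num

/-- Decay of `φ_J`, for `J` inside `Q`, away from `Q`. -/
lemma Good.enorm_le_om_mul (h : Good C φ) {Q J : DyadicInterval} (hJ : J ∈ inside Q)
    {x : UnitAddCircle} (hx : x ∉ star Q) :
    ‖φ J x‖ₑ ≤ 4 * C * om Q x * (rho Q J * om J x) := by
  have hlJ := len_pos J
  have hlQ := len_pos Q
  have hl := len_le_of_level_le hJ.2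
  have hWJ := one_le_dec J x
  have hWQ : 2 < dec Q x := not_le.1 hx
  obtain ⟨y, hy⟩ := cell_nonempty J
  have h1 : Metric.infDist x (arc Q) / len J ≤ dec J x := by
    apply len_div_le_dec (cell_subset_arc J hy)
    exact Metric.infDist_le_dist_of_mem (cell_subset_arc Q (hJ.1 hy))
  set r := len J / len Q with hr
  have hr0 : 0 < r := by positivity
  have hr1 : r ≤ 1 := (div_le_one hlQ).2 hl
  have h2 : Metric.infDist x (arc Q) / len J = (dec Q x - 1) / r := by
    rw [dec, hr]; field_simp; ring
  have h3 : dec Q x / 2 ≤ r * dec J x := by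
    rw [h2, div_le_iff₀ hr0] at h1
    linarith
  have h4 : 1 ≤ r * dec J x := by linarith
  have h5 : ‖φ J x‖ ≤ (4 * C) * (1 / dec Q x ^ 2) * (r * (1 / dec J x ^ 2)) := by
    refine (h.size J x).trans ?_
    have e : (4 * C) * (1 / dec Q x ^ 2) * (r * (1 / dec J x ^ 2)) =
        (4 * C * r) / (dec Q x ^ 2 * dec J x ^ 2) := by ring
    rw [e, div_le_div_iff₀ (by positivity) (by positivity)]
    have h6 : dec Q x ^ 2 ≤ 4 * (r * dec J x) ^ 2 := by nlinarith
    -- Of the five powers of decay, two pay for `om Q` and leave `r ^ 2`, of which one factor `r` is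
    -- enough for `rho Q J`; two further powers form `om J`.
    have h7 : dec Q x ^ 2 ≤ 4 * r * dec J x ^ 3 := by
      calc dec Q x ^ 2 ≤ 4 * (r * dec J x) ^ 2 := h6
        _ = 4 * r * dec J x ^ 2 * r := by ring
        _ ≤ 4 * r * dec J x ^ 2 * dec J x := by gcongr; linarith
        _ = _ := by ring
    calc C * (dec Q x ^ 2 * dec J x ^ 2) ≤ C * ((4 * r * dec J x ^ 3) * dec J x ^ 2) := by
          gcongr
      _ = _ := by ring
  refine (enorm_le_of_norm_le h5).trans_eq ?_
  have hrho : rho Q J = ENNReal.ofReal r := by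
    rw [rho, min_eq_right]
    rw [div_le_div_iff₀ hlQ hlJ]
    nlinarith
  rw [ENNReal.ofReal_mul (by positivity), ENNReal.ofReal_mul (by positivity),
    ENNReal.ofReal_mul (by positivity), ENNReal.ofReal_mul hr0.le, ← hrho, ← om, ← om,
    ENNReal.ofReal_coe_nnreal]
  simp

lemma lintegral_mul_sq_le {X : Type*} [MeasurableSpace X] {μ : Measure X} {a b : X → ℝ≥0∞}
    (ha : AEMeasurable a μ) (hb : AEMeasurable b μ) :
    (∫⁻ x, a x * b x ∂μ) ^ 2 ≤ (∫⁻ x, a x ∂μ) * ∫⁻ x, a x * b x ^ 2 ∂μ := by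
  have h := ENNReal.lintegral_mul_le_Lp_mul_Lq μ Real.HolderConjugate.two_two
    (f := fun x => a x ^ (1 / 2 : ℝ)) (g := fun x => a x ^ (1 / 2 : ℝ) * b x)
    (ha.pow_const _) ((ha.pow_const _).mul hb)
  simp only [Pi.mul_apply, ENNReal.rpow_ofNat, mul_pow, rpow_half_sq] at h
  have e : ∀ x, a x ^ (1 / 2 : ℝ) * (a x ^ (1 / 2 : ℝ) * b x) = a x * b x := by
    intro x
    rw [← mul_assoc, ← sq, rpow_half_sq]
  simp_rw [e] at h
  calc (∫⁻ x, a x * b x ∂μ) ^ 2 ≤ _ := pow_le_pow_left' h 2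
    _ = _ := by rw [mul_pow, rpow_half_sq, rpow_half_sq]

/-- The constant in the Carleson estimate. -/
def carlesonK (C : ℝ≥0) : ℝ≥0∞ := 2 * (4 * (1 + besselK C)) + 2 * (12 * C ^ 2 * omC ^ 2)

lemma carlesonK_ne_top (C : ℝ≥0) : carlesonK C ≠ ⊤ := by
  have h1 := omC_ne_top
  have h2 := besselK_ne_top C
  unfold carlesonK
  finiteness

/-- Cauchy–Schwarz with respect to `‖φ J‖` costs a mass of order `elen J`, which cancels the
normalization. Off `star Q` the remaining factor decays in the position relative to `Q` and in the
scale, and the sum over `J` converges without cancellation. -/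
lemma tsum_inside_far_le (h : Good C φ) {F : UnitAddCircle → E} (hF : AEStronglyMeasurable F)
    (Q : DyadicInterval) (hF0 : ∀ x ∈ star Q, F x = 0) :
    ∑' J : inside Q, (elen J)⁻¹ * ‖∫ y, φ J y • F y‖ₑ ^ 2 ≤
      12 * C ^ 2 * omC ^ 2 * ∫⁻ x, om Q x * ‖F x‖ₑ ^ 2 := by
  have hmF : AEMeasurable (fun x => ‖F x‖ₑ) := hF.enorm
  have h1 : ∀ J : inside Q, (elen J)⁻¹ * ‖∫ y, φ J y • F y‖ₑ ^ 2 ≤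
      C * omC * ∫⁻ x, 4 * C * (rho Q J * om J x) * (om Q x * ‖F x‖ₑ ^ 2) := by
    intro J
    have hm : AEMeasurable (fun x => ‖φ J x‖ₑ) := (h.aestronglyMeasurable J _).enorm
    have h2 : ‖∫ y, φ J y • F y‖ₑ ^ 2 ≤
        (C * (omC * elen J)) * ∫⁻ x, 4 * C * (rho Q J * om J x) * (om Q x * ‖F x‖ₑ ^ 2) := by
      calc ‖∫ y, φ J y • F y‖ₑ ^ 2 ≤ (∫⁻ y, ‖φ J y‖ₑ * ‖F y‖ₑ) ^ 2 := by
            gcongr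
            simp_rw [← enorm_smul]
            exact enorm_integral_le_lintegral_enorm _
        _ ≤ (∫⁻ y, ‖φ J y‖ₑ) * ∫⁻ y, ‖φ J y‖ₑ * ‖F y‖ₑ ^ 2 := lintegral_mul_sq_le hm hmF
        _ ≤ _ := by
            refine mul_le_mul' ?_ (lintegral_mono fun x => ?_)
            · calc ∫⁻ y, ‖φ J y‖ₑ ≤ ∫⁻ y, C * om J y := lintegral_mono fun y => h.enorm_le J y
                _ = C * ∫⁻ y, om J y := lintegral_const_mul _ (measurable_om _)
                _ ≤ _ := by gcongr; exact lintegral_om_le _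
            · dsimp only
              by_cases hx : x ∈ star Q
              · simp [hF0 x hx]
              · refine (mul_le_mul_left (h.enorm_le_om_mul J.2 hx) _).trans_eq ?_
                ring
    calc (elen J)⁻¹ * ‖∫ y, φ J y • F y‖ₑ ^ 2 ≤ (elen J)⁻¹ * ((C * (omC * elen J)) *
          ∫⁻ x, 4 * C * (rho Q J * om J x) * (om Q x * ‖F x‖ₑ ^ 2)) := by gcongr
      _ = ((elen J)⁻¹ * elen J) * (C * omC *
          ∫⁻ x, 4 * C * (rho Q J * om J x) * (om Q x * ‖F x‖ₑ ^ 2)) := by ring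
      _ = _ := by rw [elen_inv_mul, one_mul]
  have hmo := measurable_om Q
  calc ∑' J : inside Q, (elen J)⁻¹ * ‖∫ y, φ J y • F y‖ₑ ^ 2
      ≤ ∑' J : inside Q, C * omC * ∫⁻ x, 4 * C * (rho Q J * om J x) * (om Q x * ‖F x‖ₑ ^ 2) :=
        ENNReal.tsum_le_tsum h1
    _ ≤ ∑' J, C * omC * ∫⁻ x, 4 * C * (rho Q J * om J x) * (om Q x * ‖F x‖ₑ ^ 2) :=
        ENNReal.tsum_comp_le_tsum_of_injective Subtype.val_injective fun J =>
          C * omC * ∫⁻ x, 4 * C * (rho Q J * om J x) * (om Q x * ‖F x‖ₑ ^ 2)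
    _ = C * omC * ∫⁻ x, ∑' J, 4 * C * (rho Q J * om J x) * (om Q x * ‖F x‖ₑ ^ 2) := by
        rw [ENNReal.tsum_mul_left, lintegral_tsum fun J => ?_]
        have := measurable_om J
        fun_prop
    _ ≤ C * omC * ∫⁻ x, 4 * C * (3 * omC) * (om Q x * ‖F x‖ₑ ^ 2) := by
        gcongr with x
        rw [ENNReal.tsum_mul_right, ENNReal.tsum_mul_left]
        refine mul_le_mul_left (mul_le_mul_right ?_ _) _
        exact tsum_rho_mul_om_le Q x
    _ = _ := by
        rw [lintegral_const_mul'' _ (by fun_prop)]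
        ring

/-- The Carleson estimate for the coefficients. -/
lemma tsum_inside_le [CompleteSpace E] (h : Good C φ) (hz : ZeroMean φ) {F : UnitAddCircle → E}
    (hFi : Integrable F) (Q : DyadicInterval) :
    ∑' J : inside Q, (elen J)⁻¹ * ‖∫ y, φ J y • F y‖ₑ ^ 2 ≤
      carlesonK C * ∫⁻ x, om Q x * ‖F x‖ₑ ^ 2 := by
  have hms := measurableSet_star Q
  set F₁ := (star Q).indicator F with hF₁
  set F₂ := (star Q)ᶜ.indicator F with hF₂
  have hi1 : Integrable F₁ := hFi.indicator hms
  have hi2 : Integrable F₂ := hFi.indicator hms.compl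
  have hsplit : ∀ J, ‖∫ y, φ J y • F y‖ₑ ^ 2 ≤
      2 * ‖∫ y, φ J y • F₁ y‖ₑ ^ 2 + 2 * ‖∫ y, φ J y • F₂ y‖ₑ ^ 2 := by
    intro J
    have e : ∫ y, φ J y • F y = (∫ y, φ J y • F₁ y) + ∫ y, φ J y • F₂ y := by
      rw [← integral_add (h.integrable_smul J hi1) (h.integrable_smul J hi2)]
      simp_rw [← smul_add, hF₁, hF₂, Set.indicator_self_add_compl_apply]
    rw [e]
    refine le_trans ?_ (two_mul_sq_add_le _ _)
    gcongr
    exact enorm_add_le _ _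
  have hnear : ∑' J : inside Q, (elen J)⁻¹ * ‖∫ y, φ J y • F₁ y‖ₑ ^ 2 ≤
      4 * (1 + besselK C) * ∫⁻ x, om Q x * ‖F x‖ₑ ^ 2 := by
    calc ∑' J : inside Q, (elen J)⁻¹ * ‖∫ y, φ J y • F₁ y‖ₑ ^ 2
        ≤ ∑' J, (elen J)⁻¹ * ‖∫ y, φ J y • F₁ y‖ₑ ^ 2 :=
          ENNReal.tsum_comp_le_tsum_of_injective Subtype.val_injective fun J =>
            (elen J)⁻¹ * ‖∫ y, φ J y • F₁ y‖ₑ ^ 2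
      _ ≤ (1 + besselK C) * ∫⁻ x, ‖F₁ x‖ₑ ^ 2 := by
          rw [← lintegral_Sq_sq]
          exact lintegral_Sq_sq_le h hz hi1.aestronglyMeasurable
      _ = (1 + besselK C) * ∫⁻ x in star Q, ‖F x‖ₑ ^ 2 := by
          rw [← lintegral_indicator hms]
          congr 2; ext x
          by_cases hx : x ∈ star Q
          · simp only [hF₁, Set.indicator_of_mem hx]
          · simp only [hF₁, Set.indicator_of_notMem hx]; simp
      _ ≤ (1 + besselK C) * (4 * ∫⁻ x, om Q x * ‖F x‖ₑ ^ 2) := by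
          gcongr
          exact setLIntegral_star_le Q _
      _ = _ := by ring
  have hfar : ∑' J : inside Q, (elen J)⁻¹ * ‖∫ y, φ J y • F₂ y‖ₑ ^ 2 ≤
      12 * C ^ 2 * omC ^ 2 * ∫⁻ x, om Q x * ‖F x‖ₑ ^ 2 := by
    refine (tsum_inside_far_le h hi2.aestronglyMeasurable Q fun x hx => ?_).trans ?_
    · exact Set.indicator_of_notMem (Set.notMem_compl_iff.2 hx) _
    · gcongr with x
      rw [hF₂, enorm_indicator_eq_indicator_enorm]
      exact Set.indicator_le_self _ _ _
  calc ∑' J : inside Q, (elen J)⁻¹ * ‖∫ y, φ J y • F y‖ₑ ^ 2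
      ≤ ∑' J : inside Q, (2 * ((elen J)⁻¹ * ‖∫ y, φ J y • F₁ y‖ₑ ^ 2) +
          2 * ((elen J)⁻¹ * ‖∫ y, φ J y • F₂ y‖ₑ ^ 2)) := by
        refine ENNReal.tsum_le_tsum fun J => ?_
        refine (mul_le_mul_right (hsplit J) _).trans_eq ?_
        ring
    _ = 2 * (∑' J : inside Q, (elen J)⁻¹ * ‖∫ y, φ J y • F₁ y‖ₑ ^ 2) +
          2 * ∑' J : inside Q, (elen J)⁻¹ * ‖∫ y, φ J y • F₂ y‖ₑ ^ 2 := by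
        rw [ENNReal.summable.tsum_add ENNReal.summable, ENNReal.tsum_mul_left,
          ENNReal.tsum_mul_left]
    _ ≤ 2 * (4 * (1 + besselK C) * ∫⁻ x, om Q x * ‖F x‖ₑ ^ 2) +
          2 * (12 * C ^ 2 * omC ^ 2 * ∫⁻ x, om Q x * ‖F x‖ₑ ^ 2) := by gcongr
    _ = _ := by rw [carlesonK]; ring

lemma lintegral_om_mul_le_setLIntegral_Mx (f : UnitAddCircle → ℝ≥0∞) (Q : DyadicInterval) :
    ∫⁻ x, om Q x * f x ≤ ∫⁻ x in cell Q, Mx f x := by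
  calc ∫⁻ x, om Q x * f x = ∫⁻ _ in cell Q, (elen Q)⁻¹ * ∫⁻ x, om Q x * f x := by
        rw [setLIntegral_const, volume_cell, mul_comm, ← mul_assoc, elen_mul_inv, one_mul]
    _ ≤ _ := setLIntegral_mono' (measurableSet_cell Q) fun x hx =>
        le_Mx f (cell_subset_arc Q hx)

/-- A Carleson sequence is dominated by maximal functions. -/
lemma tsum_mul_avg_le {a : DyadicInterval → ℝ≥0∞} {f w : UnitAddCircle → ℝ≥0∞} {D : ℝ≥0∞}
    (h : ∀ Q, ∑' J : inside Q, a J ≤ D * ∫⁻ x, om Q x * f x) :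
    ∑' J, a J * avg w J ≤ D * ∫⁻ x, Mx f x * Mx w x := by
  -- The intervals where the mean of `w` exceeds `t` lie inside the stopping intervals at that
  -- height, where the Carleson hypothesis applies. The stopping cells are disjoint and contained in
  -- `{Mx w > t}`; integrating over `t` gives the claim.
  have hlevel : ∀ t : ℝ, ∑' J, a J * (if ENNReal.ofReal t < avg w J then 1 else 0) ≤
      D * ∫⁻ x, Mx f x * (if ENNReal.ofReal t < Mx w x then 1 else 0) := by
    intro t
    set S := stopping (avg w) (ENNReal.ofReal t) with hS
    have hS' : DisjointCells S := disjointCells_stopping _ _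
    calc ∑' J, a J * (if ENNReal.ofReal t < avg w J then 1 else 0)
        ≤ ∑' J, ∑' Q : S, (inside Q).indicator a J := by
          refine ENNReal.tsum_le_tsum fun J => ?_
          split_ifs with hJ
          · obtain ⟨Q, hQ, h1, h2⟩ := exists_stopping hJ
            refine le_trans ?_ (ENNReal.le_tsum (⟨Q, hQ⟩ : S))
            rw [Set.indicator_of_mem (show J ∈ inside Q from ⟨h1, h2⟩), mul_one]
          · simp
      _ = ∑' Q : S, ∑' J, (inside Q).indicator a J := ENNReal.tsum_comm
      _ = ∑' Q : S, ∑' J : inside Q, a J := by simp_rw [tsum_subtype]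
      _ ≤ ∑' Q : S, D * ∫⁻ x in cell Q, Mx f x := by
          refine ENNReal.tsum_le_tsum fun Q => (h Q).trans ?_
          exact mul_le_mul_right (lintegral_om_mul_le_setLIntegral_Mx f Q) _
      _ = D * ∫⁻ x in cover S, Mx f x := by rw [ENNReal.tsum_mul_left, hS'.lintegral_cover]
      _ ≤ _ := by
          refine mul_le_mul_right ?_ _
          rw [← lintegral_indicator (measurableSet_cover S)]
          apply lintegral_mono
          intro x
          dsimp only
          by_cases hx : x ∈ cover S
          · obtain ⟨Q, hQ, hxQ⟩ := mem_cover.1 hx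
            rw [Set.indicator_of_mem hx, if_pos (hQ.1.trans_le (avg_le_Mx w hxQ)), mul_one]
          · rw [Set.indicator_of_notMem hx]; exact zero_le
  have hm : ∀ v : ℝ≥0∞, Measurable fun t : ℝ => if ENNReal.ofReal t < v then (1 : ℝ≥0∞) else 0 :=
    fun v => Measurable.ite (measurableSet_lt ENNReal.measurable_ofReal measurable_const)
      measurable_const measurable_const
  have hm2 : Measurable fun p : ℝ × UnitAddCircle =>
      Mx f p.2 * if ENNReal.ofReal p.1 < Mx w p.2 then (1 : ℝ≥0∞) else 0 := by
    refine ((measurable_Mx f).comp measurable_snd).mul (Measurable.ite (measurableSet_lt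
      (ENNReal.measurable_ofReal.comp measurable_fst) ((measurable_Mx w).comp measurable_snd))
      measurable_const measurable_const)
  calc ∑' J, a J * avg w J
      ≤ ∑' J, a J * ∫⁻ t in Set.Ioi (0 : ℝ), (if ENNReal.ofReal t < avg w J then 1 else 0) := by
        gcongr with J
        exact le_lintegral_ite _
    _ = ∫⁻ t in Set.Ioi (0 : ℝ), ∑' J, a J * (if ENNReal.ofReal t < avg w J then 1 else 0) := by
        rw [lintegral_tsum fun J => ((hm _).const_mul _).aemeasurable]
        simp_rw [lintegral_const_mul _ (hm _)]
    _ ≤ ∫⁻ t in Set.Ioi (0 : ℝ), D * ∫⁻ x, Mx f x * (if ENNReal.ofReal t < Mx w x then 1 else 0) :=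
        lintegral_mono hlevel
    _ = D * ∫⁻ x, ∫⁻ t in Set.Ioi (0 : ℝ),
          Mx f x * (if ENNReal.ofReal t < Mx w x then 1 else 0) := by
        rw [lintegral_const_mul _ hm2.lintegral_prod_right', lintegral_lintegral_swap]
        exact hm2.aemeasurable
    _ ≤ _ := by
        gcongr with x
        rw [lintegral_const_mul _ (hm _)]
        gcongr
        exact lintegral_ite_le _

/-- The strong constants of the square function. -/
def sqS (C : ℝ≥0) : ℝ → ℝ≥0∞ := strongK (sqA C) (1 + besselK C) (carlesonK C) maxK

lemma sqS_ne_top (C : ℝ≥0) (p : ℝ) : sqS C p ≠ ⊤ :=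
  strongK_ne_top (sqA_ne_top C) (ENNReal.add_ne_top.2 ⟨by simp, besselK_ne_top C⟩)
    (carlesonK_ne_top C) maxK_ne_top p

/-- The vector-valued square function is controlled. -/
lemma controlled_Sq [CompleteSpace E] (h : Good C φ) (hz : ZeroMean φ) {F : UnitAddCircle → E}
    (hF : StronglyMeasurable F) (hFi : Integrable F) :
    Controlled volume (sqA C) (sqS C) (fun x => ‖F x‖ₑ) (Sq φ F) := by
  -- The embedding leaves a maximal function on `‖F‖²` as well as on the weight; `Mx` is bounded on
  -- every `L^q` with `q > 1`, which is what the duality step requires.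
  refine Controlled.of_weighted (b := Mx fun x => ‖F x‖ₑ ^ 2) (sqA_ne_top C) hF.enorm
    (measurable_Sq φ F) (measurable_Mx _) (weakDist_Sq h hz hF hFi)
    (lintegral_Sq_sq_le h hz hFi.aestronglyMeasurable) (fun w hw => ?_) fun q hq =>
    lintegral_Mx_rpow_le hq (hF.enorm.pow_const 2)
  rw [lintegral_Sq_sq_mul φ F hw]
  exact tsum_mul_avg_le (tsum_inside_le h hz hFi)

end Carleson


/-! ### Stability of controlled pairs -/

section Transfer

variable {α β : Type*} [MeasurableSpace α] [MeasurableSpace β]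

/-- The integrand is the function of `u` equal to `u²/t` up to `t` and to `u` beyond. It is
increasing, so the right side of `WeakDist` is monotone in `u` although its separate terms are not.
-/
lemma lintegral_dist_eq {μ : Measure α} {u : α → ℝ≥0∞} (hu : Measurable u) {t : ℝ} (ht : 0 < t) :
    ∫⁻ x in {x | ENNReal.ofReal t < u x}, u x ∂μ +
      (ENNReal.ofReal t)⁻¹ * ∫⁻ x in {x | u x ≤ ENNReal.ofReal t}, u x ^ 2 ∂μ =
    ∫⁻ x, (if ENNReal.ofReal t < u x then u x else (ENNReal.ofReal t)⁻¹ * u x ^ 2) ∂μ := by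
  have hm : MeasurableSet {x | ENNReal.ofReal t < u x} := measurableSet_lt measurable_const hu
  have hc : {x | ENNReal.ofReal t < u x}ᶜ = {x | u x ≤ ENNReal.ofReal t} := by ext; simp
  rw [← lintegral_add_compl (fun x => if ENNReal.ofReal t < u x then u x else
    (ENNReal.ofReal t)⁻¹ * u x ^ 2) hm, hc, ← lintegral_const_mul' _ _ (by simpa using ht)]
  congr 1
  · apply setLIntegral_congr_fun hm
    intro x hx
    exact (if_pos hx).symm
  · apply setLIntegral_congr_fun (measurableSet_le hu measurable_const)
    intro x hx
    exact (if_neg (not_lt.2 hx)).symm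

lemma WeakDist.mono_left {μ : Measure α} {A : ℝ≥0∞} {u u' v : α → ℝ≥0∞} (hu : Measurable u)
    (hu' : Measurable u') (hle : ∀ x, u x ≤ u' x) (h : WeakDist μ A u v) :
    WeakDist μ A u' v := by
  intro t ht
  refine (h t ht).trans ?_
  rw [lintegral_dist_eq hu ht, lintegral_dist_eq hu' ht]
  refine mul_le_mul_right (lintegral_mono fun x => ?_) _
  dsimp only
  have hT0 : ENNReal.ofReal t ≠ 0 := by simpa using ht
  split_ifs with h1 h2 h2
  · exact hle x
  · exact absurd (h1.trans_le (hle x)) h2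
  · calc (ENNReal.ofReal t)⁻¹ * u x ^ 2 ≤ (ENNReal.ofReal t)⁻¹ * (ENNReal.ofReal t * u x) := by
          rw [sq]
          gcongr
          exact not_lt.1 h1
      _ = u x := by
          rw [← mul_assoc, ENNReal.inv_mul_cancel hT0 ENNReal.ofReal_ne_top, one_mul]
      _ ≤ u' x := hle x
  · gcongr
    exact hle x

lemma Controlled.mono_left {μ : Measure α} {A : ℝ≥0∞} {K : ℝ → ℝ≥0∞} {u u' v : α → ℝ≥0∞}
    (hu : Measurable u) (hu' : Measurable u') (hle : ∀ x, u x ≤ u' x) (h : Controlled μ A K u v) :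
    Controlled μ A K u' v := by
  refine ⟨h.dist.mono_left hu hu' hle, fun p hp => (h.strong p hp).trans ?_⟩
  gcongr
  exact hle _

/-- Control passes to directed suprema. -/
lemma Controlled.iSup {ι : Type*} [Countable ι] [Nonempty ι] {μ : Measure α} {A : ℝ≥0∞}
    {K : ℝ → ℝ≥0∞} {u : α → ℝ≥0∞} {v : ι → α → ℝ≥0∞} (hv : ∀ i, Measurable (v i))
    (hd : Directed (· ≤ ·) v) (h : ∀ i, Controlled μ A K u (v i)) :
    Controlled μ A K u (fun x => ⨆ i, v i x) := by
  constructor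
  · intro t ht
    have e : {x | ENNReal.ofReal t < ⨆ i, v i x} = ⋃ i, {x | ENNReal.ofReal t < v i x} := by
      ext x; simp [lt_iSup_iff]
    rw [e, Directed.measure_iUnion, ENNReal.mul_iSup]
    · exact iSup_le fun i => (h i).dist t ht
    · intro i j
      obtain ⟨k, h1, h2⟩ := hd i j
      exact ⟨k, fun x hx => lt_of_lt_of_le hx (h1 x), fun x hx => lt_of_lt_of_le hx (h2 x)⟩
  · intro p hp
    have e : ∀ x, (⨆ i, v i x) ^ p = ⨆ i, v i x ^ p := fun x =>
      (ENNReal.orderIsoRpow p (by linarith)).map_iSup _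
    simp_rw [e]
    rw [lintegral_iSup_directed fun i => ((hv i).pow_const p).aemeasurable]
    · exact iSup_le fun i => (h i).strong p hp
    · intro i j
      obtain ⟨k, h1, h2⟩ := hd i j
      exact ⟨k, fun x => ENNReal.rpow_le_rpow (h1 x) (by linarith),
        fun x => ENNReal.rpow_le_rpow (h2 x) (by linarith)⟩

lemma Controlled.comp {μ : Measure α} {ν : Measure β} {A : ℝ≥0∞} {K : ℝ → ℝ≥0∞}
    {u v : β → ℝ≥0∞} (hu : Measurable u) (hv : Measurable v) (h : Controlled ν A K u v)
    {e : α → β} (he : MeasurePreserving e μ ν) : Controlled μ A K (u ∘ e) (v ∘ e) := by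
  constructor
  · intro t ht
    have h1 := h.dist t ht
    rw [lintegral_dist_eq hu ht] at h1
    rw [lintegral_dist_eq (hu.comp he.measurable) ht]
    rw [← he.measure_preimage (measurableSet_lt measurable_const hv).nullMeasurableSet,
      ← he.lintegral_comp (Measurable.ite (measurableSet_lt measurable_const hu) hu
        ((hu.pow_const 2).const_mul _))] at h1
    exact h1
  · intro p hp
    have h1 := h.strong p hp
    rw [← he.lintegral_comp (hv.pow_const p), ← he.lintegral_comp (hu.pow_const p)] at h1
    exact h1

lemma Controlled.prod_left {μ : Measure α} {ν : Measure β} [SFinite μ] [SFinite ν] {A : ℝ≥0∞}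
    {K : ℝ → ℝ≥0∞} (hA : A ≠ ⊤) (hK : ∀ p, 1 < p → K p ≠ ⊤) {u v : α × β → ℝ≥0∞} (hu : Measurable u)
    (hv : Measurable v)
    (h : ∀ᵐ y ∂ν, Controlled μ A K (fun x => u (x, y)) (fun x => v (x, y))) :
    Controlled (μ.prod ν) A K u v := by
  have h1 : Controlled (ν.prod μ) A K (u ∘ Prod.swap) (v ∘ Prod.swap) :=
    Controlled.prod hA hK (hu.comp measurable_swap) (hv.comp measurable_swap) h
  have h2 := h1.comp (hu.comp measurable_swap) (hv.comp measurable_swap)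
    (Measure.measurePreserving_swap (μ := μ) (ν := ν))
  exact h2

end Transfer

/-! ### Composition of two controlled operators -/

section Admissible

lemma LlogLNorm_congr {X : Type*} [MeasurableSpace X] {μ : Measure X} {f g : X → ℂ} (h : f =ᵐ[μ] g) :
    LlogLNorm μ f = LlogLNorm μ g := by
  have e : ∀ l : ℝ≥0, μ {x | (l : ℝ) < ‖f x‖} = μ {x | (l : ℝ) < ‖g x‖} := by
    intro l
    apply measure_congr
    filter_upwards [h] with x hx
    exact congrArg (fun z : ℂ => (l : ℝ) < ‖z‖) hx
  unfold LlogLNorm rearr2 rearr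
  simp_rw [e]

/-- A square or maximal operator that is dominated by two successive one-parameter operators. -/
structure Admissible (c A₁ A₂ : ℝ≥0∞) (K₁ K₂ : ℝ → ℝ≥0∞) (T : (Torus2 → ℂ) → Torus2 → ℝ≥0∞) :
    Prop where
  congr : ∀ f g : Torus2 → ℂ, f =ᵐ[volume] g → T f = T g
  measurable : ∀ f, Measurable (T f)
  dominated : ∀ f : Torus2 → ℂ, Measurable f → Integrable f → ∃ v₁ v₂ : Torus2 → ℝ≥0∞,
    Measurable v₁ ∧ Measurable v₂ ∧ Controlled volume A₁ K₁ (fun z => ‖f z‖ₑ) v₁ ∧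
      Controlled volume A₂ K₂ v₁ v₂ ∧ ∀ z, T f z ≤ c * v₂ z

variable {c A₁ A₂ : ℝ≥0∞} {K₁ K₂ : ℝ → ℝ≥0∞} {T : (Torus2 → ℂ) → Torus2 → ℝ≥0∞}

instance : IsProbabilityMeasure (volume : Measure Torus2) := by
  rw [Measure.volume_eq_prod]; infer_instance

lemma Admissible.boundedLp (h : Admissible c A₁ A₂ K₁ K₂ T) {p : ℝ≥0∞} (hp : 1 < p) (hp' : p ≠ ⊤)
    {K : ℝ≥0} (hK : (c ^ p.toReal * (K₂ p.toReal * K₁ p.toReal)) ^ (1 / p.toReal) ≤ K) :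
    BoundedLp p K T := by
  intro f hf
  set g := hf.1.mk f with hg
  have hfg : f =ᵐ[volume] g := hf.1.ae_eq_mk
  have hgm : Measurable g := hf.1.stronglyMeasurable_mk.measurable
  have hgp : MemLp g p := (memLp_congr_ae hfg).1 hf
  have hp0 : p ≠ 0 := (one_pos.trans hp).ne'
  have hr : 1 < p.toReal := by
    rw [← ENNReal.toReal_one]; exact (ENNReal.toReal_lt_toReal (by simp) hp').2 hp
  have hr0 : 0 < p.toReal := by linarith
  obtain ⟨v₁, v₂, hm1, hm2, h1, h2, h3⟩ := h.dominated g hgm (hgp.integrable hp.le)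
  have key : eLpNorm (T f) p volume ≤ K * eLpNorm f p volume := by
    rw [h.congr f g hfg, eLpNorm_congr_ae hfg, eLpNorm_eq_lintegral_rpow_enorm_toReal hp0 hp',
      eLpNorm_eq_lintegral_rpow_enorm_toReal hp0 hp']
    simp only [enorm_eq_self]
    refine le_trans ?_ (mul_le_mul_left hK _)
    rw [← ENNReal.mul_rpow_of_nonneg _ _ (by positivity)]
    refine ENNReal.rpow_le_rpow ?_ (by positivity)
    calc ∫⁻ z, T g z ^ p.toReal ≤ ∫⁻ z, c ^ p.toReal * v₂ z ^ p.toReal := by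
          apply lintegral_mono
          intro z
          dsimp only
          rw [← ENNReal.mul_rpow_of_nonneg _ _ hr0.le]
          exact ENNReal.rpow_le_rpow (h3 z) hr0.le
      _ = c ^ p.toReal * ∫⁻ z, v₂ z ^ p.toReal := lintegral_const_mul _ (hm2.pow_const _)
      _ ≤ c ^ p.toReal * (K₂ p.toReal * (K₁ p.toReal * ∫⁻ z, ‖g z‖ₑ ^ p.toReal)) := by
          refine mul_le_mul_right ((h2.strong _ hr).trans ?_) _
          exact mul_le_mul_right (h1.strong _ hr) _
      _ = _ := by ring
  exact ⟨⟨(h.measurable f).aestronglyMeasurable,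
    key.trans_lt (ENNReal.mul_lt_top ENNReal.coe_lt_top hf.2)⟩, key⟩

/-- The first operator is used from `L log L` to `L¹`, the second from `L¹` to weak `L¹`. The factor
`c + 1` replaces `c` so that the height can be divided by it even when `c` is zero. -/
lemma Admissible.boundedLlogL (h : Admissible c A₁ A₂ K₁ K₂ T) (hA : A₁ ≠ ⊤) (hc : c ≠ ⊤)
    {K : ℝ≥0} (hK : (c + 1) * (A₂ * (1 + 2 * A₁)) ≤ K) : BoundedLlogLWeakL1 K T := by
  intro f hf
  refine ⟨(h.measurable f).aemeasurable, ?_⟩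
  set g := hf.1.mk f with hg
  have hfg : f =ᵐ[volume] g := hf.1.ae_eq_mk
  have hgm : Measurable g := hf.1.stronglyMeasurable_mk.measurable
  have hN : LlogLNorm volume f = LlogLNorm volume g := LlogLNorm_congr hfg
  have hgi : Integrable g := ⟨hgm.aestronglyMeasurable,
    (lintegral_enorm_le_LlogLNorm hgm).trans_lt (hN ▸ hf.2)⟩
  obtain ⟨v₁, v₂, hm1, hm2, h1, h2, h3⟩ := h.dominated g hgm hgi
  rw [h.congr f g hfg, hN]
  refine iSup₂_le fun l hl => ?_
  have hc0 : c + 1 ≠ 0 := by simp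
  have hct : c + 1 ≠ ⊤ := by simp [hc]
  set s : ℝ≥0∞ := l / (c + 1) with hs
  have hst : s ≠ ⊤ := ENNReal.div_ne_top (by simp) hc0
  have hs0 : s ≠ 0 := (ENNReal.div_pos (by simpa using hl.ne') hct).ne'
  have hls : (l : ℝ≥0∞) = (c + 1) * s := by
    rw [hs, ENNReal.mul_div_cancel hc0 hct]
  have hw := h2.dist.weak hm1 (t := s.toReal) (ENNReal.toReal_pos hs0 hst)
  rw [ENNReal.ofReal_toReal hst] at hw
  calc (l : ℝ≥0∞) * volume {z | (l : ℝ≥0∞) < T g z}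
      ≤ (c + 1) * s * volume {z | s < v₂ z} := by
        rw [← hls]
        refine mul_le_mul_right (measure_mono fun z hz => ?_) _
        have h4 : (c + 1) * s < (c + 1) * v₂ z := by
          rw [← hls]
          refine lt_of_lt_of_le hz ((h3 z).trans ?_)
          gcongr
          exact le_self_add
        exact lt_of_mul_lt_mul_left' h4
    _ = (c + 1) * (s * volume {z | s < v₂ z}) := by ring
    _ ≤ (c + 1) * (A₂ * ((1 + 2 * A₁) * LlogLNorm volume g)) := by
        refine mul_le_mul_right (hw.trans ?_) _
        exact mul_le_mul_right (h1.dist.lintegral_le hgm hm1 hA) _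
    _ = (c + 1) * (A₂ * (1 + 2 * A₁)) * LlogLNorm volume g := by ring
    _ ≤ _ := mul_le_mul_left hK _

end Admissible


/-! ### Coefficients and slices -/

lemma coeff_congr (φ₁ φ₂ : DyadicInterval → UnitAddCircle → ℂ) {f g : Torus2 → ℂ}
    (h : f =ᵐ[volume] g) : coeff φ₁ φ₂ f = coeff φ₁ φ₂ g := by
  funext I J
  apply integral_congr_ae
  filter_upwards [h] with z hz
  rw [hz]

/-- The coefficients of the slices in the second variable. -/
def coeffY (φ₂ : DyadicInterval → UnitAddCircle → ℂ) (f : Torus2 → ℂ) (J : DyadicInterval)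
    (x : UnitAddCircle) : ℂ := ∫ y, φ₂ J y * conj (f (x, y))

/-- The coefficients of the slices in the first variable. -/
def coeffX (φ₁ : DyadicInterval → UnitAddCircle → ℂ) (f : Torus2 → ℂ) (I : DyadicInterval)
    (y : UnitAddCircle) : ℂ := ∫ x, φ₁ I x * conj (f (x, y))

/-- The size of a coefficient, normalized in `L¹`. -/
def mass (φ₁ φ₂ : DyadicInterval → UnitAddCircle → ℂ) (f : Torus2 → ℂ) (I J : DyadicInterval) :
    ℝ≥0∞ := ENNReal.ofReal (‖coeff φ₁ φ₂ f I J‖ / √(len I * len J))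

section Slices

variable {C₁ C₂ : ℝ≥0} {φ₁ φ₂ : DyadicInterval → UnitAddCircle → ℂ} {f : Torus2 → ℂ}

lemma stronglyMeasurable_mul_conj {φ : DyadicInterval → UnitAddCircle → ℂ} {C : ℝ≥0}
    (h : Good C φ) (J : DyadicInterval) (hf : Measurable f) {e : Torus2 → UnitAddCircle}
    (he : Continuous e) : StronglyMeasurable fun z : Torus2 => φ J (e z) * conj (f z) :=
  (((h.cont J).comp he).measurable.mul
    (Complex.continuous_conj.measurable.comp hf)).stronglyMeasurable

lemma integrable_conj {X : Type*} [MeasurableSpace X] {μ : Measure X} {g : X → ℂ}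
    (hg : Integrable g μ) : Integrable (fun x => conj (g x)) μ :=
  hg.congr' (Complex.continuous_conj.comp_aestronglyMeasurable hg.aestronglyMeasurable)
    (Filter.Eventually.of_forall fun x => by simp)

lemma integrable_mul_conj {φ : DyadicInterval → UnitAddCircle → ℂ} {C : ℝ≥0}
    (h : Good C φ) (J : DyadicInterval) (hf : Integrable f) {e : Torus2 → UnitAddCircle}
    (he : Continuous e) : Integrable fun z : Torus2 => φ J (e z) * conj (f z) := by
  refine (integrable_conj hf).bdd_mul (c := (C : ℝ))
    (((h.cont J).comp he).measurable.aestronglyMeasurable)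
    (Filter.Eventually.of_forall fun z => h.norm_le J _)

lemma measurable_coeffY (h : Good C₂ φ₂) (hf : Measurable f) (J : DyadicInterval) :
    Measurable (coeffY φ₂ f J) :=
  (stronglyMeasurable_mul_conj h J hf continuous_snd).integral_prod_right'.measurable

lemma measurable_coeffX (h : Good C₁ φ₁) (hf : Measurable f) (I : DyadicInterval) :
    Measurable (coeffX φ₁ f I) :=
  (stronglyMeasurable_mul_conj h I hf continuous_fst).integral_prod_left'.measurable

lemma integrable_coeffY (h : Good C₂ φ₂) (hf : Integrable f) (J : DyadicInterval) :
    Integrable (coeffY φ₂ f J) :=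
  (integrable_mul_conj h J hf continuous_snd).integral_prod_left

lemma integrable_tensor (h1 : Good C₁ φ₁) (h2 : Good C₂ φ₂) (hf : Integrable f)
    (I J : DyadicInterval) :
    Integrable fun z : Torus2 => φ₁ I z.1 * (φ₂ J z.2 * conj (f z)) :=
  (integrable_mul_conj h2 J hf continuous_snd).bdd_mul (c := (C₁ : ℝ))
    (((h1.cont I).comp continuous_fst).measurable.aestronglyMeasurable)
    (Filter.Eventually.of_forall fun _ => h1.norm_le I _)

lemma coeff_eq (φ₁ φ₂ : DyadicInterval → UnitAddCircle → ℂ) (f : Torus2 → ℂ)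
    (I J : DyadicInterval) : coeff φ₁ φ₂ f I J =
      ((1 / √(len I * len J) : ℝ) : ℂ) * ∫ z : Torus2, φ₁ I z.1 * (φ₂ J z.2 * conj (f z)) := by
  rw [coeff, ← integral_const_mul]
  congr 1; ext z
  rw [tensor]; ring

/-- The factor `|R|^(-1/2)` in the tensor and the one in the operators combine to the `L¹`
normalization. -/
lemma mass_eq (φ₁ φ₂ : DyadicInterval → UnitAddCircle → ℂ) (f : Torus2 → ℂ)
    (I J : DyadicInterval) : mass φ₁ φ₂ f I J =
      (elen I)⁻¹ * (elen J)⁻¹ * ‖∫ z : Torus2, φ₁ I z.1 * (φ₂ J z.2 * conj (f z))‖ₑ := by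
  have hI := len_pos I
  have hJ := len_pos J
  rw [mass, coeff_eq, norm_mul, Complex.norm_real, Real.norm_eq_abs, abs_of_nonneg (by positivity),
    elen_inv, elen_inv, ← ofReal_norm, ← ENNReal.ofReal_mul (by positivity),
    ← ENNReal.ofReal_mul (by positivity)]
  congr 1
  rw [div_eq_mul_inv, mul_right_comm, ← div_eq_mul_inv, div_div,
    Real.mul_self_sqrt (by positivity)]
  congr 1
  field_simp

lemma mass_eq_coeffY (h1 : Good C₁ φ₁) (h2 : Good C₂ φ₂) (hf : Integrable f)
    (I J : DyadicInterval) : mass φ₁ φ₂ f I J =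
      (elen I)⁻¹ * (elen J)⁻¹ * ‖∫ x, φ₁ I x * coeffY φ₂ f J x‖ₑ := by
  rw [mass_eq]
  congr 2
  refine (integral_prod _ (integrable_tensor h1 h2 hf I J)).trans ?_
  simp_rw [integral_const_mul]
  rfl

lemma mass_eq_coeffX (h1 : Good C₁ φ₁) (h2 : Good C₂ φ₂) (hf : Integrable f)
    (I J : DyadicInterval) : mass φ₁ φ₂ f I J =
      (elen I)⁻¹ * (elen J)⁻¹ * ‖∫ y, φ₂ J y * coeffX φ₁ f I y‖ₑ := by
  rw [mass_eq]
  congr 2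
  refine (integral_prod_symm _ (integrable_tensor h1 h2 hf I J)).trans ?_
  congr 1; ext y
  rw [coeffX, ← integral_const_mul]
  congr 1; ext x
  ring

/-- Coefficients are dominated by the maximal function. -/
lemma Good.coeff_mul_chi_le_Mx {φ : DyadicInterval → UnitAddCircle → ℂ} {C : ℝ≥0} (h : Good C φ)
    (I : DyadicInterval) (g : UnitAddCircle → ℂ) (x : UnitAddCircle) :
    (elen I)⁻¹ * ‖∫ y, φ I y * g y‖ₑ * chi I x ≤ C * Mx (fun y => ‖g y‖ₑ) x := by
  have h1 : ‖∫ y, φ I y * g y‖ₑ ≤ C * ∫⁻ y, om I y * ‖g y‖ₑ := by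
    rw [← lintegral_const_mul' _ _ ENNReal.coe_ne_top]
    refine (enorm_integral_le_lintegral_enorm _).trans (lintegral_mono fun y => ?_)
    dsimp only
    rw [enorm_mul, ← mul_assoc]
    exact mul_le_mul_left (h.enorm_le I y) _
  calc _ ≤ (elen I)⁻¹ * (C * ∫⁻ y, om I y * ‖g y‖ₑ) * chi I x := by gcongr
    _ = C * ((elen I)⁻¹ * (∫⁻ y, om I y * ‖g y‖ₑ) * chi I x) := by ring
    _ ≤ _ := mul_le_mul_right (le_iSup (fun J => (elen J)⁻¹ * (∫⁻ y, om J y * ‖g y‖ₑ) * chi J x) I) _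

lemma measurable_Mx_snd {u : Torus2 → ℝ≥0∞} (hu : Measurable u) :
    Measurable fun z : Torus2 => Mx (fun y => u (z.1, y)) z.2 := by
  refine Measurable.iSup fun J => ?_
  have h1 : Measurable fun x : UnitAddCircle => ∫⁻ y, om J y * u (x, y) :=
    Measurable.lintegral_prod_right' (f := fun z : Torus2 => om J z.2 * u z)
      (((measurable_om J).comp measurable_snd).mul hu)
  exact ((h1.comp measurable_fst).const_mul _).mul ((measurable_chi J).comp measurable_snd)

lemma measurable_Mx_fst {u : Torus2 → ℝ≥0∞} (hu : Measurable u) :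
    Measurable fun z : Torus2 => Mx (fun x => u (x, z.2)) z.1 :=
  (measurable_Mx_snd (hu.comp measurable_swap)).comp measurable_swap

lemma Mx_mono {u v : UnitAddCircle → ℝ≥0∞} (h : ∀ x, u x ≤ v x) (x : UnitAddCircle) :
    Mx u x ≤ Mx v x := Mx_mono_ae (Filter.Eventually.of_forall h) x

lemma elen_inv_mul_chi_ne_top (I : DyadicInterval) (x : UnitAddCircle) :
    (elen I)⁻¹ * chi I x ≠ ⊤ :=
  ENNReal.mul_ne_top (ENNReal.inv_ne_top.2 (elen_ne_zero I))
    (ne_top_of_le_ne_top ENNReal.one_ne_top (chi_le_one I x))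

/-! ### Inner square functions -/

/-- The pairing conjugates `f`, so the slices enter `Sq` conjugated; norms are unaffected. -/
lemma Sq_conj_snd (φ₂ : DyadicInterval → UnitAddCircle → ℂ) (f : Torus2 → ℂ) (x y : UnitAddCircle) :
    Sq φ₂ (fun y' => conj (f (x, y'))) y = l2 fun J => (elen J)⁻¹ * ‖coeffY φ₂ f J x‖ₑ * chi J y :=
  rfl

lemma Sq_conj_fst (φ₁ : DyadicInterval → UnitAddCircle → ℂ) (f : Torus2 → ℂ) (x y : UnitAddCircle) :
    Sq φ₁ (fun x' => conj (f (x', y))) x = l2 fun I => (elen I)⁻¹ * ‖coeffX φ₁ f I y‖ₑ * chi I x :=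
  rfl

lemma measurable_Sq_snd (h : Good C₂ φ₂) (hf : Measurable f) :
    Measurable fun z : Torus2 => Sq φ₂ (fun y' => conj (f (z.1, y'))) z.2 := by
  simp_rw [Sq_conj_snd]
  exact measurable_l2 fun J => (((measurable_coeffY h hf J).enorm.comp measurable_fst).const_mul _).mul
    ((measurable_chi J).comp measurable_snd)

lemma measurable_term_fst (h : Good C₁ φ₁) (hf : Measurable f) (I : DyadicInterval) :
    Measurable fun z : Torus2 => (elen I)⁻¹ * ‖coeffX φ₁ f I z.2‖ₑ * chi I z.1 :=
  (((measurable_coeffX h hf I).enorm.comp measurable_snd).const_mul _).mul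
    ((measurable_chi I).comp measurable_fst)

lemma measurable_Sq_fst (h : Good C₁ φ₁) (hf : Measurable f) :
    Measurable fun z : Torus2 => Sq φ₁ (fun x' => conj (f (x', z.2))) z.1 := by
  simp_rw [Sq_conj_fst]
  exact measurable_l2 fun I => measurable_term_fst h hf I

lemma controlled_Sq_snd (h : Good C₂ φ₂) (hz : ZeroMean φ₂) (hf : Measurable f)
    (hfi : Integrable f) :
    Controlled volume (sqA C₂) (sqS C₂) (fun z => ‖f z‖ₑ)
      (fun z : Torus2 => Sq φ₂ (fun y' => conj (f (z.1, y'))) z.2) := by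
  refine Controlled.prod (sqA_ne_top C₂) (fun p _ => sqS_ne_top C₂ p) hf.enorm
    (measurable_Sq_snd h hf) ?_
  filter_upwards [Integrable.prod_right_ae hfi] with x hx
  have h1 := controlled_Sq h hz (F := fun y => conj (f (x, y)))
    (Complex.continuous_conj.measurable.comp (hf.comp measurable_prodMk_left)).stronglyMeasurable
    (integrable_conj hx)
  simpa only [RCLike.enorm_conj] using h1

lemma controlled_Sq_fst (h : Good C₁ φ₁) (hz : ZeroMean φ₁) (hf : Measurable f)
    (hfi : Integrable f) :
    Controlled volume (sqA C₁) (sqS C₁) (fun z => ‖f z‖ₑ)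
      (fun z : Torus2 => Sq φ₁ (fun x' => conj (f (x', z.2))) z.1) := by
  refine Controlled.prod_left (sqA_ne_top C₁) (fun p _ => sqS_ne_top C₁ p) hf.enorm
    (measurable_Sq_fst h hf) ?_
  filter_upwards [Integrable.prod_left_ae hfi] with y hy
  have h1 := controlled_Sq h hz (F := fun x => conj (f (x, y)))
    (Complex.continuous_conj.measurable.comp (hf.comp measurable_prodMk_right)).stronglyMeasurable
    (integrable_conj hy)
  simpa only [RCLike.enorm_conj] using h1

lemma controlled_Mx_snd {u : Torus2 → ℝ≥0∞} (hu : Measurable u) :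
    Controlled volume maxA maxS u (fun z : Torus2 => Mx (fun y => u (z.1, y)) z.2) :=
  Controlled.prod maxA_ne_top (fun p _ => maxS_ne_top p) hu (measurable_Mx_snd hu)
    (Filter.Eventually.of_forall fun _ => controlled_Mx (hu.comp measurable_prodMk_left))

lemma controlled_Mx_fst {u : Torus2 → ℝ≥0∞} (hu : Measurable u) :
    Controlled volume maxA maxS u (fun z : Torus2 => Mx (fun x => u (x, z.2)) z.1) :=
  Controlled.prod_left maxA_ne_top (fun p _ => maxS_ne_top p) hu (measurable_Mx_fst hu)
    (Filter.Eventually.of_forall fun _ => controlled_Mx (hu.comp measurable_prodMk_right))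

end Slices


/-! ### Pointwise domination of the four operators -/

lemma ofReal_one_div_sqrt (I : DyadicInterval) :
    ENNReal.ofReal (1 / √(len I)) = ((elen I)⁻¹) ^ (1 / 2 : ℝ) := by
  have := len_pos I
  rw [elen_inv, ENNReal.ofReal_rpow_of_nonneg (by positivity) (by norm_num), ← Real.sqrt_eq_rpow,
    Real.sqrt_div zero_le_one, Real.sqrt_one]

section Operators

variable {C₁ C₂ : ℝ≥0} {φ₁ φ₂ : DyadicInterval → UnitAddCircle → ℂ}

lemma mass_sq (φ₁ φ₂ : DyadicInterval → UnitAddCircle → ℂ) (f : Torus2 → ℂ)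
    (I J : DyadicInterval) :
    mass φ₁ φ₂ f I J ^ 2 = ENNReal.ofReal (‖coeff φ₁ φ₂ f I J‖ ^ 2 / (len I * len J)) := by
  have hI := len_pos I
  have hJ := len_pos J
  rw [mass, ← ENNReal.ofReal_pow (by positivity), div_pow, Real.sq_sqrt (by positivity)]

lemma mass_sq' (φ₁ φ₂ : DyadicInterval → UnitAddCircle → ℂ) (f : Torus2 → ℂ)
    (I J : DyadicInterval) :
    mass φ₁ φ₂ f I J ^ 2 = (elen I)⁻¹ * ENNReal.ofReal (‖coeff φ₁ φ₂ f I J‖ ^ 2 / len J) := by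
  have hI := len_pos I
  have hJ := len_pos J
  rw [mass_sq, elen_inv, ← ENNReal.ofReal_mul (by positivity)]
  congr 1
  field_simp

lemma MM_eq (φ₁ φ₂ : DyadicInterval → UnitAddCircle → ℂ) (f : Torus2 → ℂ) (z : Torus2) :
    MM φ₁ φ₂ f z = ⨆ R : DyadicInterval × DyadicInterval,
      mass φ₁ φ₂ f R.1 R.2 * (chi R.1 z.1 * chi R.2 z.2) := rfl

lemma MS_eq (φ₁ φ₂ : DyadicInterval → UnitAddCircle → ℂ) (f : Torus2 → ℂ) (z : Torus2) :
    MS φ₁ φ₂ f z = ⨆ I, l2 (fun J => mass φ₁ φ₂ f I J * chi J z.2) * chi I z.1 := by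
  unfold MS l2
  congr 1; ext I
  rw [ofReal_one_div_sqrt, ← ENNReal.mul_rpow_of_nonneg _ _ (by norm_num), ← ENNReal.tsum_mul_left]
  simp_rw [mul_pow, chi_sq, mass_sq', mul_assoc]

lemma SM_eq (φ₁ φ₂ : DyadicInterval → UnitAddCircle → ℂ) (f : Torus2 → ℂ) (z : Torus2) :
    SM φ₁ φ₂ f z = l2 fun I => ⨆ J, mass φ₁ φ₂ f I J * chi J z.2 * chi I z.1 := by
  unfold SM l2
  congr 1
  congr 1; ext I
  have hI := len_pos I
  have h1 : ∀ J, mass φ₁ φ₂ f I J * chi J z.2 * chi I z.1 = ENNReal.ofReal (1 / √(len I)) *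
      chi I z.1 * (ENNReal.ofReal (‖coeff φ₁ φ₂ f I J‖ / √(len J)) * chi J z.2) := by
    intro J
    have hJ := len_pos J
    have h2 : mass φ₁ φ₂ f I J = ENNReal.ofReal (1 / √(len I)) *
        ENNReal.ofReal (‖coeff φ₁ φ₂ f I J‖ / √(len J)) := by
      rw [mass, ← ENNReal.ofReal_mul (by positivity), Real.sqrt_mul hI.le]
      congr 1
      field_simp
    rw [h2]; ring
  simp_rw [h1]
  rw [← ENNReal.mul_iSup, mul_pow, mul_pow, chi_sq, ofReal_one_div_sqrt, rpow_half_sq, elen_inv]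
  ring

lemma SS_eq (φ₁ φ₂ : DyadicInterval → UnitAddCircle → ℂ) (f : Torus2 → ℂ) (z : Torus2) :
    SS φ₁ φ₂ f z = l2 fun R : DyadicInterval × DyadicInterval =>
      mass φ₁ φ₂ f R.1 R.2 * (chi R.1 z.1 * chi R.2 z.2) := by
  unfold SS l2
  simp_rw [mul_pow, chi_sq, mass_sq]

lemma measurable_chi_fst (I : DyadicInterval) : Measurable fun z : Torus2 => chi I z.1 :=
  (measurable_chi I).comp measurable_fst

lemma measurable_chi_snd (J : DyadicInterval) : Measurable fun z : Torus2 => chi J z.2 :=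
  (measurable_chi J).comp measurable_snd

lemma measurable_MM (φ₁ φ₂ : DyadicInterval → UnitAddCircle → ℂ) (f : Torus2 → ℂ) :
    Measurable (MM φ₁ φ₂ f) :=
  Measurable.iSup fun _ => ((measurable_chi_fst _).mul (measurable_chi_snd _)).const_mul _

lemma measurable_MS (φ₁ φ₂ : DyadicInterval → UnitAddCircle → ℂ) (f : Torus2 → ℂ) :
    Measurable (MS φ₁ φ₂ f) := by
  rw [funext (MS_eq φ₁ φ₂ f)]
  exact Measurable.iSup fun I => (measurable_l2 fun J => (measurable_chi_snd J).const_mul _).mul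
    (measurable_chi_fst I)

lemma measurable_SM (φ₁ φ₂ : DyadicInterval → UnitAddCircle → ℂ) (f : Torus2 → ℂ) :
    Measurable (SM φ₁ φ₂ f) := by
  rw [funext (SM_eq φ₁ φ₂ f)]
  exact measurable_l2 fun I => Measurable.iSup fun J =>
    ((measurable_chi_snd J).const_mul _).mul (measurable_chi_fst I)

lemma measurable_SS (φ₁ φ₂ : DyadicInterval → UnitAddCircle → ℂ) (f : Torus2 → ℂ) :
    Measurable (SS φ₁ φ₂ f) := by
  rw [funext (SS_eq φ₁ φ₂ f)]
  exact measurable_l2 fun R => ((measurable_chi_fst _).mul (measurable_chi_snd _)).const_mul _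

/-- Integrate in `y` first: the slice coefficients are dominated by `Mx` in `y`, and the outer
integral by `Mx` in `x` of the result. -/
lemma admissible_MM (h1 : Good C₁ φ₁) (h2 : Good C₂ φ₂) :
    Admissible (C₁ * C₂) maxA maxA maxS maxS (MM φ₁ φ₂) := by
  refine ⟨fun f g h => ?_, measurable_MM φ₁ φ₂, fun f hf hfi => ?_⟩
  · unfold MM; rw [coeff_congr φ₁ φ₂ h]
  have hm1 := measurable_Mx_snd hf.enorm
  refine ⟨_, _, hm1, measurable_Mx_fst hm1, controlled_Mx_snd hf.enorm, controlled_Mx_fst hm1,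
    fun z => ?_⟩
  rw [MM_eq]
  refine iSup_le fun ⟨I, J⟩ => ?_
  have hk := elen_inv_mul_chi_ne_top J z.2
  dsimp only
  rw [mass_eq_coeffY h1 h2 hfi]
  calc _ = (elen J)⁻¹ * chi J z.2 *
          ((elen I)⁻¹ * ‖∫ x, φ₁ I x * coeffY φ₂ f J x‖ₑ * chi I z.1) := by ring
    _ ≤ (elen J)⁻¹ * chi J z.2 * (C₁ * Mx (fun x => ‖coeffY φ₂ f J x‖ₑ) z.1) :=
        mul_le_mul_right (h1.coeff_mul_chi_le_Mx I _ _) _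
    _ = C₁ * Mx (fun x => (elen J)⁻¹ * chi J z.2 * ‖coeffY φ₂ f J x‖ₑ) z.1 := by
        rw [Mx_const_mul hk]; ring
    _ ≤ C₁ * Mx (fun x => C₂ * Mx (fun y => ‖f (x, y)‖ₑ) z.2) z.1 := by
        refine mul_le_mul_right (Mx_mono (fun x => ?_) _) _
        have := h2.coeff_mul_chi_le_Mx J (fun y => conj (f (x, y))) z.2
        simp only [RCLike.enorm_conj] at this
        refine le_trans (le_of_eq ?_) this
        rw [coeffY]; ring
    _ = _ := by rw [Mx_const_mul ENNReal.coe_ne_top]; ring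

/-- Minkowski's inequality moves the `ℓ²` norm over `J` inside the `x`-integral against `om I`. What
remains is the square function in `y` under the maximal function in `x`. -/
lemma admissible_MS (h1 : Good C₁ φ₁) (h2 : Good C₂ φ₂) (hz : ZeroMean φ₂) :
    Admissible C₁ (sqA C₂) maxA (sqS C₂) maxS (MS φ₁ φ₂) := by
  refine ⟨fun f g h => ?_, measurable_MS φ₁ φ₂, fun f hf hfi => ?_⟩
  · unfold MS; rw [coeff_congr φ₁ φ₂ h]
  have hm1 := measurable_Sq_snd h2 hf
  refine ⟨_, _, hm1, measurable_Mx_fst hm1, controlled_Sq_snd h2 hz hf hfi,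
    controlled_Mx_fst hm1, fun z => ?_⟩
  rw [MS_eq]
  refine iSup_le fun I => ?_
  simp_rw [mass_eq_coeffY h1 h2 hfi, Sq_conj_snd]
  have hJ : ∀ J, (elen I)⁻¹ * (elen J)⁻¹ * ‖∫ x, φ₁ I x * coeffY φ₂ f J x‖ₑ * chi J z.2 ≤
      (elen I)⁻¹ * ∫⁻ x, C₁ * om I x * ((elen J)⁻¹ * ‖coeffY φ₂ f J x‖ₑ * chi J z.2) := by
    intro J
    have hk := elen_inv_mul_chi_ne_top J z.2
    calc (elen I)⁻¹ * (elen J)⁻¹ * ‖∫ x, φ₁ I x * coeffY φ₂ f J x‖ₑ * chi J z.2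
        = (elen I)⁻¹ * ((elen J)⁻¹ * chi J z.2 * ‖∫ x, φ₁ I x * coeffY φ₂ f J x‖ₑ) := by ring
      _ ≤ (elen I)⁻¹ * ((elen J)⁻¹ * chi J z.2 *
            ∫⁻ x, C₁ * om I x * ‖coeffY φ₂ f J x‖ₑ) := by
          refine mul_le_mul_right (mul_le_mul_right ?_ _) _
          refine (enorm_integral_le_lintegral_enorm _).trans (lintegral_mono fun x => ?_)
          dsimp only
          rw [enorm_mul]
          exact mul_le_mul_left (h1.enorm_le I x) _
      _ = _ := by
          rw [← lintegral_const_mul' _ _ hk]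
          congr 2; ext x; ring
  have hmJ : ∀ J, Measurable fun x =>
      C₁ * om I x * ((elen J)⁻¹ * ‖coeffY φ₂ f J x‖ₑ * chi J z.2) := fun J =>
    ((measurable_om I).const_mul _).mul
      (((measurable_coeffY h2 hf J).enorm.const_mul _).mul_const _)
  calc _ ≤ l2 (fun J => (elen I)⁻¹ *
          ∫⁻ x, C₁ * om I x * ((elen J)⁻¹ * ‖coeffY φ₂ f J x‖ₑ * chi J z.2)) * chi I z.1 :=
        mul_le_mul_left (l2_mono hJ) _
    _ ≤ (elen I)⁻¹ * (∫⁻ x, l2 fun J =>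
          C₁ * om I x * ((elen J)⁻¹ * ‖coeffY φ₂ f J x‖ₑ * chi J z.2)) * chi I z.1 := by
        rw [l2_const_mul]
        exact mul_le_mul_left (mul_le_mul_right (l2_lintegral_le hmJ) _) _
    _ = C₁ * ((elen I)⁻¹ * (∫⁻ x, om I x * l2 fun J =>
          (elen J)⁻¹ * ‖coeffY φ₂ f J x‖ₑ * chi J z.2) * chi I z.1) := by
        simp_rw [l2_const_mul, mul_assoc (C₁ : ℝ≥0∞)]
        rw [lintegral_const_mul' _ _ ENNReal.coe_ne_top]
        ring
    _ ≤ _ := mul_le_mul_right (le_iSup (fun I => (elen I)⁻¹ * (∫⁻ x, om I x * l2 fun J =>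
          (elen J)⁻¹ * ‖coeffY φ₂ f J x‖ₑ * chi J z.2) * chi I z.1) I) _

/-- The supremum over `J` acts on each term of the sum over `I`, so a scalar maximal function of the
square function would not dominate. For fixed `x` the terms of the square function in `x` form a
sequence of functions of `y`, to which the vector-valued maximal inequality applies. -/
lemma admissible_SM (h1 : Good C₁ φ₁) (h2 : Good C₂ φ₂) (hz : ZeroMean φ₁) :
    Admissible C₂ (sqA C₁) maxA (sqS C₁) maxS (SM φ₁ φ₂) := by
  refine ⟨fun f g h => ?_, measurable_SM φ₁ φ₂, fun f hf hfi => ?_⟩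
  · unfold SM; rw [coeff_congr φ₁ φ₂ h]
  have hm1 := measurable_Sq_fst h1 hf
  have hv1 := controlled_Sq_fst h1 hz hf hfi
  simp_rw [Sq_conj_fst] at hm1 hv1
  have hm2 : Measurable fun z : Torus2 => l2 fun I =>
      Mx (fun y => (elen I)⁻¹ * ‖coeffX φ₁ f I y‖ₑ * chi I z.1) z.2 :=
    measurable_l2 fun I => measurable_Mx_snd
      (u := fun z => (elen I)⁻¹ * ‖coeffX φ₁ f I z.2‖ₑ * chi I z.1) (measurable_term_fst h1 hf I)
  refine ⟨_, _, hm1, hm2, hv1, ?_, fun z => ?_⟩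
  · refine Controlled.prod maxA_ne_top (fun p _ => maxS_ne_top p) hm1 hm2
      (Filter.Eventually.of_forall fun x => ?_)
    exact controlled_l2_Mx (N := fun I y => (elen I)⁻¹ * ‖coeffX φ₁ f I y‖ₑ * chi I x)
      fun I => ((measurable_coeffX h1 hf I).enorm.const_mul _).mul_const _
  · rw [SM_eq, ← l2_const_mul]
    refine l2_mono fun I => iSup_le fun J => ?_
    have hk := elen_inv_mul_chi_ne_top I z.1
    rw [mass_eq_coeffX h1 h2 hfi]
    calc _ = (elen I)⁻¹ * chi I z.1 *
          ((elen J)⁻¹ * ‖∫ y, φ₂ J y * coeffX φ₁ f I y‖ₑ * chi J z.2) := by ring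
      _ ≤ (elen I)⁻¹ * chi I z.1 * (C₂ * Mx (fun y => ‖coeffX φ₁ f I y‖ₑ) z.2) :=
          mul_le_mul_right (h2.coeff_mul_chi_le_Mx J _ _) _
      _ = C₂ * ((elen I)⁻¹ * chi I z.1 * Mx (fun y => ‖coeffX φ₁ f I y‖ₑ) z.2) := by ring
      _ = _ := by
          rw [← Mx_const_mul hk]
          simp_rw [mul_right_comm]

/-- The vector of weighted slice coefficients over a finite family. -/
def sliceVec (φ₂ : DyadicInterval → UnitAddCircle → ℂ) (f : Torus2 → ℂ) (s : Finset DyadicInterval)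
    (y x : UnitAddCircle) : EuclideanSpace ℂ s :=
  WithLp.toLp 2 fun J : s => ((((elen J)⁻¹ * chi J y).toReal : ℝ) : ℂ) * coeffY φ₂ f J x

lemma enorm_sq_euclidean {ι : Type*} [Fintype ι] (v : EuclideanSpace ℂ ι) :
    ‖v‖ₑ ^ 2 = ∑ i, ‖v i‖ₑ ^ 2 := by
  simp_rw [← ofReal_norm_sq]
  rw [EuclideanSpace.norm_sq_eq, ENNReal.ofReal_sum_of_nonneg fun i _ => by positivity]

lemma enorm_toReal_ofReal {a : ℝ≥0∞} (ha : a ≠ ⊤) : ‖((a.toReal : ℝ) : ℂ)‖ₑ = a := by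
  rw [← ofReal_norm, Complex.norm_real, Real.norm_eq_abs, abs_of_nonneg ENNReal.toReal_nonneg,
    ENNReal.ofReal_toReal ha]

lemma enorm_sliceVec_sq (φ₂ : DyadicInterval → UnitAddCircle → ℂ) (f : Torus2 → ℂ)
    (s : Finset DyadicInterval) (y x : UnitAddCircle) : ‖sliceVec φ₂ f s y x‖ₑ ^ 2 =
      ∑ J ∈ s, ((elen J)⁻¹ * ‖coeffY φ₂ f J x‖ₑ * chi J y) ^ 2 := by
  rw [enorm_sq_euclidean, ← Finset.sum_coe_sort s]
  refine Finset.sum_congr rfl fun J _ => ?_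
  rw [sliceVec]
  dsimp only
  rw [enorm_mul, enorm_toReal_ofReal (elen_inv_mul_chi_ne_top _ _)]
  ring

lemma measurable_sliceVec {f : Torus2 → ℂ} (h : Good C₂ φ₂) (hf : Measurable f)
    (s : Finset DyadicInterval) (y : UnitAddCircle) : Measurable (sliceVec φ₂ f s y) :=
  (WithLp.measurable_toLp 2 _).comp
    (measurable_pi_lambda _ fun J => (measurable_coeffY h hf J).const_mul _)

lemma integrable_sliceVec {f : Torus2 → ℂ} (h : Good C₂ φ₂) (hf : Measurable f)
    (hfi : Integrable f) (s : Finset DyadicInterval) (y : UnitAddCircle) :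
    Integrable (sliceVec φ₂ f s y) := by
  have h1 : Integrable fun x => ∑ J : s, ‖((((elen J)⁻¹ * chi J y).toReal : ℝ) : ℂ) *
      coeffY φ₂ f J x‖ :=
    integrable_finsetSum _ fun J _ => ((integrable_coeffY h hfi J).const_mul _).norm
  refine h1.mono' (measurable_sliceVec h hf s y).aestronglyMeasurable
    (Filter.Eventually.of_forall fun x => ?_)
  rw [EuclideanSpace.norm_eq]
  refine Real.sqrt_le_iff.2 ⟨Finset.sum_nonneg fun J _ => norm_nonneg _, ?_⟩
  exact Finset.sum_sq_le_sq_sum_of_nonneg fun J _ => norm_nonneg _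

lemma enorm_integral_sliceVec_sq {f : Torus2 → ℂ} (h1 : Good C₁ φ₁) (h : Good C₂ φ₂)
    (hf : Measurable f) (hfi : Integrable f) (s : Finset DyadicInterval) (I : DyadicInterval)
    (y : UnitAddCircle) : ‖∫ x, φ₁ I x • sliceVec φ₂ f s y x‖ₑ ^ 2 =
      ∑ J ∈ s, ((elen J)⁻¹ * chi J y * ‖∫ x, φ₁ I x * coeffY φ₂ f J x‖ₑ) ^ 2 := by
  rw [enorm_sq_euclidean, ← Finset.sum_coe_sort s]
  refine Finset.sum_congr rfl fun J _ => ?_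
  have e1 := (EuclideanSpace.proj (𝕜 := ℂ) J).integral_comp_comm
    (h1.integrable_smul I (integrable_sliceVec h hf hfi s y))
  have e2 : ∀ x, (EuclideanSpace.proj (𝕜 := ℂ) J) (φ₁ I x • sliceVec φ₂ f s y x) =
      ((((elen J)⁻¹ * chi J y).toReal : ℝ) : ℂ) * (φ₁ I x * coeffY φ₂ f J x) := by
    intro x
    simp [sliceVec]
    ring
  simp_rw [e2] at e1
  rw [integral_const_mul] at e1
  rw [← enorm_toReal_ofReal (elen_inv_mul_chi_ne_top J y), ← enorm_mul, e1]
  rfl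

/-- The square function in the first variable of a finite part of the slice coefficients. -/
def partialSS (φ₁ φ₂ : DyadicInterval → UnitAddCircle → ℂ) (f : Torus2 → ℂ)
    (s : Finset DyadicInterval) (z : Torus2) : ℝ≥0∞ :=
  (∑ J ∈ s, ∑' I, (mass φ₁ φ₂ f I J * (chi I z.1 * chi J z.2)) ^ 2) ^ (1 / 2 : ℝ)

lemma measurable_partialSS (φ₁ φ₂ : DyadicInterval → UnitAddCircle → ℂ) (f : Torus2 → ℂ)
    (s : Finset DyadicInterval) : Measurable (partialSS φ₁ φ₂ f s) :=
  (Finset.measurable_fun_sum _ fun J _ => Measurable.tsum fun I =>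
    (((measurable_chi_fst I).mul (measurable_chi_snd J)).const_mul _).pow_const 2).pow_const _

/-- Restricting `J` to finite sets keeps the target a finite-dimensional Hilbert space; the directed
supremum loses nothing. -/
lemma SS_eq_iSup (φ₁ φ₂ : DyadicInterval → UnitAddCircle → ℂ) (f : Torus2 → ℂ) :
    SS φ₁ φ₂ f = fun z => ⨆ s, partialSS φ₁ φ₂ f s z := by
  ext z
  rw [SS_eq, l2, ENNReal.tsum_prod (f := fun I J =>
    (mass φ₁ φ₂ f I J * (chi I z.1 * chi J z.2)) ^ 2), ENNReal.tsum_comm, ENNReal.tsum_eq_iSup_sum]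
  exact (ENNReal.orderIsoRpow (1 / 2 : ℝ) (by norm_num)).map_iSup _

/-- The Euclidean norm of the vector of `y`-coefficients absorbs the sum over `J`, leaving a
one-parameter square function in `x`. -/
lemma partialSS_eq_Sq {f : Torus2 → ℂ} (h1 : Good C₁ φ₁) (h2 : Good C₂ φ₂) (hf : Measurable f)
    (hfi : Integrable f) (s : Finset DyadicInterval) (x y : UnitAddCircle) :
    partialSS φ₁ φ₂ f s (x, y) = Sq φ₁ (sliceVec φ₂ f s y) x := by
  unfold partialSS Sq l2
  congr 1
  simp_rw [mul_pow, enorm_integral_sliceVec_sq h1 h2 hf hfi, mass_eq_coeffY h1 h2 hfi]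
  rw [← Summable.tsum_finsetSum fun _ _ => ENNReal.summable]
  congr 1; ext I
  rw [Finset.mul_sum, Finset.sum_mul]
  refine Finset.sum_congr rfl fun J _ => ?_
  ring

/-- The vector-valued bounds do not depend on the finite set, and the norm of the truncated vector
is at most the full square function in `y`. Hence `SS f` itself serves as the second function, with
constant 1. -/
lemma admissible_SS (h1 : Good C₁ φ₁) (h2 : Good C₂ φ₂) (hz1 : ZeroMean φ₁) (hz2 : ZeroMean φ₂) :
    Admissible 1 (sqA C₂) (sqA C₁) (sqS C₂) (sqS C₁) (SS φ₁ φ₂) := by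
  refine ⟨fun f g h => ?_, measurable_SS φ₁ φ₂, fun f hf hfi => ?_⟩
  · unfold SS; rw [coeff_congr φ₁ φ₂ h]
  have hm1 := measurable_Sq_snd h2 hf
  have hv1 := controlled_Sq_snd h2 hz2 hf hfi
  simp_rw [Sq_conj_snd] at hm1 hv1
  refine ⟨_, SS φ₁ φ₂ f, hm1, measurable_SS φ₁ φ₂ f, hv1, ?_,
    fun z => by rw [one_mul]⟩
  rw [SS_eq_iSup]
  refine Controlled.iSup (measurable_partialSS φ₁ φ₂ f) ?_ fun s => ?_
  · refine Monotone.directed_le fun s t hst z => ?_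
    unfold partialSS
    gcongr
  · refine Controlled.prod_left (sqA_ne_top C₁) (fun p _ => sqS_ne_top C₁ p) hm1
      (measurable_partialSS φ₁ φ₂ f s) (Filter.Eventually.of_forall fun y => ?_)
    simp_rw [partialSS_eq_Sq h1 h2 hf hfi]
    have hm : Measurable fun x => l2 fun J => (elen J)⁻¹ * ‖coeffY φ₂ f J x‖ₑ * chi J y :=
      measurable_l2 fun J => ((measurable_coeffY h2 hf J).enorm.const_mul _).mul_const _
    have hc := controlled_Sq h1 hz1 (measurable_sliceVec h2 hf s y).stronglyMeasurable
      (integrable_sliceVec h2 hf hfi s y)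
    refine hc.mono_left (measurable_sliceVec h2 hf s y).enorm hm fun x => ?_
    rw [← ENNReal.pow_le_pow_left_iff two_ne_zero, enorm_sliceVec_sq, l2_sq]
    exact ENNReal.sum_le_tsum s

end Operators


/-! ### Finiteness of the constants and conclusion -/

lemma strong_const_ne_top {c a b : ℝ≥0∞} (hc : c ≠ ⊤) (ha : a ≠ ⊤) (hb : b ≠ ⊤) {r : ℝ}
    (hr : 0 ≤ r) : (c ^ r * (b * a)) ^ (1 / r) ≠ ⊤ :=
  ENNReal.rpow_ne_top_of_nonneg (by positivity) (ENNReal.mul_ne_top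
    (ENNReal.rpow_ne_top_of_nonneg hr hc) (ENNReal.mul_ne_top hb ha))

lemma weak_const_ne_top {c a b : ℝ≥0∞} (hc : c ≠ ⊤) (ha : a ≠ ⊤) (hb : b ≠ ⊤) :
    (c + 1) * (b * (1 + 2 * a)) ≠ ⊤ := by finiteness

lemma exists_common_bound {a b c d : ℝ≥0∞} (ha : a ≠ ⊤) (hb : b ≠ ⊤) (hc : c ≠ ⊤) (hd : d ≠ ⊤) :
    ∃ K : ℝ≥0, a ≤ K ∧ b ≤ K ∧ c ≤ K ∧ d ≤ K := by
  refine ⟨(a ⊔ b ⊔ c ⊔ d).toNNReal, ?_⟩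
  rw [ENNReal.coe_toNNReal (by simp [ha, hb, hc, hd])]
  simp

end HybridMaxSquare

end

theorem mainTheorem6 (C₁ C₂ : ℕ → ℝ) :
    (∀ p : ENNReal, 1 < p → p < ⊤ →
      ∃ K : NNReal, ∀ φ₁ φ₂ : HybridMaxSquare.DyadicInterval → UnitAddCircle → ℂ,
        HybridMaxSquare.IsAdaptedFamily C₁ φ₁ → HybridMaxSquare.IsAdaptedFamily C₂ φ₂ →
          HybridMaxSquare.BoundedLp p K (HybridMaxSquare.MM φ₁ φ₂) ∧
          (HybridMaxSquare.ZeroMean φ₂ →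
            HybridMaxSquare.BoundedLp p K (HybridMaxSquare.MS φ₁ φ₂)) ∧
          (HybridMaxSquare.ZeroMean φ₁ →
            HybridMaxSquare.BoundedLp p K (HybridMaxSquare.SM φ₁ φ₂)) ∧
          (HybridMaxSquare.ZeroMean φ₁ → HybridMaxSquare.ZeroMean φ₂ →
            HybridMaxSquare.BoundedLp p K (HybridMaxSquare.SS φ₁ φ₂))) ∧
    (∃ K : NNReal, ∀ φ₁ φ₂ : HybridMaxSquare.DyadicInterval → UnitAddCircle → ℂ,
        HybridMaxSquare.IsAdaptedFamily C₁ φ₁ → HybridMaxSquare.IsAdaptedFamily C₂ φ₂ →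
          HybridMaxSquare.BoundedLlogLWeakL1 K (HybridMaxSquare.MM φ₁ φ₂) ∧
          (HybridMaxSquare.ZeroMean φ₂ →
            HybridMaxSquare.BoundedLlogLWeakL1 K (HybridMaxSquare.MS φ₁ φ₂)) ∧
          (HybridMaxSquare.ZeroMean φ₁ →
            HybridMaxSquare.BoundedLlogLWeakL1 K (HybridMaxSquare.SM φ₁ φ₂)) ∧
          (HybridMaxSquare.ZeroMean φ₁ → HybridMaxSquare.ZeroMean φ₂ →
            HybridMaxSquare.BoundedLlogLWeakL1 K (HybridMaxSquare.SS φ₁ φ₂))) := by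
  -- Only the fifth-order size constant and the second-order derivative constant enter, so the
  -- bounds are uniform over all families with the given constants.
  set D₁ : ℝ≥0 := (max (C₁ 5) (C₁ 2)).toNNReal
  set D₂ : ℝ≥0 := (max (C₂ 5) (C₂ 2)).toNNReal
  have hD₁ : (D₁ : ℝ≥0∞) ≠ ⊤ := ENNReal.coe_ne_top
  have hD₂ : (D₂ : ℝ≥0∞) ≠ ⊤ := ENNReal.coe_ne_top
  have hD : (D₁ : ℝ≥0∞) * D₂ ≠ ⊤ := ENNReal.mul_ne_top hD₁ hD₂
  have hA₁ := HybridMaxSquare.sqA_ne_top D₁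
  have hA₂ := HybridMaxSquare.sqA_ne_top D₂
  have hM := HybridMaxSquare.maxA_ne_top
  constructor
  · intro p hp hpt
    have hr : 0 ≤ p.toReal := ENNReal.toReal_nonneg
    have hS₁ := HybridMaxSquare.sqS_ne_top D₁ p.toReal
    have hS₂ := HybridMaxSquare.sqS_ne_top D₂ p.toReal
    have hN := HybridMaxSquare.maxS_ne_top p.toReal
    obtain ⟨K, h1, h2, h3, h4⟩ := HybridMaxSquare.exists_common_bound
      (HybridMaxSquare.strong_const_ne_top hD hN hN hr)
      (HybridMaxSquare.strong_const_ne_top hD₁ hS₂ hN hr)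
      (HybridMaxSquare.strong_const_ne_top hD₂ hS₁ hN hr)
      (HybridMaxSquare.strong_const_ne_top ENNReal.one_ne_top hS₂ hS₁ hr)
    exact ⟨K, fun φ₁ φ₂ hφ₁ hφ₂ =>
      ⟨(HybridMaxSquare.admissible_MM hφ₁.good hφ₂.good).boundedLp hp hpt.ne h1,
      fun hz => (HybridMaxSquare.admissible_MS hφ₁.good hφ₂.good hz).boundedLp hp hpt.ne h2,
      fun hz => (HybridMaxSquare.admissible_SM hφ₁.good hφ₂.good hz).boundedLp hp hpt.ne h3,
      fun hz hz' =>
        (HybridMaxSquare.admissible_SS hφ₁.good hφ₂.good hz hz').boundedLp hp hpt.ne h4⟩⟩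
  · obtain ⟨K, h1, h2, h3, h4⟩ := HybridMaxSquare.exists_common_bound
      (HybridMaxSquare.weak_const_ne_top hD hM hM)
      (HybridMaxSquare.weak_const_ne_top hD₁ hA₂ hM)
      (HybridMaxSquare.weak_const_ne_top hD₂ hA₁ hM)
      (HybridMaxSquare.weak_const_ne_top ENNReal.one_ne_top hA₂ hA₁)
    exact ⟨K, fun φ₁ φ₂ hφ₁ hφ₂ =>
      ⟨(HybridMaxSquare.admissible_MM hφ₁.good hφ₂.good).boundedLlogL hM hD h1,
      fun hz => (HybridMaxSquare.admissible_MS hφ₁.good hφ₂.good hz).boundedLlogL hA₂ hD₁ h2,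
      fun hz => (HybridMaxSquare.admissible_SM hφ₁.good hφ₂.good hz).boundedLlogL hA₁ hD₂ h3,
      fun hz hz' => (HybridMaxSquare.admissible_SS hφ₁.good hφ₂.good hz hz').boundedLlogL hA₂
        ENNReal.one_ne_top h4⟩⟩
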